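/- Let $n\ge 3$. For $E\subset\mathbb R^n$ let $\gamma(E)=(2\pi)^{-n/2}\int_E e^{-|x|^2/2}\,dx$, let $B_r$ be the ball of radius $r$ centered at the origin, and let $\psi(s)=\frac1{\sqrt{2\pi}}\int_{-\infty}^s e^{-t^2/2}\,dt$ (the Gaussian volume of a half-space $\{x_1\le s\}$). A set $E$ is of class $C^2$ (respectively $C^{1,1}$) if near each of its boundary points it is, in suitable orthonormal coordinates, the subgraph of a function $u:\mathbb R^{n-1}\to\mathbb R$ that is $C^2$ (respectively $C^1$ with Lipschitz gradient). For such a set, $\nu=\nu_{\partial E}$ denotes the exterior unit normal and $H_{\partial E}=\operatorname{div}_\tau\nu_{\partial E}$ the mean curvature of $\partial E$ (the sum of the principal curvatures, defined $\mathcal H^{n-1}$-almost everywhere on $\partial E$ if $E$ is only $C^{1,1}$), and $$\mathcal H(E)=\int_{\partial E}H_{\partial E}\,e^{-|x|^2/2}\,d\mathcal H^{n-1}.$$ (i) Let $M>0$ and $m\ge\max\{\psi(2M),\psi(\sqrt{n-2})\}$. If $E$ is a convex set of class $C^2$ containing the origin with $\gamma(E)=\gamma(B_r)=m$ and $\|H_{\partial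 E}\|_{L^\infty(\partial E)}\le M$, then $\mathcal H(E)$ is finite and $$\mathcal H(E)\le\mathcal H(B_r).$$ (ii) Let $m\ge\psi(\sqrt{n-2})$. If $E$ is a convex set of class $C^{1,1}$ containing the origin with $\gamma(E)=\gamma(B_r)=m$ and $\mathcal H(E)<\infty$, then $$\int_{\partial E}\frac{\langle x,\nu\rangle}{|x|}\,H_{\partial E}\,e^{-|x|^2/2}\,d\mathcal H^{n-1}\le\int_{\partial B_r}\frac{\langle x,\nu\rangle}{|x|}\,H_{\partial B_r}\,e^{-|x|^2/2}\,d\mathcal H^{n-1},$$ where the integral on the left converges absolutely. -/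

import Mathlib

open MeasureTheory Set Filter Topology

noncomputable section

namespace GaussianCurvature

/-- `ℝⁿ` with its Euclidean norm. -/
abbrev Space (n : ℕ) : Type := EuclideanSpace ℝ (Fin n)

/-- The Gaussian volume `γ(E) = (2π)^{-n/2} ∫_E e^{-|x|²/2} dx`. -/
def gaussianVolume {n : ℕ} (E : Set (Space n)) : ℝ :=
  1 / (2 * Real.pi) ^ ((n : ℝ) / 2) * ∫ x in E, Real.exp (-‖x‖ ^ 2 / 2)

/-- The Gaussian volume `ψ(s) = (2π)^{-1/2} ∫_{-∞}^s e^{-t²/2} dt` of the half-space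
`{x₁ ≤ s}`. -/
def psi (s : ℝ) : ℝ :=
  1 / Real.sqrt (2 * Real.pi) * ∫ t in Iic s, Real.exp (-t ^ 2 / 2)

/-- Near the point `x₀`, the set `E` is the subgraph in direction `e` of the function `u`, which
is defined on the hyperplane orthogonal to `e`: in some neighbourhood of `x₀` the interior of `E`
is the set strictly below the graph and the boundary of `E` is the graph. -/
def IsSubgraphNear {n : ℕ} (E : Set (Space n)) (x₀ e : Space n)
    (u : (Submodule.span ℝ {e})ᗮ → ℝ) : Prop :=
  ∀ᶠ y in 𝓝 x₀,
    (y ∈ interior E ↔ inner ℝ e y < u ((Submodule.span ℝ {e})ᗮ.orthogonalProjectionOnto y)) ∧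
    (y ∈ frontier E ↔ inner ℝ e y = u ((Submodule.span ℝ {e})ᗮ.orthogonalProjectionOnto y))

/-- Sets of class `C²`: locally at each boundary point the subgraph, in a suitable direction, of a
`C²` function on a hyperplane. -/
def IsClassC2 {n : ℕ} (E : Set (Space n)) : Prop :=
  ∀ x₀ ∈ frontier E, ∃ e : Space n, ‖e‖ = 1 ∧ ∃ u : (Submodule.span ℝ {e})ᗮ → ℝ,
    ContDiff ℝ 2 u ∧ IsSubgraphNear E x₀ e u

/-- Sets of class `C^{1,1}`: locally at each boundary point the subgraph, in a suitable direction,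
of a `C¹` function with Lipschitz derivative on a hyperplane. The Lipschitz constant may depend on
the boundary point. -/
def IsClassC11 {n : ℕ} (E : Set (Space n)) : Prop :=
  ∀ x₀ ∈ frontier E, ∃ e : Space n, ‖e‖ = 1 ∧ ∃ u : (Submodule.span ℝ {e})ᗮ → ℝ,
    (ContDiff ℝ 1 u ∧ ∃ K : NNReal, LipschitzWith K (fderiv ℝ u)) ∧ IsSubgraphNear E x₀ e u

/-- `v` is an exterior unit normal to `E` at `x`: close to `x`, the set `E` contains every cone
`⟨y - x, v⟩ < -ε |y - x|` and misses every cone `⟨y - x, v⟩ > ε |y - x|`. Such a `v` is unique,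
and it exists at each boundary point of a set whose boundary is locally a `C¹` subgraph. -/
def IsExteriorNormal {n : ℕ} (E : Set (Space n)) (x v : Space n) : Prop :=
  ‖v‖ = 1 ∧ ∀ ε : ℝ, 0 < ε → ∀ᶠ y in 𝓝 x,
    (inner ℝ (y - x) v < -ε * ‖y - x‖ → y ∈ E) ∧
    (ε * ‖y - x‖ < inner ℝ (y - x) v → y ∉ E)

open Classical in
/-- The exterior unit normal `ν_{∂E}` (with value `0` at points without a normal). -/
def normal {n : ℕ} (E : Set (Space n)) (x : Space n) : Space n :=
  if h : ∃ v, IsExteriorNormal E x v then h.choose else 0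

/-- The tangential divergence `div_τ X = ∑ᵢ ⟨∇_{τᵢ} X, τᵢ⟩` on `∂E`, where `(τᵢ)` is an orthonormal
basis of the tangent space, the orthogonal complement of the normal. The derivative is taken along
`∂E`; its values on tangent vectors do not depend on how `X` is extended off `∂E`. -/
def tangentialDiv {n : ℕ} (E : Set (Space n)) (X : Space n → Space n) (x : Space n) : ℝ :=
  ∑ i, inner ℝ
    (fderivWithin ℝ X (frontier E) x
      (stdOrthonormalBasis ℝ (Submodule.span ℝ {normal E x})ᗮ i : Space n))
    (stdOrthonormalBasis ℝ (Submodule.span ℝ {normal E x})ᗮ i : Space n)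

/-- The mean curvature `H_{∂E} = div_τ ν_{∂E}`, the sum of the principal curvatures. For a set of
class `C^{1,1}` the normal is differentiable along `∂E` almost everywhere, and there this is
`-div (Du / √(1 + |Du|²))` in terms of a local graph function `u`. -/
def meanCurvature {n : ℕ} (E : Set (Space n)) (x : Space n) : ℝ :=
  tangentialDiv E (normal E) x

/-- The measure `ℋ^{n-1}` on `∂E`. -/
def boundaryMeasure {n : ℕ} (E : Set (Space n)) : Measure (Space n) :=
  (Measure.euclideanHausdorffMeasure (n - 1)).restrict (frontier E)

/-- The integrand `H_{∂E} e^{-|x|²/2}`. -/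
def curvatureDensity {n : ℕ} (E : Set (Space n)) (x : Space n) : ℝ :=
  meanCurvature E x * Real.exp (-‖x‖ ^ 2 / 2)

/-- The functional `ℋ(E) = ∫_{∂E} H_{∂E} e^{-|x|²/2} dℋ^{n-1}`. -/
def curvatureEnergy {n : ℕ} (E : Set (Space n)) : ℝ :=
  ∫ x, curvatureDensity E x ∂(boundaryMeasure E)

/-- The integrand `(⟨x, ν⟩ / |x|) H_{∂E} e^{-|x|²/2}`. -/
def radialDensity {n : ℕ} (E : Set (Space n)) (x : Space n) : ℝ :=
  inner ℝ x (normal E x) / ‖x‖ * curvatureDensity E x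

/-- The integral `∫_{∂E} (⟨x, ν⟩ / |x|) H_{∂E} e^{-|x|²/2} dℋ^{n-1}`. -/
def radialEnergy {n : ℕ} (E : Set (Space n)) : ℝ :=
  ∫ x, radialDensity E x ∂(boundaryMeasure E)

end GaussianCurvature

end

noncomputable section

namespace GaussianCurvature

/-!
Write `p = ⟨x, ν⟩` and `t = |x|` on `∂E`. The half-space `{y | ⟨y, ν⟩ ≤ p}` contains the convex set
`E` and has Gaussian volume `ψ(p)`, so `ψ(a) ≤ γ(E)` forces `a ≤ p`; in particular `p² ≥ n - 2`.

Integrating `p F` over `∂E` is integrating `F` against the cone measure of `E`. In the polar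
coordinates of the gauge of `E`, the divergence theorem for the Lipschitz extension of `h ν` along
rays is therefore an integration by parts on `∂E`,
`∫ p h H = ∫ ((n - 1) h + ⟨∇h, x - p ν⟩)`.
For `h = e^{-t²/2} / t`, and after adding `(1 - p / t) H e^{-t²/2}` in the case of a bounded
curvature `H ≤ M ≤ p`, the right-hand side is pointwise at most `(n - 1) (p / t²) e^{-t²/2}`
because `p² ≥ n - 2`, with equality on a ball around the origin.

Finally `∫ (p / t²) e^{-t²/2}` over `∂E` is the integral over `E` of the divergence of
`e^{-|x|²/2} x / |x|²`, which is `((n - 2) / |x|² - 1) e^{-|x|²/2}`. Relative to the Gaussian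
density this is decreasing in `|x|`, so for a given Gaussian volume the ball maximizes it.
-/

variable {n : ℕ}

/-! ### Exterior normals and local defining functions -/

/-- A local defining function `Φ` of class `C^{1,1}` for `E` near `x₀`, with gradient `G`: near `x₀`
the interior of `E` is `{Φ < 0}` and its boundary is `{Φ = 0}`. The normalization `1 ≤ ‖G‖` is the
one satisfied by `Φ y = ⟨e, y⟩ - u (P y)` when `E` is the subgraph of `u`. -/
structure IsDefiningFunction (E : Set (Space n)) (x₀ : Space n) (Φ : Space n → ℝ)
    (G : Space n → Space n) : Prop where
  hasGradientAt : ∀ y, HasGradientAt Φ (G y) y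
  one_le_norm : ∀ y, 1 ≤ ‖G y‖
  lipschitz : ∃ K : NNReal, ∃ U ∈ 𝓝 x₀, LipschitzOnWith K G U
  eventually_iff : ∀ᶠ y in 𝓝 x₀, (y ∈ interior E ↔ Φ y < 0) ∧ (y ∈ frontier E ↔ Φ y = 0)

/-- Sets of class `C^{1,1}` in terms of defining functions, which treats `IsClassC2` and
`IsClassC11` at once. -/
def HasDefiningFunctions (E : Set (Space n)) : Prop :=
  ∀ x₀ ∈ frontier E, ∃ Φ G, IsDefiningFunction E x₀ Φ G

section Graph

variable {V : Type*} [NormedAddCommGroup V] [InnerProductSpace ℝ V]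

theorem norm_le_norm_sub_of_mem_orthogonal {K : Submodule ℝ V} {e z : V} (he : e ∈ Kᗮ)
    (hz : z ∈ K) : ‖e‖ ≤ ‖e - z‖ := by
  rw [← abs_of_nonneg (norm_nonneg e), ← abs_of_nonneg (norm_nonneg (e - z)), ← sq_le_sq,
    norm_sub_sq_real, Submodule.inner_left_of_mem_orthogonal hz he]
  nlinarith [sq_nonneg ‖z‖]

variable {K : Submodule ℝ V} [CompleteSpace K] {u : K → ℝ}

theorem hasGradientAt_inner_sub_comp_orthogonalProjectionOnto [CompleteSpace V] (e : V) {y : V}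
    (hu : DifferentiableAt ℝ u (K.orthogonalProjectionOnto y)) :
    HasGradientAt (fun y => inner ℝ e y - u (K.orthogonalProjectionOnto y))
      (e - gradient u (K.orthogonalProjectionOnto y)) y := by
  rw [hasGradientAt_iff_hasFDerivAt]
  refine ((innerSL ℝ e).hasFDerivAt.sub (hu.hasGradientAt.hasFDerivAt.comp y
    K.orthogonalProjectionOnto.hasFDerivAt)).congr_fderiv ?_
  ext z
  simp only [sub_apply, innerSL_apply_apply, ContinuousLinearMap.comp_apply,
    InnerProductSpace.toDual_apply_apply, inner_sub_left,
    Submodule.inner_orthogonalProjectionOnto_eq_of_mem_left]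

theorem lipschitzOnWith_sub_gradient_orthogonalProjectionOnto (e : V) {C : NNReal} {U : Set K}
    (hu : LipschitzOnWith C (fderiv ℝ u) U) :
    LipschitzOnWith C (fun y : V => e - gradient u (K.orthogonalProjectionOnto y))
      (K.orthogonalProjectionOnto ⁻¹' U) := by
  refine LipschitzOnWith.of_dist_le_mul fun x hx y hy => ?_
  rw [dist_sub_left, ← Subtype.dist_eq, gradient, gradient, LinearIsometryEquiv.dist_map]
  refine (hu.dist_le_mul _ hx _ hy).trans (mul_le_mul_of_nonneg_left ?_ C.2)
  rw [dist_eq_norm, dist_eq_norm, ← map_sub]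
  exact K.norm_orthogonalProjectionOnto_apply_le _

end Graph

theorem IsSubgraphNear.exists_isDefiningFunction {E : Set (Space n)} {x₀ e : Space n}
    (he : ‖e‖ = 1) {u : (Submodule.span ℝ {e})ᗮ → ℝ} (hE : IsSubgraphNear E x₀ e u)
    (hu : Differentiable ℝ u)
    (hlip : ∃ K : NNReal, ∃ U ∈ 𝓝 ((Submodule.span ℝ {e})ᗮ.orthogonalProjectionOnto x₀),
      LipschitzOnWith K (fderiv ℝ u) U) :
    ∃ Φ G, IsDefiningFunction E x₀ Φ G := by
  obtain ⟨K, U, hU, hK⟩ := hlip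
  refine ⟨_, _, fun y => hasGradientAt_inner_sub_comp_orthogonalProjectionOnto e (hu _),
    fun y => ?_, ⟨K, _, ?_, lipschitzOnWith_sub_gradient_orthogonalProjectionOnto e hK⟩, ?_⟩
  · exact he.symm.trans_le (norm_le_norm_sub_of_mem_orthogonal
      (Submodule.le_orthogonal_orthogonal _ (Submodule.mem_span_singleton_self e))
      (Subtype.coe_prop _))
  · exact (ContinuousLinearMap.continuous _).continuousAt.preimage_mem_nhds hU
  · filter_upwards [hE] with y hy
    simpa [sub_neg, sub_eq_zero] using hy

theorem IsClassC2.hasDefiningFunctions {E : Set (Space n)} (hE : IsClassC2 E) :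
    HasDefiningFunctions E := by
  intro x hx
  obtain ⟨e, he, u, hu, h⟩ := hE x hx
  have hu' : ContDiff ℝ 1 (fderiv ℝ u) := hu.fderiv_right (by norm_num)
  exact h.exists_isDefiningFunction he (hu.differentiable (by norm_num))
    hu'.contDiffAt.exists_lipschitzOnWith

theorem IsClassC11.hasDefiningFunctions {E : Set (Space n)} (hE : IsClassC11 E) :
    HasDefiningFunctions E := by
  intro x hx
  obtain ⟨e, he, u, ⟨hu, K, hK⟩, h⟩ := hE x hx
  exact h.exists_isDefiningFunction he (hu.differentiable (by norm_num))
    ⟨K, univ, univ_mem, hK.lipschitzOnWith⟩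

theorem IsDefiningFunction.eventually_isExteriorNormal {E : Set (Space n)} {x₀ : Space n}
    {Φ : Space n → ℝ} {G : Space n → Space n} (h : IsDefiningFunction E x₀ Φ G) :
    ∀ᶠ y in 𝓝 x₀, y ∈ frontier E → IsExteriorNormal E y (NormedSpace.normalize (G y)) := by
  filter_upwards [h.eventually_iff.eventually_nhds] with y hy hyE
  have hG : 0 < ‖G y‖ := zero_lt_one.trans_le (h.one_le_norm y)
  have hΦ : Φ y = 0 := (hy.self_of_nhds).2.1 hyE
  refine ⟨NormedSpace.norm_normalize (norm_pos_iff.1 hG), fun ε hε => ?_⟩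
  have hd := ((hasGradientAt_iff_hasFDerivAt.1 (h.hasGradientAt y)).isLittleO).def hε
  filter_upwards [hy, hd] with z hz hΦz
  simp only [hΦ, InnerProductSpace.toDual_apply_apply, sub_zero, Real.norm_eq_abs] at hΦz
  have hinner : inner ℝ (G y) (z - y) =
      ‖G y‖ * inner ℝ (z - y) (NormedSpace.normalize (G y)) := by
    rw [← real_inner_smul_right, NormedSpace.norm_smul_normalize, real_inner_comm]
  have hε' : ε * ‖z - y‖ ≤ ‖G y‖ * (ε * ‖z - y‖) :=
    le_mul_of_one_le_left (by positivity) (h.one_le_norm y)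
  obtain ⟨hlower, hupper⟩ := abs_le.1 hΦz
  refine ⟨fun hlt => interior_subset (hz.1.2 ?_), fun hlt hzE => ?_⟩
  · nlinarith [mul_lt_mul_of_pos_left hlt hG]
  · have hpos : 0 < Φ z := by nlinarith [mul_lt_mul_of_pos_left hlt hG]
    by_cases hi : z ∈ interior E
    · exact ((hz.1.1 hi).trans hpos).false
    · exact hpos.ne' (hz.2.1 ⟨subset_closure hzE, hi⟩)

theorem tendsto_add_smul_nhdsGT {V : Type*} [NormedAddCommGroup V] [NormedSpace ℝ V] (x d : V) :
    Tendsto (fun t : ℝ => x + t • d) (𝓝[>] 0) (𝓝 x) := by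
  have h : Continuous fun t : ℝ => x + t • d := by fun_prop
  simpa using (h.tendsto 0).mono_left nhdsWithin_le_nhds

namespace IsExteriorNormal

variable {E : Set (Space n)} {x v w d : Space n}

theorem eventually_add_smul_mem (hv : IsExteriorNormal E x v) (hd : inner ℝ d v < 0) :
    ∀ᶠ t : ℝ in 𝓝[>] 0, x + t • d ∈ E := by
  have hd0 : 0 < ‖d‖ := norm_pos_iff.2 fun h => by simp [h] at hd
  filter_upwards [(tendsto_add_smul_nhdsGT x d).eventually
    (hv.2 (-inner ℝ d v / (2 * ‖d‖)) (div_pos (neg_pos.2 hd) (by positivity))),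
    self_mem_nhdsWithin] with t ht (ht0 : 0 < t)
  refine ht.1 ?_
  rw [add_sub_cancel_left, real_inner_smul_left, norm_smul, Real.norm_eq_abs, abs_of_pos ht0]
  calc t * inner ℝ d v < t * (inner ℝ d v / 2) := by gcongr; linarith
    _ = -(-inner ℝ d v / (2 * ‖d‖)) * (t * ‖d‖) := by field_simp

theorem eventually_add_smul_notMem (hv : IsExteriorNormal E x v) (hd : 0 < inner ℝ d v) :
    ∀ᶠ t : ℝ in 𝓝[>] 0, x + t • d ∉ E := by
  have hd0 : 0 < ‖d‖ := norm_pos_iff.2 fun h => by simp [h] at hd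
  filter_upwards [(tendsto_add_smul_nhdsGT x d).eventually
    (hv.2 (inner ℝ d v / (2 * ‖d‖)) (by positivity)), self_mem_nhdsWithin] with t ht (ht0 : 0 < t)
  refine ht.2 ?_
  rw [add_sub_cancel_left, real_inner_smul_left, norm_smul, Real.norm_eq_abs, abs_of_pos ht0]
  calc inner ℝ d v / (2 * ‖d‖) * (t * ‖d‖) = t * (inner ℝ d v / 2) := by field_simp
    _ < t * inner ℝ d v := by gcongr; linarith

-- If `v ≠ w`, moving from `x` in the direction `w - v` enters `E` by `v` and leaves it by `w`.
theorem unique (hv : IsExteriorNormal E x v) (hw : IsExteriorNormal E x w) : v = w := by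
  by_contra hne
  have hlt : inner ℝ v w < (1 : ℝ) := (inner_lt_one_iff_real_of_norm_eq_one hv.1 hw.1).2 hne
  have hin : inner ℝ (w - v) v < (0 : ℝ) := by
    rw [inner_sub_left, real_inner_self_eq_norm_sq, hv.1, real_inner_comm]; linarith
  have hout : (0 : ℝ) < inner ℝ (w - v) w := by
    rw [inner_sub_left, real_inner_self_eq_norm_sq, hw.1]; linarith
  obtain ⟨t, hmem, hnotMem⟩ :=
    ((hv.eventually_add_smul_mem hin).and (hw.eventually_add_smul_notMem hout)).exists
  exact hnotMem hmem

theorem normal_eq (hv : IsExteriorNormal E x v) : normal E x = v := by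
  have h : ∃ v, IsExteriorNormal E x v := ⟨v, hv⟩
  rw [normal, dif_pos h]
  exact h.choose_spec.unique hv

theorem inner_sub_nonpos (hv : IsExteriorNormal E x v) (hc : Convex ℝ E)
    (hi : (interior E).Nonempty) (hx : x ∈ closure E) {y : Space n} (hy : y ∈ closure E) :
    inner ℝ (y - x) v ≤ 0 := by
  rw [← hc.closure_interior_eq_closure_of_nonempty_interior hi] at hy
  refine closure_minimal (t := {y | inner ℝ (y - x) v ≤ 0}) (fun z hz => ?_)
    (isClosed_le (by fun_prop) continuous_const) hy
  by_contra hpos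
  obtain ⟨t, hnotMem, ht0, ht1⟩ :=
    ((hv.eventually_add_smul_notMem (not_le.1 hpos)).and (Ioo_mem_nhdsGT one_pos)).exists
  exact hnotMem (interior_subset (hc.openSegment_interior_closure_subset_interior hz hx
    ⟨t, 1 - t, ht0, by linarith, by ring, by module⟩))

end IsExteriorNormal

theorem norm_mul_norm_normalize_sub_le {V : Type*} [NormedAddCommGroup V] [NormedSpace ℝ V]
    (v w : V) :
    ‖v‖ * ‖NormedSpace.normalize v - NormedSpace.normalize w‖ ≤ 2 * ‖v - w‖ := by
  have hw : ‖NormedSpace.normalize w‖ ≤ 1 := by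
    rcases eq_or_ne w 0 with rfl | hw
    · simp
    · exact (NormedSpace.norm_normalize hw).le
  have hsplit : ‖v‖ • (NormedSpace.normalize v - NormedSpace.normalize w) =
      (v - w) + (‖w‖ - ‖v‖) • NormedSpace.normalize w := by
    rw [smul_sub, sub_smul, NormedSpace.norm_smul_normalize, NormedSpace.norm_smul_normalize]
    abel
  calc ‖v‖ * ‖NormedSpace.normalize v - NormedSpace.normalize w‖
      = ‖(v - w) + (‖w‖ - ‖v‖) • NormedSpace.normalize w‖ := by
        rw [← hsplit, norm_smul, norm_norm]
    _ ≤ ‖v - w‖ + ‖w - v‖ * 1 := by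
        refine (norm_add_le _ _).trans ?_
        rw [norm_smul, Real.norm_eq_abs]
        gcongr
        exact abs_norm_sub_norm_le w v
    _ = 2 * ‖v - w‖ := by rw [norm_sub_rev w]; ring

namespace HasDefiningFunctions

variable {E : Set (Space n)}

theorem isExteriorNormal (hE : HasDefiningFunctions E) {x : Space n} (hx : x ∈ frontier E) :
    IsExteriorNormal E x (normal E x) := by
  obtain ⟨Φ, G, h⟩ := hE x hx
  have hν := h.eventually_isExteriorNormal.self_of_nhds hx
  rwa [hν.normal_eq]

theorem locallyLipschitzOn_normal (hE : HasDefiningFunctions E) :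
    LocallyLipschitzOn (frontier E) (normal E) := by
  intro x hx
  obtain ⟨Φ, G, h⟩ := hE x hx
  obtain ⟨K, U, hU, hK⟩ := h.lipschitz
  refine ⟨2 * K, _ ∩ frontier E, inter_mem (mem_nhdsWithin_of_mem_nhds
    (inter_mem hU h.eventually_isExteriorNormal)) self_mem_nhdsWithin,
    LipschitzOnWith.of_dist_le_mul ?_⟩
  rintro y ⟨⟨hyU, hy⟩, hyE⟩ z ⟨⟨hzU, hz⟩, hzE⟩
  rw [(hy hyE).normal_eq, (hz hzE).normal_eq, dist_eq_norm]
  calc ‖NormedSpace.normalize (G y) - NormedSpace.normalize (G z)‖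
      ≤ ‖G y‖ * ‖NormedSpace.normalize (G y) - NormedSpace.normalize (G z)‖ :=
        le_mul_of_one_le_left (norm_nonneg _) (h.one_le_norm y)
    _ ≤ 2 * dist (G y) (G z) := by
        rw [dist_eq_norm]
        exact norm_mul_norm_normalize_sub_le _ _
    _ ≤ 2 * (K * dist y z) := by
        gcongr
        exact hK.dist_le_mul _ hyU _ hzU
    _ = (2 * K : NNReal) * dist y z := by
        push_cast
        ring

end HasDefiningFunctions

/-! ### Polar coordinates of a positively homogeneous function -/

open scoped Pointwise

section Polar

variable {V : Type*} [NormedAddCommGroup V] [NormedSpace ℝ V]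

/-- The projection `x ↦ x / p(x)` along rays onto the level set `{p = 1}` of a positively
homogeneous function; its value is `0` where `p` vanishes. -/
def radialProj (p : V → ℝ) (x : V) : V := (p x)⁻¹ • x

theorem smul_radialProj {p : V → ℝ} {x : V} (hx : p x ≠ 0) : p x • radialProj p x = x := by
  rw [radialProj, smul_smul, mul_inv_cancel₀ hx, one_smul]

variable [MeasurableSpace V]

/-- The cone measure of `{p = 1}`, for a positively homogeneous `p`: a set `A` has measure `dim V`
times the volume of the part of the cone over `A` where `0 < p < 1`. -/
def coneMeasure (μ : Measure V) (p : V → ℝ) : Measure V :=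
  (Module.finrank ℝ V : ENNReal) • (μ.restrict {x | 0 < p x ∧ p x < 1}).map (radialProj p)

/-- The measure `s ^ k ds` on `(0, ∞)`, as a measure on `ℝ`: the radial factor of polar coordinates
in dimension `k + 1`. -/
def powMeasure (k : ℕ) : Measure ℝ :=
  (volume.restrict (Ioi 0)).withDensity fun s => ENNReal.ofReal (s ^ k)

/-- Measurable positively homogeneous functions, the gauges of polar coordinates. -/
structure IsPosHomogeneous (p : V → ℝ) : Prop where
  measurable : Measurable p
  map_smul : ∀ t : ℝ, 0 < t → ∀ x, p (t • x) = t * p x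

theorem powMeasure_Iio (k : ℕ) {b : ℝ} (hb : 0 ≤ b) :
    powMeasure k (Iio b) = ENNReal.ofReal (b ^ (k + 1) / (k + 1)) := by
  rw [powMeasure, withDensity_apply _ measurableSet_Iio,
    Measure.restrict_restrict measurableSet_Iio, Iio_inter_Ioi, restrict_Ioo_eq_restrict_Ioc,
    ← ofReal_integral_eq_lintegral_ofReal (intervalIntegral.intervalIntegrable_pow _).1,
    ← intervalIntegral.integral_of_le hb, integral_pow, zero_pow k.succ_ne_zero, sub_zero]
  filter_upwards [ae_restrict_mem measurableSet_Ioc] with y hy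
  exact pow_nonneg hy.1.le _

theorem integral_powMeasure (k : ℕ) (η : ℝ → ℝ) :
    ∫ s, η s ∂powMeasure k = ∫ s in Ioi 0, s ^ k * η s := by
  rw [powMeasure, integral_withDensity_eq_integral_toReal_smul (by fun_prop)
    (Eventually.of_forall fun _ => ENNReal.ofReal_lt_top)]
  refine setIntegral_congr_fun measurableSet_Ioi fun s (hs : 0 < s) => ?_
  simp only [smul_eq_mul, ENNReal.toReal_ofReal (pow_nonneg hs.le _)]

theorem integrable_powMeasure {k : ℕ} {η : ℝ → ℝ} :
    Integrable η (powMeasure k) ↔ IntegrableOn (fun s => s ^ k * η s) (Ioi 0) := by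
  rw [powMeasure, integrable_withDensity_iff_integrable_smul' (by fun_prop)
    (Eventually.of_forall fun _ => ENNReal.ofReal_lt_top)]
  refine integrableOn_congr_fun (fun s (hs : 0 < s) => ?_) measurableSet_Ioi
  simp only [smul_eq_mul, ENNReal.toReal_ofReal (pow_nonneg hs.le _)]

namespace IsPosHomogeneous

variable {p : V → ℝ} {μ : Measure V}

theorem map_zero (hp : IsPosHomogeneous p) : p 0 = 0 := by
  have h := hp.map_smul 2 two_pos 0
  rw [smul_zero] at h
  linarith

theorem radialProj_smul (hp : IsPosHomogeneous p) {t : ℝ} (ht : 0 < t) (x : V) :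
    radialProj p (t • x) = radialProj p x := by
  rw [radialProj, radialProj, hp.map_smul t ht, mul_inv, smul_smul, mul_right_comm,
    inv_mul_cancel₀ ht.ne', one_mul]

variable [BorelSpace V] [SecondCountableTopology V]

theorem measurable_radialProj (hp : IsPosHomogeneous p) : Measurable (radialProj p) :=
  hp.measurable.inv.smul measurable_id

theorem measurable_polar (hp : IsPosHomogeneous p) :
    Measurable fun x => (radialProj p x, p x) :=
  hp.measurable_radialProj.prodMk hp.measurable

theorem coneMeasure_apply (hp : IsPosHomogeneous p) {A : Set V} (hA : MeasurableSet A) :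
    coneMeasure μ p A =
      Module.finrank ℝ V * μ {x | 0 < p x ∧ p x < 1 ∧ radialProj p x ∈ A} := by
  rw [coneMeasure, Measure.smul_apply, Measure.map_apply hp.measurable_radialProj hA,
    Measure.restrict_apply (hp.measurable_radialProj hA), smul_eq_mul]
  congr 2
  ext x
  simp only [mem_inter_iff, mem_preimage, mem_ofPred_eq]
  tauto

end IsPosHomogeneous

variable [BorelSpace V] [FiniteDimensional ℝ V] {p : V → ℝ} {μ : Measure V} [μ.IsAddHaarMeasure]

namespace IsPosHomogeneous

theorem measure_sector (hp : IsPosHomogeneous p) {b : ℝ} (hb : 0 < b) (A : Set V) :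
    μ {x | 0 < p x ∧ p x < b ∧ radialProj p x ∈ A} =
      ENNReal.ofReal (b ^ Module.finrank ℝ V) *
        μ {x | 0 < p x ∧ p x < 1 ∧ radialProj p x ∈ A} := by
  have h := Measure.addHaar_smul μ b {x | 0 < p x ∧ p x < 1 ∧ radialProj p x ∈ A}
  rw [abs_of_pos (pow_pos hb _)] at h
  rw [← h]
  congr 1
  ext x
  rw [mem_smul_set_iff_inv_smul_mem₀ hb.ne']
  simp only [mem_ofPred_eq, hp.radialProj_smul (inv_pos.2 hb), hp.map_smul _ (inv_pos.2 hb)]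
  rw [mul_pos_iff_of_pos_left (inv_pos.2 hb), inv_mul_lt_iff₀ hb, mul_one]

theorem measure_sector_eq_mul (hp : IsPosHomogeneous p) {A : Set V} (hA : MeasurableSet A)
    (b : ℝ) :
    μ {x | 0 < p x ∧ p x < b ∧ radialProj p x ∈ A} =
      coneMeasure μ p A * powMeasure (Module.finrank ℝ V - 1) (Iio b) := by
  rcases le_or_gt b 0 with hb | hb
  · have hempty : {x | 0 < p x ∧ p x < b ∧ radialProj p x ∈ A} = ∅ :=
      eq_empty_of_forall_notMem fun x hx => (hx.1.trans hx.2.1).not_ge hb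
    have hzero : powMeasure (Module.finrank ℝ V - 1) (Iio b) = 0 :=
      measure_mono_null (Iio_subset_Iio hb) (by simp [powMeasure_Iio _ le_rfl])
    rw [hempty, measure_empty, hzero, mul_zero]
  rcases subsingleton_or_nontrivial V with hV | hV
  · have hempty : {x | 0 < p x ∧ p x < b ∧ radialProj p x ∈ A} = ∅ :=
      eq_empty_of_forall_notMem fun x hx => by
        have h := hx.1
        rw [Subsingleton.elim x 0, hp.map_zero] at h
        exact h.false
    rw [hempty, measure_empty, coneMeasure, Module.finrank_zero_of_subsingleton]
    simp
  · obtain ⟨k, hk⟩ := Nat.exists_eq_succ_of_ne_zero (Module.finrank_pos (R := ℝ) (M := V)).ne'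
    rw [hp.measure_sector hb, hp.coneMeasure_apply hA, powMeasure_Iio _ hb.le, hk,
      Nat.succ_sub_one, ENNReal.ofReal_div_of_pos (by positivity), ← Nat.cast_succ,
      ENNReal.ofReal_natCast, mul_comm ((k.succ : ℕ) : ENNReal), mul_assoc,
      ENNReal.mul_div_cancel (by positivity) (by simp), mul_comm]

theorem sigmaFinite_coneMeasure (hp : IsPosHomogeneous p) : SigmaFinite (coneMeasure μ p) := by
  refine ⟨⟨⟨fun k => Metric.closedBall 0 k, fun _ => trivial, fun k => ?_,
    Metric.iUnion_closedBall_nat 0⟩⟩⟩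
  rw [hp.coneMeasure_apply measurableSet_closedBall]
  refine ENNReal.mul_lt_top (ENNReal.natCast_lt_top _) ((measure_mono ?_).trans_lt
    (measure_closedBall_lt_top (x := (0 : V)) (r := k)))
  rintro x ⟨h0, h1, h2⟩
  rw [mem_closedBall_zero_iff] at h2 ⊢
  rw [← smul_radialProj h0.ne', norm_smul, Real.norm_eq_abs, abs_of_pos h0]
  exact (mul_le_of_le_one_left (norm_nonneg _) h1.le).trans h2

theorem map_polar (hp : IsPosHomogeneous p) :
    (μ.restrict {x | 0 < p x}).map (fun x => (radialProj p x, p x)) =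
      (coneMeasure μ p).prod (powMeasure (Module.finrank ℝ V - 1)) := by
  have := hp.sigmaFinite_coneMeasure (μ := μ)
  symm
  refine Measure.prod_eq_generateFrom MeasurableSpace.generateFrom_measurableSet
    ((borel_eq_generateFrom_Iio ℝ).symm.trans BorelSpace.measurable_eq.symm)
    MeasurableSpace.isPiSystem_measurableSet isPiSystem_Iio
    (coneMeasure μ p).toFiniteSpanningSetsIn
    ⟨fun k => Iio (k : ℝ), fun k => mem_range_self _, fun k => ?_, ?_⟩
    fun A hA => forall_mem_range.2 fun b => ?_
  · rw [powMeasure_Iio _ (Nat.cast_nonneg k)]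
    exact ENNReal.ofReal_lt_top
  · exact iUnion_eq_univ_iff.2 exists_nat_gt
  · replace hA : MeasurableSet A := hA
    rw [Measure.map_apply hp.measurable_polar (hA.prod measurableSet_Iio),
      Measure.restrict_apply (hp.measurable_polar (hA.prod measurableSet_Iio)),
      ← hp.measure_sector_eq_mul hA]
    congr 1
    ext x
    simp only [mem_inter_iff, mem_preimage, mem_prod, mem_Iio, mem_ofPred_eq]
    tauto

theorem integral_polar (hp : IsPosHomogeneous p) {f : V × ℝ → ℝ}
    (hf : AEStronglyMeasurable f
      ((coneMeasure μ p).prod (powMeasure (Module.finrank ℝ V - 1)))) :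
    ∫ x in {x | 0 < p x}, f (radialProj p x, p x) ∂μ =
      ∫ z, f z ∂(coneMeasure μ p).prod (powMeasure (Module.finrank ℝ V - 1)) := by
  rw [← hp.map_polar] at hf ⊢
  rw [integral_map hp.measurable_polar.aemeasurable hf]

theorem integrable_polar (hp : IsPosHomogeneous p) {f : V × ℝ → ℝ}
    (hf : AEStronglyMeasurable f
      ((coneMeasure μ p).prod (powMeasure (Module.finrank ℝ V - 1)))) :
    IntegrableOn (fun x => f (radialProj p x, p x)) {x | 0 < p x} μ ↔
      Integrable f ((coneMeasure μ p).prod (powMeasure (Module.finrank ℝ V - 1))) := by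
  rw [← hp.map_polar] at hf ⊢
  rw [integrable_map_measure hf hp.measurable_polar.aemeasurable]
  rfl

end IsPosHomogeneous

end Polar

section Hyperplane

variable {V : Type*} [NormedAddCommGroup V] [InnerProductSpace ℝ V]

theorem isPosHomogeneous_inner_div [MeasurableSpace V] [BorelSpace V] (v : V) (c : ℝ) :
    IsPosHomogeneous fun x : V => inner ℝ x v / c where
  measurable := (by fun_prop : Continuous fun x : V => inner ℝ x v / c).measurable
  map_smul t _ x := by rw [real_inner_smul_left, mul_div_assoc]

variable {v : V} {c : ℝ} {B : Set V}

theorem cone_inter_hyperplane (hv : ‖v‖ = 1) (hc : 0 < c) (hB : ∀ x ∈ B, inner ℝ x v = c)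
    (s : ℝ) :
    {x | 0 < inner ℝ x v / c ∧ inner ℝ x v / c < 1 ∧
        radialProj (fun x => inner ℝ x v / c) x ∈ B} ∩
      AffineSubspace.mk' (s • v +ᵥ (0 : V)) (Submodule.span ℝ {v})ᗮ =
      if s ∈ Ioo 0 c then (s / c) • B else ∅ := by
  have hmem : ∀ x : V, x ∈ AffineSubspace.mk' (s • v +ᵥ (0 : V)) (Submodule.span ℝ {v})ᗮ ↔
      inner ℝ x v = s := fun x => by
    rw [AffineSubspace.mem_mk', Submodule.mem_orthogonal_singleton_iff_inner_left]
    simp [inner_sub_left, real_inner_smul_left, hv, sub_eq_zero]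
  ext x
  simp only [mem_inter_iff, SetLike.mem_coe, hmem, mem_ofPred_eq, radialProj]
  split_ifs with hs
  · have hsc : 0 < s / c := div_pos hs.1 hc
    rw [mem_smul_set_iff_inv_smul_mem₀ hsc.ne']
    constructor
    · rintro ⟨⟨-, -, hxB⟩, hxs⟩
      rwa [hxs] at hxB
    · intro hxB
      have hxs := hB _ hxB
      rw [real_inner_smul_left, inv_mul_eq_iff_eq_mul₀ hsc.ne', div_mul_cancel₀ _ hc.ne'] at hxs
      rw [hxs]
      exact ⟨⟨hsc, (div_lt_one hc).2 hs.2, hxB⟩, rfl⟩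
  · rw [mem_empty_iff_false, iff_false]
    rintro ⟨⟨h0, h1, -⟩, rfl⟩
    exact hs ⟨(div_pos_iff_of_pos_right hc).1 h0, (div_lt_one hc).1 h1⟩

variable [MeasurableSpace V] [BorelSpace V]

theorem euclideanHausdorffMeasure_cone_inter_hyperplane (hv : ‖v‖ = 1) (hc : 0 < c)
    (hB : ∀ x ∈ B, inner ℝ x v = c) (k : ℕ) (s : ℝ) :
    Measure.euclideanHausdorffMeasure k
      ({x | 0 < inner ℝ x v / c ∧ inner ℝ x v / c < 1 ∧
          radialProj (fun x => inner ℝ x v / c) x ∈ B} ∩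
        AffineSubspace.mk' (s • v +ᵥ (0 : V)) (Submodule.span ℝ {v})ᗮ) =
      (Ioo 0 c).indicator (fun s => ENNReal.ofReal (s ^ k) *
        (ENNReal.ofReal ((c ^ k)⁻¹) * Measure.euclideanHausdorffMeasure k B)) s := by
  rw [cone_inter_hyperplane hv hc hB]
  by_cases hs : s ∈ Ioo 0 c
  · have hsc : 0 < s / c := div_pos hs.1 hc
    rw [if_pos hs, indicator_of_mem hs, Measure.euclideanHausdorffMeasure_smul₀ _ hsc.ne',
      ← mul_assoc, ← ENNReal.ofReal_mul (pow_nonneg hs.1.le _), ← div_eq_mul_inv, ← div_pow,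
      ENNReal.smul_def, smul_eq_mul, ENNReal.coe_pow, ENNReal.ofReal_pow hsc.le,
      ← Real.enorm_of_nonneg hsc.le, enorm_eq_nnnorm]
  · rw [if_neg hs, indicator_of_notMem hs, measure_empty]

theorem coneMeasure_inner_div [FiniteDimensional ℝ V] (hv : ‖v‖ = 1)
    (hc : 0 < c) (hBm : MeasurableSet B) (hB : ∀ x ∈ B, inner ℝ x v = c) :
    coneMeasure volume (fun x => inner ℝ x v / c) B =
      ENNReal.ofReal c * Measure.euclideanHausdorffMeasure (Module.finrank ℝ V - 1) B := by
  have hp := isPosHomogeneous_inner_div v c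
  have hv0 : v ≠ 0 := fun h => by simp [h] at hv
  have : Nontrivial V := ⟨⟨v, 0, hv0⟩⟩
  obtain ⟨k, hk⟩ := Nat.exists_eq_succ_of_ne_zero (Module.finrank_pos (R := ℝ) (M := V)).ne'
  have hcone : MeasurableSet {x : V | 0 < inner ℝ x v / c ∧ inner ℝ x v / c < 1 ∧
      radialProj (fun x => inner ℝ x v / c) x ∈ B} :=
    (measurableSet_lt measurable_const hp.measurable).inter
      ((measurableSet_lt hp.measurable measurable_const).inter (hp.measurable_radialProj hBm))
  have hpow : ∫⁻ s in Ioo 0 c, ENNReal.ofReal (s ^ k) =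
      ENNReal.ofReal (c ^ (k + 1) / (k + 1)) := by
    rw [← powMeasure_Iio k hc.le, powMeasure, withDensity_apply _ measurableSet_Iio,
      Measure.restrict_restrict measurableSet_Iio, Iio_inter_Ioi]
  rw [hp.coneMeasure_apply hBm, ← InnerProductSpace.euclideanHausdorffMeasure_eq_volume,
    EuclideanGeometry.euclideanHausdorffMeasure_eq_lintegral (0 : V) hv0 hcone, hk,
    Nat.succ_sub_one, ← ofReal_norm, hv, ENNReal.ofReal_one, one_mul]
  simp_rw [euclideanHausdorffMeasure_cone_inter_hyperplane hv hc hB]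
  rw [lintegral_indicator measurableSet_Ioo, lintegral_mul_const _ (by fun_prop), hpow,
    ← mul_assoc, ← mul_assoc, ← ENNReal.ofReal_natCast, ← ENNReal.ofReal_mul (by positivity),
    ← ENNReal.ofReal_mul (by positivity)]
  congr 2
  push_cast
  field_simp
  rw [pow_succ]

end Hyperplane

theorem measure_le_of_locally_le {X : Type*} [TopologicalSpace X] [SecondCountableTopology X]
    [MeasurableSpace X] [OpensMeasurableSpace X] {μ ν : Measure X}
    (h : ∀ x, ∃ U ∈ 𝓝 x, ∀ A ⊆ U, MeasurableSet A → μ A ≤ ν A) : μ ≤ ν := by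
  choose U hU hle using h
  obtain ⟨t, htc, ht⟩ := TopologicalSpace.countable_cover_nhds fun x => interior_mem_nhds.2 (hU x)
  refine Measure.le_iff.2 fun s hs => ?_
  rcases t.eq_empty_or_nonempty with rfl | htn
  · rw [biUnion_empty] at ht
    simp [eq_empty_of_subset_empty (ht ▸ subset_univ s)]
  obtain ⟨f, rfl⟩ := htc.exists_eq_range htn
  rw [biUnion_range] at ht
  set D := disjointed fun i => interior (U (f i))
  have hD : ∀ i, MeasurableSet (s ∩ D i) := fun i =>
    hs.inter (MeasurableSet.disjointed (fun i => isOpen_interior.measurableSet) i)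
  have hdisj : Pairwise (Function.onFun Disjoint fun i => s ∩ D i) := fun i j hij =>
    (disjoint_disjointed _ hij).mono inter_subset_right inter_subset_right
  have hcover : s = ⋃ i, s ∩ D i := by rw [← inter_iUnion, iUnion_disjointed, ht, inter_univ]
  rw [hcover, measure_iUnion hdisj hD, measure_iUnion hdisj hD]
  exact ENNReal.tsum_le_tsum fun i => hle (f i) _
    (inter_subset_right.trans ((disjointed_le _ i).trans interior_subset)) (hD i)

theorem euclideanHausdorffMeasure_image_le {X Y : Type*} [EMetricSpace X]
    [EMetricSpace Y] [MeasurableSpace X] [BorelSpace X] [MeasurableSpace Y] [BorelSpace Y]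
    {K : NNReal} {f : X → Y} {s : Set X} (h : LipschitzOnWith K f s) (d : ℕ) :
    Measure.euclideanHausdorffMeasure d (f '' s) ≤
      (K : ENNReal) ^ d * Measure.euclideanHausdorffMeasure d s := by
  rw [Measure.euclideanHausdorffMeasure_def, Measure.euclideanHausdorffMeasure_def,
    Measure.smul_apply, Measure.smul_apply, ENNReal.smul_def, ENNReal.smul_def, smul_eq_mul,
    smul_eq_mul, mul_left_comm]
  gcongr
  simpa using h.hausdorffMeasure_image_le (d := d) (by positivity)

/-! ### The cone measure of a convex set -/

section Comparison

variable {V : Type*} [NormedAddCommGroup V] [NormedSpace ℝ V] [MeasurableSpace V] [BorelSpace V]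

theorem isPosHomogeneous_gauge {E : Set V} (hc : Convex ℝ E) (h0 : E ∈ 𝓝 0) :
    IsPosHomogeneous (gauge E) where
  measurable := (continuous_gauge hc h0).measurable
  map_smul t ht x := by rw [gauge_smul_of_nonneg ht.le, smul_eq_mul]

theorem IsPosHomogeneous.coneMeasure_image_radialProj_le [FiniteDimensional ℝ V] {μ : Measure V}
    [μ.IsAddHaarMeasure] {p q : V → ℝ} (hp : IsPosHomogeneous p) (hq : IsPosHomogeneous q)
    {A : Set V} (hpA : MeasurableSet (radialProj p '' A))
    (hqA : MeasurableSet (radialProj q '' A)) {l : ℝ} (hl : 0 < l)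
    (h : ∀ a ∈ A, 0 < p a ∧ 0 < q a ∧ q a ≤ l * p a) :
    coneMeasure μ p (radialProj p '' A) ≤
      ENNReal.ofReal (l ^ Module.finrank ℝ V) * coneMeasure μ q (radialProj q '' A) := by
  rw [hp.coneMeasure_apply hpA, hq.coneMeasure_apply hqA, mul_left_comm, ← hq.measure_sector hl]
  gcongr Module.finrank ℝ V * μ ?_
  rintro x ⟨hx0, hx1, a, ha, hax⟩
  obtain ⟨hpa, hqa, hle⟩ := h a ha
  have hx : x = (p x / p a) • a := by
    rw [div_eq_mul_inv, mul_smul]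
    change x = p x • radialProj p a
    rw [hax, smul_radialProj hx0.ne']
  have ht : 0 < p x / p a := div_pos hx0 hpa
  have hqx : q x = p x / p a * q a := by rw [← hq.map_smul _ ht, ← hx]
  refine ⟨hqx ▸ mul_pos ht hqa, ?_, a, ha, ?_⟩
  · calc q x = p x / p a * q a := hqx
      _ ≤ p x / p a * (l * p a) := by gcongr
      _ = p x * l := by field_simp
      _ < l := mul_lt_of_lt_one_left hl hx1
  · rw [hx, hq.radialProj_smul ht]

end Comparison

section NearIsometry

variable {W : Type*} [NormedAddCommGroup W] {f : W → W} {s : Set W} {τ : NNReal}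

theorem lipschitzOnWith_of_sub_id (h : LipschitzOnWith τ (fun x => f x - x) s) :
    LipschitzOnWith (1 + τ) f s := by
  simpa only [id_eq, add_sub_cancel] using (LipschitzWith.id.lipschitzOnWith (s := s)).add h

theorem antilipschitzWith_domRestrict_of_sub_id (h : LipschitzOnWith τ (fun x => f x - x) s)
    (hτ : τ < 1) : AntilipschitzWith (1 - τ)⁻¹ (s.domRestrict f) := by
  have hid : AntilipschitzWith 1 (s.domRestrict (id : W → W)) := AntilipschitzWith.id.domRestrict s
  convert! hid.add_lipschitzWith h.to_restrict (by rwa [inv_one]) using 1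
  · rw [inv_one]
  · ext x
    exact (add_sub_cancel _ _).symm

theorem euclideanHausdorffMeasure_le_image [MeasurableSpace W] [BorelSpace W] {K : NNReal}
    (h : AntilipschitzWith K (s.domRestrict f)) (d : ℕ) :
    Measure.euclideanHausdorffMeasure d s ≤
      (K : ENNReal) ^ d * Measure.euclideanHausdorffMeasure d (f '' s) := by
  have hinj : InjOn f s := injOn_iff_injective.2 h.injective
  have hinv : LipschitzOnWith K (Function.invFunOn f s) (f '' s) := by
    rintro _ ⟨a, ha, rfl⟩ _ ⟨b, hb, rfl⟩
    rw [hinj.leftInvOn_invFunOn ha, hinj.leftInvOn_invFunOn hb]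
    exact h ⟨a, ha⟩ ⟨b, hb⟩
  have hle := euclideanHausdorffMeasure_image_le hinv d
  rwa [hinj.leftInvOn_invFunOn.image_image] at hle

theorem euclideanHausdorffMeasure_image_comparison [MeasurableSpace W] [BorelSpace W] {l : NNReal}
    (hl : 1 < l) (h : LipschitzOnWith (1 - l⁻¹) (fun x => f x - x) s) (d : ℕ) :
    Measure.euclideanHausdorffMeasure d (f '' s) ≤
        (l : ENNReal) ^ d * Measure.euclideanHausdorffMeasure d s ∧
      Measure.euclideanHausdorffMeasure d s ≤
        (l : ENNReal) ^ d * Measure.euclideanHausdorffMeasure d (f '' s) := by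
  have hl0 : 0 < l := one_pos.trans hl
  have hinv : l⁻¹ ≤ 1 := inv_le_one_of_one_le₀ hl.le
  constructor
  · have hle : 1 + (1 - l⁻¹) ≤ l := by
      rw [← NNReal.coe_le_coe]
      push_cast [NNReal.coe_sub hinv]
      have : (0 : ℝ) ≤ (l - 1) ^ 2 / l := by positivity
      have hsq : ((l : ℝ) - 1) ^ 2 / l = l - 2 + (l : ℝ)⁻¹ := by field_simp; ring
      linarith
    exact euclideanHausdorffMeasure_image_le ((lipschitzOnWith_of_sub_id h).weaken hle) d
  · have hanti := antilipschitzWith_domRestrict_of_sub_id h (tsub_lt_self one_pos (inv_pos.2 hl0))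
    rw [tsub_tsub_cancel_of_le hinv, inv_inv] at hanti
    exact euclideanHausdorffMeasure_le_image hanti d

theorem norm_radialProj_sub_sub_le [NormedSpace ℝ W] {p : W → ℝ} {a b : W} (ha : 1 / 2 ≤ p a)
    (hb : 1 / 2 ≤ p b) :
    ‖radialProj p a - a - (radialProj p b - b)‖ ≤
      |(p a)⁻¹ - 1| * ‖a - b‖ + 4 * |p a - p b| * ‖b‖ := by
  have hpa : 0 < p a := by linarith
  have hpb : 0 < p b := by linarith
  have hia : (p a)⁻¹ ≤ 2 := by rw [inv_le_comm₀ hpa two_pos]; linarith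
  have hib : (p b)⁻¹ ≤ 2 := by rw [inv_le_comm₀ hpb two_pos]; linarith
  have hinv : (p a)⁻¹ - (p b)⁻¹ = (p a)⁻¹ * (p b)⁻¹ * (p b - p a) := by field_simp
  have hdiff : radialProj p a - a - (radialProj p b - b) =
      ((p a)⁻¹ - 1) • (a - b) + ((p a)⁻¹ - (p b)⁻¹) • b := by
    rw [radialProj, radialProj]
    module
  calc ‖radialProj p a - a - (radialProj p b - b)‖
      ≤ ‖((p a)⁻¹ - 1) • (a - b)‖ + ‖((p a)⁻¹ - (p b)⁻¹) • b‖ := hdiff ▸ norm_add_le _ _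
    _ = |(p a)⁻¹ - 1| * ‖a - b‖ + (p a)⁻¹ * (p b)⁻¹ * |p a - p b| * ‖b‖ := by
      rw [norm_smul, norm_smul, hinv, Real.norm_eq_abs, Real.norm_eq_abs, abs_mul, abs_mul,
        abs_inv, abs_inv, abs_of_pos hpa, abs_of_pos hpb, abs_sub_comm (p b)]
    _ ≤ |(p a)⁻¹ - 1| * ‖a - b‖ + 2 * 2 * |p a - p b| * ‖b‖ := by gcongr
    _ = |(p a)⁻¹ - 1| * ‖a - b‖ + 4 * |p a - p b| * ‖b‖ := by ring

end NearIsometry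

theorem exists_setLIntegral_comparison {X : Type*} [TopologicalSpace X] [MeasurableSpace X]
    (μ : Measure X) {f : X → ℝ} {s : Set X} {x₀ : X} (hf : ContinuousWithinAt f s x₀)
    (h0 : 0 < f x₀) {l : NNReal} (hl : 1 < l) :
    ∃ U ∈ 𝓝[s] x₀, ∀ A ⊆ U, MeasurableSet A →
      ∫⁻ x in A, ENNReal.ofReal (f x) ∂μ ≤ l * (ENNReal.ofReal (f x₀) * μ A) ∧
      ENNReal.ofReal (f x₀) * μ A ≤ l * ∫⁻ x in A, ENNReal.ofReal (f x) ∂μ := by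
  have hl' : f x₀ < l * f x₀ := lt_mul_of_one_lt_left h0 hl
  have hU : ∀ᶠ a in 𝓝[s] x₀, f a < l * f x₀ ∧ f x₀ < l * f a :=
    (hf.eventually_lt tendsto_const_nhds hl').and
      (tendsto_const_nhds.eventually_lt (hf.const_mul (l : ℝ)) hl')
  refine ⟨_, hU, fun A hAU hA => ⟨?_, ?_⟩⟩
  · rw [← mul_assoc, ← setLIntegral_const]
    refine setLIntegral_mono' hA fun a ha => ?_
    rw [← ENNReal.ofReal_coe_nnreal, ← ENNReal.ofReal_mul l.coe_nonneg]
    exact ENNReal.ofReal_le_ofReal (hAU ha).1.le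
  · rw [← lintegral_const_mul' _ _ ENNReal.coe_ne_top, ← setLIntegral_const]
    refine setLIntegral_mono' hA fun a ha => ?_
    rw [← ENNReal.ofReal_coe_nnreal, ← ENNReal.ofReal_mul l.coe_nonneg]
    exact ENNReal.ofReal_le_ofReal (hAU ha).2.le

theorem le_of_forall_one_lt_pow_smul {X : Type*} [MeasurableSpace X] {μ ν : Measure X} (k : ℕ)
    (h : ∀ l : NNReal, 1 < l → μ ≤ ((l : ENNReal) ^ k) • ν) : μ ≤ ν := by
  refine Measure.le_iff.2 fun s _ => ?_
  have hpow : Tendsto (fun l : NNReal => (l : ENNReal) ^ k) (𝓝[>] 1) (𝓝 1) := by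
    have hcont : Continuous fun l : NNReal => (l : ENNReal) ^ k :=
      (ENNReal.continuous_pow k).comp ENNReal.continuous_coe
    simpa only [ENNReal.coe_one, one_pow] using (hcont.tendsto 1).mono_left nhdsWithin_le_nhds
  have hlim : Tendsto (fun l : NNReal => (l : ENNReal) ^ k * ν s) (𝓝[>] 1) (𝓝 (ν s)) := by
    simpa only [one_mul] using ENNReal.Tendsto.mul_const (b := ν s) hpow (Or.inl one_ne_zero)
  refine ge_of_tendsto hlim ?_
  filter_upwards [self_mem_nhdsWithin] with l hl
  exact h l hl s

/-- Convex neighbourhoods of the origin whose exterior unit normal is locally Lipschitz and defines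
supporting hyperplanes: the sets on which the divergence theorem below is carried out. -/
structure IsRegularConvex (E : Set (Space n)) : Prop where
  convex : Convex ℝ E
  mem_nhds : E ∈ 𝓝 (0 : Space n)
  norm_normal : ∀ x ∈ frontier E, ‖normal E x‖ = 1
  inner_sub_nonpos : ∀ x ∈ frontier E, ∀ y ∈ closure E, inner ℝ (y - x) (normal E x) ≤ 0
  locallyLipschitzOn : LocallyLipschitzOn (frontier E) (normal E)

/-- The linear function equal to `1` on the hyperplane through `x₀` orthogonal to `ν(x₀)`; its
radial projection maps `∂E` near `x₀` to the tangent plane at `x₀`. -/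
def tangentGauge (E : Set (Space n)) (x₀ x : Space n) : ℝ :=
  inner ℝ x (normal E x₀) / inner ℝ x₀ (normal E x₀)

namespace IsRegularConvex

variable {E : Set (Space n)} (hE : IsRegularConvex E) {x₀ x : Space n}

include hE

theorem isPosHomogeneous : IsPosHomogeneous (gauge E) :=
  isPosHomogeneous_gauge hE.convex hE.mem_nhds

theorem gauge_eq_one_iff : gauge E x = 1 ↔ x ∈ frontier E :=
  gauge_eq_one_iff_mem_frontier hE.convex hE.mem_nhds

theorem radialProj_mem_frontier (hx : 0 < gauge E x) : radialProj (gauge E) x ∈ frontier E := by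
  rw [← hE.gauge_eq_one_iff, radialProj, hE.isPosHomogeneous.map_smul _ (inv_pos.2 hx),
    inv_mul_cancel₀ hx.ne']

theorem radialProj_of_mem_frontier (hx : x ∈ frontier E) : radialProj (gauge E) x = x := by
  rw [radialProj, hE.gauge_eq_one_iff.2 hx, inv_one, one_smul]

theorem exists_le_inner_normal : ∃ δ > 0, ∀ x ∈ frontier E, δ ≤ inner ℝ x (normal E x) := by
  obtain ⟨δ, hδ, hball⟩ := Metric.nhds_basis_closedBall.mem_iff.1 hE.mem_nhds
  refine ⟨δ, hδ, fun x hx => ?_⟩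
  have hmem : δ • normal E x ∈ E := hball (by
    rw [mem_closedBall_zero_iff, norm_smul, hE.norm_normal x hx, mul_one, Real.norm_eq_abs,
      abs_of_pos hδ])
  have h := hE.inner_sub_nonpos x hx _ (subset_closure hmem)
  rw [inner_sub_left, real_inner_smul_left, real_inner_self_eq_norm_sq, hE.norm_normal x hx] at h
  linarith

theorem inner_normal_pos (hx : x ∈ frontier E) : 0 < inner ℝ x (normal E x) := by
  obtain ⟨δ, hδ, h⟩ := hE.exists_le_inner_normal
  exact hδ.trans_le (h x hx)

theorem inner_normal_le_norm (hx : x ∈ frontier E) : inner ℝ x (normal E x) ≤ ‖x‖ := by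
  simpa only [hE.norm_normal x hx, mul_one] using real_inner_le_norm x (normal E x)

theorem continuousOn_normal : ContinuousOn (normal E) (frontier E) :=
  hE.locallyLipschitzOn.continuousOn

theorem continuousOn_inner_normal :
    ContinuousOn (fun x => inner ℝ x (normal E x)) (frontier E) :=
  continuousOn_id.inner hE.continuousOn_normal

theorem inner_sub_le_of_norm_normal_sub_le {v a b : Space n} {δ : ℝ} (ha : a ∈ frontier E)
    (hb : b ∈ closure E) (hv : ‖normal E a - v‖ ≤ δ) : inner ℝ (b - a) v ≤ δ * ‖b - a‖ := by
  calc inner ℝ (b - a) v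
      = inner ℝ (b - a) (normal E a) - inner ℝ (b - a) (normal E a - v) := by
        rw [inner_sub_right]; ring
    _ ≤ 0 + ‖b - a‖ * ‖normal E a - v‖ := by
        have := (abs_le.1 (abs_real_inner_le_norm (b - a) (normal E a - v))).1
        linarith [hE.inner_sub_nonpos a ha b hb]
    _ ≤ δ * ‖b - a‖ := by
        rw [zero_add, mul_comm]
        gcongr

theorem abs_inner_sub_le {v a b : Space n} {δ : ℝ} (ha : a ∈ frontier E) (hb : b ∈ frontier E)
    (hav : ‖normal E a - v‖ ≤ δ) (hbv : ‖normal E b - v‖ ≤ δ) :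
    |inner ℝ (a - b) v| ≤ δ * ‖a - b‖ := by
  refine abs_le'.2 ⟨hE.inner_sub_le_of_norm_normal_sub_le hb ha.1 hbv, ?_⟩
  rw [← inner_neg_left, neg_sub, norm_sub_rev]
  exact hE.inner_sub_le_of_norm_normal_sub_le ha hb.1 hav

theorem tangentGauge_self (hx₀ : x₀ ∈ frontier E) : tangentGauge E x₀ x₀ = 1 :=
  div_self (hE.inner_normal_pos hx₀).ne'

theorem tangentGauge_le_one (hx₀ : x₀ ∈ frontier E) (hx : x ∈ closure E) :
    tangentGauge E x₀ x ≤ 1 := by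
  have h := hE.inner_sub_nonpos x₀ hx₀ x hx
  rw [inner_sub_left] at h
  rw [tangentGauge, div_le_one (hE.inner_normal_pos hx₀)]
  linarith

omit hE in
theorem continuous_tangentGauge : Continuous (tangentGauge E x₀) := by
  unfold tangentGauge
  fun_prop

theorem exists_abs_tangentGauge_sub_le (hx₀ : x₀ ∈ frontier E) {ε : ℝ} (hε : 0 < ε) :
    ∃ U ∈ 𝓝[frontier E] x₀, ∀ a ∈ U, ∀ b ∈ U,
      |tangentGauge E x₀ a - tangentGauge E x₀ b| ≤ ε * ‖a - b‖ := by
  have hc := hE.inner_normal_pos hx₀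
  have hν : ∀ᶠ a in 𝓝[frontier E] x₀,
      ‖normal E a - normal E x₀‖ < ε * inner ℝ x₀ (normal E x₀) := by
    simpa only [dist_eq_norm] using
      Metric.tendsto_nhds.1 (hE.continuousOn_normal x₀ hx₀) _ (mul_pos hε hc)
  refine ⟨_, hν.and self_mem_nhdsWithin, fun a ha b hb => ?_⟩
  rw [tangentGauge, tangentGauge, ← sub_div, ← inner_sub_left, abs_div, abs_of_pos hc,
    div_le_iff₀ hc]
  linarith [hE.abs_inner_sub_le ha.2 hb.2 ha.1.le hb.1.le]

theorem exists_lipschitzOnWith_radialProj_tangentGauge_sub (hx₀ : x₀ ∈ frontier E) {τ : NNReal}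
    (hτ : 0 < τ) :
    ∃ U ∈ 𝓝[frontier E] x₀,
      LipschitzOnWith τ (fun x => radialProj (tangentGauge E x₀) x - x) U := by
  set p := tangentGauge E x₀
  have hp₀ : p x₀ = 1 := hE.tangentGauge_self hx₀
  have hpc : ContinuousAt p x₀ := continuous_tangentGauge.continuousAt
  have hhalf : ∀ᶠ a in 𝓝 x₀, 1 / 2 < p a :=
    hpc.eventually (Ioi_mem_nhds (by rw [hp₀]; norm_num))
  have hinv : ∀ᶠ a in 𝓝 x₀, |(p a)⁻¹ - 1| < τ / 2 :=
    ((hpc.inv₀ (by rw [hp₀]; exact one_ne_zero)).sub continuousAt_const).abs.eventually_lt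
      continuousAt_const (by simpa [hp₀] using hτ)
  have hnorm : ∀ᶠ a in 𝓝 x₀, ‖a‖ < ‖x₀‖ + 1 :=
    continuous_norm.continuousAt.eventually_lt continuousAt_const (lt_add_one _)
  obtain ⟨U, hU, hsub⟩ := hE.exists_abs_tangentGauge_sub_le hx₀
    (ε := τ / (8 * (‖x₀‖ + 1))) (by positivity)
  refine ⟨_, inter_mem hU (nhdsWithin_le_nhds ((hhalf.and hinv).and hnorm)),
    LipschitzOnWith.of_dist_le_mul ?_⟩
  rintro a ⟨haU, ⟨ha, ha'⟩, -⟩ b ⟨hbU, ⟨hb, -⟩, hbR⟩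
  rw [dist_eq_norm, dist_eq_norm]
  calc ‖radialProj p a - a - (radialProj p b - b)‖
      ≤ |(p a)⁻¹ - 1| * ‖a - b‖ + 4 * |p a - p b| * ‖b‖ :=
        norm_radialProj_sub_sub_le ha.le hb.le
    _ ≤ τ / 2 * ‖a - b‖ + 4 * (τ / (8 * (‖x₀‖ + 1)) * ‖a - b‖) * (‖x₀‖ + 1) := by
        gcongr
        exact hsub a haU b hbU
    _ = τ * ‖a - b‖ := by field_simp; ring

theorem coneMeasure_tangentGauge_image (hx₀ : x₀ ∈ frontier E) {A : Set (Space n)}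
    (hS : MeasurableSet (radialProj (tangentGauge E x₀) '' A))
    (hA : ∀ a ∈ A, 0 < tangentGauge E x₀ a) :
    coneMeasure volume (tangentGauge E x₀) (radialProj (tangentGauge E x₀) '' A) =
      ENNReal.ofReal (inner ℝ x₀ (normal E x₀)) *
        Measure.euclideanHausdorffMeasure (n - 1) (radialProj (tangentGauge E x₀) '' A) := by
  have hc := hE.inner_normal_pos hx₀
  have h := coneMeasure_inner_div (hE.norm_normal x₀ hx₀) hc hS (by
    rintro _ ⟨a, ha, rfl⟩
    have hpa := hA a ha
    rw [radialProj, real_inner_smul_left, inv_mul_eq_iff_eq_mul₀ hpa.ne', tangentGauge,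
      div_mul_cancel₀ _ hc.ne'])
  rwa [finrank_euclideanSpace_fin] at h

theorem coneMeasure_tangentGauge_image_comparison (hx₀ : x₀ ∈ frontier E) {A : Set (Space n)}
    (hA : MeasurableSet A) (hAE : A ⊆ frontier E)
    (hS : MeasurableSet (radialProj (tangentGauge E x₀) '' A)) {l : NNReal} (hl : 0 < l)
    (hAl : ∀ a ∈ A, (l : ℝ)⁻¹ < tangentGauge E x₀ a) :
    coneMeasure volume (gauge E) A ≤
        coneMeasure volume (tangentGauge E x₀) (radialProj (tangentGauge E x₀) '' A) ∧
      coneMeasure volume (tangentGauge E x₀) (radialProj (tangentGauge E x₀) '' A) ≤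
        (l : ENNReal) ^ n * coneMeasure volume (gauge E) A := by
  have hl' : (0 : ℝ) < l := by exact_mod_cast hl
  have hp : IsPosHomogeneous (tangentGauge E x₀) := isPosHomogeneous_inner_div _ _
  have hproj : radialProj (gauge E) '' A = A :=
    (image_congr fun a ha => hE.radialProj_of_mem_frontier (hAE ha)).trans (image_id' A)
  have hAg : MeasurableSet (radialProj (gauge E) '' A) := hproj.symm ▸ hA
  have hpos : ∀ a ∈ A, 0 < tangentGauge E x₀ a := fun a ha => (inv_pos.2 hl').trans (hAl a ha)
  have hg : ∀ a ∈ A, gauge E a = 1 := fun a ha => hE.gauge_eq_one_iff.2 (hAE ha)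
  constructor
  · have h := hE.isPosHomogeneous.coneMeasure_image_radialProj_le (μ := volume) hp hAg hS one_pos
      fun a ha => ⟨hg a ha ▸ one_pos, hpos a ha, by
        rw [hg a ha, one_mul]; exact hE.tangentGauge_le_one hx₀ (hAE ha).1⟩
    rwa [hproj, one_pow, ENNReal.ofReal_one, one_mul] at h
  · have h := hp.coneMeasure_image_radialProj_le (μ := volume) hE.isPosHomogeneous hS hAg hl'
      fun a ha => ⟨hpos a ha, hg a ha ▸ one_pos, by
        rw [hg a ha]; exact ((inv_lt_iff_one_lt_mul₀' hl').1 (hAl a ha)).le⟩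
    rwa [hproj, finrank_euclideanSpace_fin, ENNReal.ofReal_pow hl'.le,
      ENNReal.ofReal_coe_nnreal] at h

theorem exists_coneMeasure_comparison (hx₀ : x₀ ∈ frontier E) {l : NNReal} (hl : 1 < l) :
    ∃ U ∈ 𝓝[frontier E] x₀, ∀ A ⊆ U, MeasurableSet A →
      coneMeasure volume (gauge E) A ≤ (l : ENNReal) ^ n *
        (ENNReal.ofReal (inner ℝ x₀ (normal E x₀)) *
          Measure.euclideanHausdorffMeasure (n - 1) A) ∧
      ENNReal.ofReal (inner ℝ x₀ (normal E x₀)) * Measure.euclideanHausdorffMeasure (n - 1) A ≤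
        (l : ENNReal) ^ (2 * n) * coneMeasure volume (gauge E) A := by
  have hl0 : 0 < l := one_pos.trans hl
  have hinv : l⁻¹ < 1 := inv_lt_one_of_one_lt₀ hl
  have hl1 : (1 : ENNReal) ≤ l := by exact_mod_cast hl.le
  have hpow : (l : ENNReal) ^ (n - 1) ≤ (l : ENNReal) ^ n := pow_le_pow_right₀ hl1 (n.sub_le 1)
  obtain ⟨U, hU, hlip⟩ := hE.exists_lipschitzOnWith_radialProj_tangentGauge_sub hx₀
    (tsub_pos_of_lt hinv)
  have hgt : ∀ᶠ a in 𝓝 x₀, (l : ℝ)⁻¹ < tangentGauge E x₀ a :=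
    continuousAt_const.eventually_lt continuous_tangentGauge.continuousAt
      (by rw [hE.tangentGauge_self hx₀]; exact_mod_cast hinv)
  refine ⟨_, inter_mem (inter_mem hU (nhdsWithin_le_nhds hgt)) self_mem_nhdsWithin,
    fun A hAU hA => ?_⟩
  set c := ENNReal.ofReal (inner ℝ x₀ (normal E x₀))
  set p := tangentGauge E x₀
  have hAlip := hlip.mono (hAU.trans (inter_subset_left.trans inter_subset_left))
  have hAl : ∀ a ∈ A, (l : ℝ)⁻¹ < p a := fun a ha => (hAU ha).1.2
  have hS : MeasurableSet (radialProj p '' A) :=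
    hA.image_of_continuousOn_injOn (lipschitzOnWith_of_sub_id hAlip).continuousOn
      (injOn_iff_injective.2 (antilipschitzWith_domRestrict_of_sub_id hAlip
        (tsub_lt_self one_pos (inv_pos.2 hl0))).injective)
  obtain ⟨hH₁, hH₂⟩ := euclideanHausdorffMeasure_image_comparison hl hAlip (n - 1)
  obtain ⟨hκ₁, hκ₂⟩ := hE.coneMeasure_tangentGauge_image_comparison hx₀ hA
    (hAU.trans inter_subset_right) hS hl0 hAl
  have hflat := hE.coneMeasure_tangentGauge_image hx₀ hS
    fun a ha => (inv_pos.2 (NNReal.coe_pos.2 hl0)).trans (hAl a ha)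
  constructor
  · calc coneMeasure volume (gauge E) A
        ≤ c * Measure.euclideanHausdorffMeasure (n - 1) (radialProj p '' A) := hκ₁.trans hflat.le
      _ ≤ c * (l ^ n * Measure.euclideanHausdorffMeasure (n - 1) A) := by
        gcongr c * ?_
        exact hH₁.trans (mul_le_mul_left hpow _)
      _ = l ^ n * (c * Measure.euclideanHausdorffMeasure (n - 1) A) := mul_left_comm _ _ _
  · calc c * Measure.euclideanHausdorffMeasure (n - 1) A
        ≤ c * (l ^ n * Measure.euclideanHausdorffMeasure (n - 1) (radialProj p '' A)) := by
          gcongr c * ?_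
          exact hH₂.trans (mul_le_mul_left hpow _)
      _ = l ^ n * coneMeasure volume p (radialProj p '' A) := by rw [hflat, mul_left_comm]
      _ ≤ l ^ n * (l ^ n * coneMeasure volume (gauge E) A) := by gcongr
      _ = l ^ (2 * n) * coneMeasure volume (gauge E) A := by ring

theorem coneMeasure_of_disjoint_frontier {A : Set (Space n)} (hA : MeasurableSet A)
    (h : Disjoint A (frontier E)) : coneMeasure volume (gauge E) A = 0 := by
  have hempty : {x | 0 < gauge E x ∧ gauge E x < 1 ∧ radialProj (gauge E) x ∈ A} = ∅ :=
    eq_empty_of_forall_notMem fun x hx =>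
      disjoint_left.1 h hx.2.2 (hE.radialProj_mem_frontier hx.1)
  rw [hE.isPosHomogeneous.coneMeasure_apply hA, hempty, measure_empty, mul_zero]

theorem coneMeasure_inter_frontier {A : Set (Space n)} (hA : MeasurableSet A) :
    coneMeasure volume (gauge E) (A ∩ frontier E) = coneMeasure volume (gauge E) A := by
  have hF : MeasurableSet (frontier E) := isClosed_frontier.measurableSet
  rw [← measure_inter_add_sdiff A hF,
    hE.coneMeasure_of_disjoint_frontier (hA.diff hF) disjoint_sdiff_left, add_zero]

omit hE in
theorem withDensity_boundaryMeasure_apply {A : Set (Space n)} (hA : MeasurableSet A)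
    (f : Space n → ENNReal) :
    (boundaryMeasure E).withDensity f A =
      ∫⁻ x in A ∩ frontier E, f x ∂Measure.euclideanHausdorffMeasure (n - 1) := by
  rw [withDensity_apply _ hA, boundaryMeasure, Measure.restrict_restrict hA]

theorem exists_coneMeasure_withDensity_comparison (x : Space n) {l : NNReal} (hl : 1 < l) :
    ∃ U ∈ 𝓝 x, ∀ A ⊆ U, MeasurableSet A →
      coneMeasure volume (gauge E) A ≤ (l : ENNReal) ^ (2 * n + 1) *
        (boundaryMeasure E).withDensity (fun y => ENNReal.ofReal (inner ℝ y (normal E y))) A ∧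
      (boundaryMeasure E).withDensity (fun y => ENNReal.ofReal (inner ℝ y (normal E y))) A ≤
        (l : ENNReal) ^ (2 * n + 1) * coneMeasure volume (gauge E) A := by
  by_cases hx : x ∈ frontier E
  · obtain ⟨U, hU, hκ⟩ := hE.exists_coneMeasure_comparison hx hl
    obtain ⟨T, hT, hρ⟩ := exists_setLIntegral_comparison
      (Measure.euclideanHausdorffMeasure (n - 1)) (hE.continuousOn_inner_normal x hx)
      (hE.inner_normal_pos hx) hl
    obtain ⟨N, hN, hNsub⟩ := mem_nhdsWithin_iff_exists_mem_nhds_inter.1 (inter_mem hU hT)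
    refine ⟨N, hN, fun A hAN hA => ?_⟩
    have hAF : MeasurableSet (A ∩ frontier E) := hA.inter isClosed_frontier.measurableSet
    have hAsub : A ∩ frontier E ⊆ U ∩ T := (inter_subset_inter_left _ hAN).trans hNsub
    obtain ⟨hκ₁, hκ₂⟩ := hκ _ (hAsub.trans inter_subset_left) hAF
    obtain ⟨hρ₁, hρ₂⟩ := hρ _ (hAsub.trans inter_subset_right) hAF
    rw [withDensity_boundaryMeasure_apply hA, ← hE.coneMeasure_inter_frontier hA]
    have hl1 : (1 : ENNReal) ≤ l := by exact_mod_cast hl.le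
    constructor
    · calc _ ≤ _ := hκ₁.trans (mul_le_mul_right hρ₂ _)
        _ = _ := by rw [← mul_assoc, ← pow_succ]
        _ ≤ _ := mul_le_mul_left (pow_le_pow_right₀ hl1 (by omega)) _
    · calc _ ≤ _ := hρ₁.trans (mul_le_mul_right hκ₂ _)
        _ = _ := by rw [← mul_assoc, ← pow_succ']
  · refine ⟨(frontier E)ᶜ, isClosed_frontier.isOpen_compl.mem_nhds hx, fun A hAU hA => ?_⟩
    have hdisj : Disjoint A (frontier E) := disjoint_left.2 fun a ha => hAU ha
    rw [hE.coneMeasure_of_disjoint_frontier hA hdisj, withDensity_boundaryMeasure_apply hA,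
      hdisj.inter_eq, setLIntegral_empty]
    exact ⟨zero_le, zero_le⟩

theorem coneMeasure_eq_withDensity :
    coneMeasure volume (gauge E) =
      (boundaryMeasure E).withDensity fun x => ENNReal.ofReal (inner ℝ x (normal E x)) := by
  refine le_antisymm (le_of_forall_one_lt_pow_smul (2 * n + 1) fun l hl => ?_)
    (le_of_forall_one_lt_pow_smul (2 * n + 1) fun l hl => ?_) <;>
  refine measure_le_of_locally_le fun x => ?_ <;>
  obtain ⟨U, hU, h⟩ := hE.exists_coneMeasure_withDensity_comparison x hl
  · exact ⟨U, hU, fun A hAU hA => (h A hAU hA).1⟩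
  · exact ⟨U, hU, fun A hAU hA => (h A hAU hA).2⟩

omit hE in
theorem aestronglyMeasurable_of_continuousOn {F : Type*} [TopologicalSpace F]
    [TopologicalSpace.PseudoMetrizableSpace F] [SecondCountableTopology F]
    {f : Space n → F} (hf : ContinuousOn f (frontier E)) :
    AEStronglyMeasurable f (boundaryMeasure E) :=
  hf.aestronglyMeasurable isClosed_frontier.measurableSet

theorem aemeasurable_inner_normal : AEMeasurable
    (fun x => ENNReal.ofReal (inner ℝ x (normal E x))) (boundaryMeasure E) :=
  (aestronglyMeasurable_of_continuousOn hE.continuousOn_inner_normal).aemeasurable.ennreal_ofReal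

omit hE in
theorem ae_boundaryMeasure_mem_frontier : ∀ᵐ x ∂boundaryMeasure E, x ∈ frontier E :=
  ae_restrict_mem isClosed_frontier.measurableSet

theorem integral_coneMeasure (f : Space n → ℝ) :
    ∫ x, f x ∂coneMeasure volume (gauge E) =
      ∫ x, inner ℝ x (normal E x) * f x ∂boundaryMeasure E := by
  rw [hE.coneMeasure_eq_withDensity, integral_withDensity_eq_integral_toReal_smul₀
    hE.aemeasurable_inner_normal (Eventually.of_forall fun _ => ENNReal.ofReal_lt_top)]
  refine integral_congr_ae ?_
  filter_upwards [ae_boundaryMeasure_mem_frontier] with x hx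
  rw [ENNReal.toReal_ofReal (hE.inner_normal_pos hx).le, smul_eq_mul]

theorem integrable_coneMeasure_iff {f : Space n → ℝ} :
    Integrable f (coneMeasure volume (gauge E)) ↔
      Integrable (fun x => inner ℝ x (normal E x) * f x) (boundaryMeasure E) := by
  rw [hE.coneMeasure_eq_withDensity, integrable_withDensity_iff_integrable_smul₀'
    hE.aemeasurable_inner_normal (Eventually.of_forall fun _ => ENNReal.ofReal_lt_top)]
  refine integrable_congr ?_
  filter_upwards [ae_boundaryMeasure_mem_frontier] with x hx
  rw [ENNReal.toReal_ofReal (hE.inner_normal_pos hx).le, smul_eq_mul]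

theorem ae_coneMeasure_iff {P : Space n → Prop} :
    (∀ᵐ x ∂coneMeasure volume (gauge E), P x) ↔ ∀ᵐ x ∂boundaryMeasure E, P x := by
  rw [hE.coneMeasure_eq_withDensity, ae_withDensity_iff' hE.aemeasurable_inner_normal]
  refine eventually_congr ?_
  filter_upwards [ae_boundaryMeasure_mem_frontier] with x hx
  simp [hE.inner_normal_pos hx]

end IsRegularConvex

/-! ### Mean curvature as a divergence -/

/-- The function `f` is Lipschitz in a neighbourhood of `x`. -/
def IsLipschitzNear {V W : Type*} [PseudoEMetricSpace V] [PseudoEMetricSpace W] (f : V → W)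
    (x : V) : Prop :=
  ∃ K, ∃ U ∈ 𝓝 x, LipschitzOnWith K f U

namespace IsLipschitzNear

variable {V W₁ W₂ : Type*} [NormedAddCommGroup V] [NormedAddCommGroup W₁] [NormedAddCommGroup W₂]

theorem continuousAt {f : V → W₁} {x : V} (hf : IsLipschitzNear f x) : ContinuousAt f x := by
  obtain ⟨K, U, hU, hK⟩ := hf
  exact hK.continuousOn.continuousAt hU

theorem prodMk {f : V → W₁} {g : V → W₂} {x : V} (hf : IsLipschitzNear f x)
    (hg : IsLipschitzNear g x) : IsLipschitzNear (fun y => (f y, g y)) x := by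
  obtain ⟨K, U, hU, hK⟩ := hf
  obtain ⟨L, T, hT, hL⟩ := hg
  exact ⟨max K L, U ∩ T, inter_mem hU hT,
    (hK.mono inter_subset_left).prodMk (hL.mono inter_subset_right)⟩

theorem id (x : V) : IsLipschitzNear (fun y : V => y) x :=
  ⟨1, univ, univ_mem, LipschitzWith.id.lipschitzOnWith⟩

variable [NormedSpace ℝ W₁] [NormedSpace ℝ W₂]

theorem contDiffAt_comp {f : V → W₁} {Ψ : W₁ → W₂} {x : V} (hf : IsLipschitzNear f x)
    (hΨ : ContDiffAt ℝ 1 Ψ (f x)) : IsLipschitzNear (fun y => Ψ (f y)) x := by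
  have hc := hf.continuousAt
  obtain ⟨K, U, hU, hK⟩ := hf
  obtain ⟨L, T, hT, hL⟩ := hΨ.exists_lipschitzOnWith
  exact ⟨L * K, U ∩ f ⁻¹' T, inter_mem hU (hc hT),
    hL.comp (hK.mono inter_subset_left) fun y hy => hy.2⟩

theorem smul {f : V → ℝ} {g : V → W₁} {x : V} (hf : IsLipschitzNear f x)
    (hg : IsLipschitzNear g x) : IsLipschitzNear (fun y => f y • g y) x :=
  (hf.prodMk hg).contDiffAt_comp (Ψ := fun q : ℝ × W₁ => q.1 • q.2)
    (contDiffAt_fst.smul contDiffAt_snd)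

theorem radialProj [NormedSpace ℝ V] {p : V → ℝ} {x : V} (hp : IsLipschitzNear p x)
    (hx : p x ≠ 0) : IsLipschitzNear (radialProj p) x :=
  (hp.contDiffAt_comp (Ψ := fun s : ℝ => s⁻¹) (contDiffAt_inv ℝ hx)).smul (id x)

end IsLipschitzNear

theorem hasFDerivAt_radialProj {V : Type*} [NormedAddCommGroup V] [NormedSpace ℝ V] {p : V → ℝ}
    {x : V} (hx : p x ≠ 0) (hd : DifferentiableAt ℝ p x) :
    HasFDerivAt (radialProj p) ((p x)⁻¹ • ContinuousLinearMap.id ℝ V +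
      ((-(p x ^ 2)⁻¹) • fderiv ℝ p x).smulRight x) x :=
  ((hasDerivAt_inv hx).comp_hasFDerivAt x hd.hasFDerivAt).smul (hasFDerivAt_id x)

section Divergence

/-- The divergence of a vector field, as the trace of its derivative. -/
def divergence {V : Type*} [NormedAddCommGroup V] [NormedSpace ℝ V] (X : V → V) (x : V) : ℝ :=
  LinearMap.trace ℝ V (fderiv ℝ X x : V →ₗ[ℝ] V)

theorem divergence_smul {V : Type*} [NormedAddCommGroup V] [NormedSpace ℝ V]
    [FiniteDimensional ℝ V] {φ : V → ℝ} {X : V → V} {x : V} {φ' : V →L[ℝ] ℝ}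
    (hφ : HasFDerivAt φ φ' x) (hX : DifferentiableAt ℝ X x) :
    divergence (fun y => φ y • X y) x = φ x * divergence X x + φ' (X x) := by
  have h : fderiv ℝ (fun y => φ y • X y) x = _ := (hφ.smul hX.hasFDerivAt).fderiv
  rw [divergence, h, ContinuousLinearMap.toLinearMap_add, map_add,
    ContinuousLinearMap.toLinearMap_smul, map_smul, divergence, smul_eq_mul]
  congr 1
  exact LinearMap.trace_smulRight _ _

variable {V : Type*} [NormedAddCommGroup V] [InnerProductSpace ℝ V]

theorem divergence_eq_sum {ι : Type*} [Fintype ι] (e : OrthonormalBasis ι ℝ V) (X : V → V)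
    (x : V) : divergence X x = ∑ i, inner ℝ (e i) (fderiv ℝ X x (e i)) :=
  LinearMap.trace_eq_sum_inner _ e

variable [FiniteDimensional ℝ V]

theorem measurable_divergence [MeasurableSpace V] [BorelSpace V] (X : V → V) :
    Measurable (divergence X) := by
  rw [show divergence X = _ from funext (divergence_eq_sum (stdOrthonormalBasis ℝ V) X)]
  exact Finset.measurable_sum _ fun i _ =>
    measurable_const.inner (measurable_fderiv_apply_const ℝ X _)

theorem sum_inner_orthogonal_eq_trace_sub (A : V →L[ℝ] V) {v : V} (hv : ‖v‖ = 1) :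
    ∑ i, inner ℝ (A (stdOrthonormalBasis ℝ (Submodule.span ℝ {v})ᗮ i : V))
      (stdOrthonormalBasis ℝ (Submodule.span ℝ {v})ᗮ i : V) =
    LinearMap.trace ℝ V (A : V →ₗ[ℝ] V) - inner ℝ (A v) v := by
  set W := (Submodule.span ℝ {v})ᗮ with hW
  set P : V →ₗ[ℝ] W := (W.orthogonalProjectionOnto : V →ₗ[ℝ] W)
  have htrace : ∑ i, inner ℝ (A (stdOrthonormalBasis ℝ W i : V))
      (stdOrthonormalBasis ℝ W i : V) =
      LinearMap.trace ℝ W (P ∘ₗ ((A : V →ₗ[ℝ] V) ∘ₗ W.subtype)) := by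
    rw [LinearMap.trace_eq_sum_inner _ (stdOrthonormalBasis ℝ W)]
    refine Finset.sum_congr rfl fun i _ => ?_
    rw [real_inner_comm]
    exact (Submodule.inner_orthogonalProjectionOnto_eq_of_mem_left _ _).symm
  have hproj : W.subtype ∘ₗ P =
      LinearMap.id - (InnerProductSpace.rankOne ℝ v v : V →ₗ[ℝ] V) := by
    ext1 x
    have h := Submodule.starProjection_orthogonal_val (K := Submodule.span ℝ {v}) x
    rw [Submodule.starProjection_unit_singleton ℝ hv x] at h
    simpa [P, hW] using h
  have hrank : (A : V →ₗ[ℝ] V) ∘ₗ (InnerProductSpace.rankOne ℝ v v : V →ₗ[ℝ] V) =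
      (InnerProductSpace.rankOne ℝ (A v) v : V →ₗ[ℝ] V) := by
    ext1 x
    simp
  rw [htrace, LinearMap.trace_comp_comm', LinearMap.comp_assoc, hproj, LinearMap.comp_sub,
    map_sub, LinearMap.comp_id, hrank, InnerProductSpace.trace_rankOne, real_inner_comm]

end Divergence

/-- The extension of the exterior normal of `E` to the whole space that is constant along the rays
from the origin. -/
def radialNormal (E : Set (Space n)) (x : Space n) : Space n :=
  normal E (radialProj (gauge E) x)

theorem IsPosHomogeneous.differentiableAt_radialProj {V : Type*} [NormedAddCommGroup V]
    [NormedSpace ℝ V] [MeasurableSpace V] {p : V → ℝ} (hp : IsPosHomogeneous p) {x : V}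
    (hx : 0 < p x) (hd : DifferentiableAt ℝ p x) : DifferentiableAt ℝ p (radialProj p x) := by
  have hscale : DifferentiableAt ℝ (fun y : V => p x • y) (radialProj p x) := by fun_prop
  rw [← smul_radialProj hx.ne'] at hd
  simpa only [Function.comp_apply, hp.map_smul _ hx, inv_mul_cancel_left₀ hx.ne'] using
    (hd.comp _ hscale).const_mul (p x)⁻¹

namespace IsRegularConvex

variable {E : Set (Space n)} (hE : IsRegularConvex E) {x : Space n}

include hE

theorem radialNormal_of_mem_frontier (hx : x ∈ frontier E) : radialNormal E x = normal E x := by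
  rw [radialNormal, hE.radialProj_of_mem_frontier hx]

theorem norm_radialNormal (hx : 0 < gauge E x) : ‖radialNormal E x‖ = 1 :=
  hE.norm_normal _ (hE.radialProj_mem_frontier hx)

theorem radialNormal_smul {t : ℝ} (ht : 0 < t) (x : Space n) :
    radialNormal E (t • x) = radialNormal E x := by
  rw [radialNormal, radialNormal, hE.isPosHomogeneous.radialProj_smul ht]

theorem eventually_gauge_pos (hx : 0 < gauge E x) : ∀ᶠ y in 𝓝 x, 0 < gauge E y :=
  (continuous_gauge hE.convex hE.mem_nhds).continuousAt.eventually (Ioi_mem_nhds hx)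

theorem inner_le_gauge_mul {z : Space n} (hz : z ∈ frontier E) (y : Space n) :
    inner ℝ y (normal E z) ≤ gauge E y * inner ℝ z (normal E z) := by
  have hc := hE.inner_normal_pos hz
  rw [← div_le_iff₀ hc]
  refine le_of_forall_gt_imp_ge_of_dense fun t ht => ?_
  have ht0 : 0 < t := (gauge_nonneg y).trans_lt ht
  have hgauge : gauge E (t⁻¹ • y) ≤ 1 := by
    rw [hE.isPosHomogeneous.map_smul _ (inv_pos.2 ht0), inv_mul_le_iff₀ ht0, mul_one]
    exact ht.le
  have hsupp := hE.inner_sub_nonpos z hz _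
    ((gauge_le_one_iff_mem_closure hE.convex hE.mem_nhds).1 hgauge)
  rw [inner_sub_left, real_inner_smul_left, sub_nonpos, inv_mul_le_iff₀ ht0] at hsupp
  rwa [div_le_iff₀ hc]

theorem fderiv_gauge_apply (hx : 0 < gauge E x) (hd : DifferentiableAt ℝ (gauge E) x)
    (v : Space n) :
    fderiv ℝ (gauge E) x v =
      inner ℝ v (radialNormal E x) / inner ℝ (radialProj (gauge E) x) (radialNormal E x) := by
  have hz : radialProj (gauge E) x ∈ frontier E := hE.radialProj_mem_frontier hx
  have hle : ∀ y, inner ℝ y (radialNormal E x) ≤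
      gauge E y * inner ℝ (radialProj (gauge E) x) (radialNormal E x) := hE.inner_le_gauge_mul hz
  have hc : 0 < inner ℝ (radialProj (gauge E) x) (radialNormal E x) := hE.inner_normal_pos hz
  set ν := radialNormal E x
  set c := inner ℝ (radialProj (gauge E) x) ν
  have hxν : inner ℝ ν x = gauge E x * c := by
    rw [← real_inner_smul_left, smul_radialProj hx.ne', real_inner_comm]
  -- The supporting hyperplane at the projection of `x` bounds the gauge from below, with equality
  -- at `x`.
  have hmin : IsLocalMin (fun y => gauge E y - c⁻¹ * inner ℝ ν y) x := by
    refine Eventually.of_forall fun y => ?_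
    simp only [hxν]
    rw [mul_comm (gauge E x), inv_mul_cancel_left₀ hc.ne', sub_self, sub_nonneg,
      inv_mul_le_iff₀ hc, real_inner_comm, mul_comm]
    exact hle y
  have hder : HasFDerivAt (fun y => gauge E y - c⁻¹ * inner ℝ ν y)
      (fderiv ℝ (gauge E) x - c⁻¹ • innerSL ℝ ν) x :=
    hd.hasFDerivAt.sub ((innerSL ℝ ν).hasFDerivAt.const_mul _)
  have hv := DFunLike.congr_fun (hmin.hasFDerivAt_eq_zero hder) v
  simp only [_root_.sub_apply, _root_.smul_apply, innerSL_apply_apply,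
    smul_eq_mul, _root_.zero_apply, sub_eq_zero] at hv
  rw [hv, div_eq_inv_mul, real_inner_comm v ν]

theorem mem_tangentConeAt (hx : x ∈ frontier E) (hd : DifferentiableAt ℝ (gauge E) x)
    {v : Space n} (hv : inner ℝ v (normal E x) = 0) : v ∈ tangentConeAt ℝ (frontier E) x := by
  have hg : gauge E x = 1 := hE.gauge_eq_one_iff.2 hx
  have hpos : 0 < gauge E x := hg ▸ one_pos
  have hv_mem : v ∈ tangentConeAt ℝ {y | 0 < gauge E y} x := by
    rw [tangentConeAt_of_mem_nhds (hE.eventually_gauge_pos hpos)]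
    exact mem_univ _
  have hfderiv : fderiv ℝ (gauge E) x v = 0 := by
    rw [hE.fderiv_gauge_apply hpos hd v, hE.radialNormal_of_mem_frontier hx, hv, zero_div]
  have hproj := (hasFDerivAt_radialProj hpos.ne' hd).hasFDerivWithinAt.mapsTo_tangent_cone hv_mem
  rw [hE.radialProj_of_mem_frontier hx] at hproj
  simp only [hg, inv_one, one_pow, one_smul, _root_.add_apply, ContinuousLinearMap.id_apply,
    ContinuousLinearMap.smulRight_apply, _root_.smul_apply, hfderiv, smul_zero, zero_smul,
    add_zero] at hproj
  refine tangentConeAt_mono ?_ hproj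
  rintro _ ⟨y, hy, rfl⟩
  exact hE.radialProj_mem_frontier hy

theorem meanCurvature_eq_trace_sub (hx : x ∈ frontier E) (hd : DifferentiableAt ℝ (gauge E) x)
    {f : Space n → Space n} {A : Space n →L[ℝ] Space n} (hf : HasFDerivAt f A x)
    (hfE : EqOn f (normal E) (frontier E)) :
    meanCurvature E x = LinearMap.trace ℝ (Space n) (A : Space n →ₗ[ℝ] Space n) -
      inner ℝ (A (normal E x)) (normal E x) := by
  rw [← sum_inner_orthogonal_eq_trace_sub A (hE.norm_normal x hx), meanCurvature, tangentialDiv]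
  refine Finset.sum_congr rfl fun i _ => ?_
  have hA : HasFDerivWithinAt (normal E) A (frontier E) x :=
    hf.hasFDerivWithinAt.congr (fun y hy => (hfE hy).symm) (hfE hx).symm
  rw [hA.differentiableWithinAt.hasFDerivWithinAt.unique_on hA (hE.mem_tangentConeAt hx hd ?_)]
  exact Submodule.mem_orthogonal_singleton_iff_inner_left.1
    (stdOrthonormalBasis ℝ (Submodule.span ℝ {normal E x})ᗮ i).2

theorem inner_fderiv_radialNormal (hx : 0 < gauge E x)
    (hd : DifferentiableAt ℝ (radialNormal E) x) (v : Space n) :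
    inner ℝ (fderiv ℝ (radialNormal E) x v) (radialNormal E x) = 0 := by
  have hinner := hd.hasFDerivAt.inner ℝ hd.hasFDerivAt
  have hconst : HasFDerivAt (fun y => inner ℝ (radialNormal E y) (radialNormal E y))
      (0 : Space n →L[ℝ] ℝ) x := by
    refine (hasFDerivAt_const (1 : ℝ) x).congr_of_eventuallyEq ?_
    filter_upwards [hE.eventually_gauge_pos hx] with y hy
    rw [real_inner_self_eq_norm_sq, hE.norm_radialNormal hy, one_pow]
  have h := DFunLike.congr_fun (hinner.unique hconst) v
  simp only [ContinuousLinearMap.comp_apply, ContinuousLinearMap.prod_apply, fderivInnerCLM_apply,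
    _root_.zero_apply] at h
  rw [real_inner_comm] at h
  linarith

theorem hasFDerivAt_radialNormal_radialProj (hx : 0 < gauge E x)
    (hd : DifferentiableAt ℝ (radialNormal E) x) :
    HasFDerivAt (radialNormal E) (gauge E x • fderiv ℝ (radialNormal E) x)
      (radialProj (gauge E) x) := by
  have hder := hd.hasFDerivAt
  rw [← hasFDerivWithinAt_univ, ← smul_radialProj (p := gauge E) hx.ne',
    ← smul_set_univ₀ hx.ne', ← hasFDerivWithinAt_comp_smul_smul_iff, smul_radialProj hx.ne',
    hasFDerivWithinAt_univ] at hder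
  simpa only [hE.radialNormal_smul hx] using hder

theorem meanCurvature_radialProj (hx : 0 < gauge E x) (hg : DifferentiableAt ℝ (gauge E) x)
    (hd : DifferentiableAt ℝ (radialNormal E) x) :
    meanCurvature E (radialProj (gauge E) x) = gauge E x * divergence (radialNormal E) x := by
  have horth : inner ℝ (fderiv ℝ (radialNormal E) x (radialNormal E x)) (radialNormal E x) = 0 :=
    hE.inner_fderiv_radialNormal hx hd _
  rw [hE.meanCurvature_eq_trace_sub (hE.radialProj_mem_frontier hx)
      (hE.isPosHomogeneous.differentiableAt_radialProj hx hg)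
      (hE.hasFDerivAt_radialNormal_radialProj hx hd)
      fun y hy => hE.radialNormal_of_mem_frontier hy,
    ← radialNormal, _root_.smul_apply, real_inner_smul_left, horth, mul_zero, sub_zero,
    ContinuousLinearMap.toLinearMap_smul, map_smul, smul_eq_mul, divergence]

theorem isLipschitzNear_gauge (x : Space n) : IsLipschitzNear (gauge E) x := by
  obtain ⟨L, hL⟩ := hE.convex.lipschitz_gauge hE.mem_nhds
  exact ⟨L, univ, univ_mem, hL.lipschitzOnWith⟩

theorem isLipschitzNear_radialNormal (hx : 0 < gauge E x) : IsLipschitzNear (radialNormal E) x := by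
  have hproj := (hE.isLipschitzNear_gauge x).radialProj hx.ne'
  have hcont : Tendsto (radialProj (gauge E)) (𝓝 x) (𝓝[frontier E] radialProj (gauge E) x) := by
    refine tendsto_nhdsWithin_iff.2 ⟨hproj.continuousAt, ?_⟩
    filter_upwards [hE.eventually_gauge_pos hx] with y hy
    exact hE.radialProj_mem_frontier hy
  obtain ⟨K, U, hU, hK⟩ := hproj
  obtain ⟨L, T, hT, hL⟩ := hE.locallyLipschitzOn (hE.radialProj_mem_frontier hx)
  exact ⟨L * K, U ∩ radialProj (gauge E) ⁻¹' T, inter_mem hU (hcont hT),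
    hL.comp (hK.mono inter_subset_left) fun y hy => hy.2⟩

theorem ae_differentiableAt_radialNormal :
    ∀ᵐ x : Space n, 0 < gauge E x → DifferentiableAt ℝ (radialNormal E) x := by
  rw [ae_iff]
  refine measure_null_of_locally_null _ fun x hx => ?_
  obtain ⟨hpos, -⟩ := Classical.not_imp.1 hx
  obtain ⟨K, U, hU, hK⟩ := hE.isLipschitzNear_radialNormal hpos
  have hae := (hK.mono interior_subset).ae_differentiableWithinAt (μ := volume)
    isOpen_interior.measurableSet
  rw [ae_restrict_iff' isOpen_interior.measurableSet] at hae
  refine ⟨_, inter_mem_nhdsWithin _ (interior_mem_nhds.2 hU),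
    measure_mono_null ?_ (ae_iff.1 hae)⟩
  rintro y ⟨hy, hyU⟩ hdiff
  exact (Classical.not_imp.1 hy).2 ((hdiff hyU).differentiableAt (isOpen_interior.mem_nhds hyU))

theorem ae_differentiableAt_gauge_and_radialNormal : ∀ᵐ x : Space n, 0 < gauge E x →
    DifferentiableAt ℝ (gauge E) x ∧ DifferentiableAt ℝ (radialNormal E) x := by
  obtain ⟨L, hL⟩ := hE.convex.lipschitz_gauge hE.mem_nhds
  filter_upwards [hE.ae_differentiableAt_radialNormal, hL.ae_differentiableAt] with x hN hg hx
  exact ⟨hg, hN hx⟩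

theorem ae_boundaryMeasure_differentiableAt : ∀ᵐ z ∂boundaryMeasure E,
    DifferentiableAt ℝ (gauge E) z ∧ DifferentiableAt ℝ (radialNormal E) z := by
  have hp := hE.isPosHomogeneous
  have hmeas : MeasurableSet
      {z | DifferentiableAt ℝ (gauge E) z ∧ DifferentiableAt ℝ (radialNormal E) z} :=
    (measurableSet_of_differentiableAt ℝ _).inter (measurableSet_of_differentiableAt ℝ _)
  rw [← hE.ae_coneMeasure_iff]
  refine Measure.ae_smul_measure ?_ _
  rw [ae_map_iff hp.measurable_radialProj.aemeasurable hmeas]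
  filter_upwards [ae_restrict_of_ae hE.ae_differentiableAt_gauge_and_radialNormal,
    ae_restrict_mem ((measurableSet_lt measurable_const hp.measurable).inter
      (measurableSet_lt hp.measurable measurable_const))] with x hdiff hx
  obtain ⟨hg, hN⟩ := hdiff hx.1
  exact ⟨hp.differentiableAt_radialProj hx.1 hg,
    (hE.hasFDerivAt_radialNormal_radialProj hx.1 hN).differentiableAt⟩

theorem ae_meanCurvature_eq_divergence :
    ∀ᵐ z ∂boundaryMeasure E, meanCurvature E z = divergence (radialNormal E) z := by
  filter_upwards [hE.ae_boundaryMeasure_differentiableAt, ae_boundaryMeasure_mem_frontier]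
    with z ⟨hg, hN⟩ hz
  have hgz : gauge E z = 1 := hE.gauge_eq_one_iff.2 hz
  have h := hE.meanCurvature_radialProj (hgz ▸ one_pos) hg hN
  rwa [hE.radialProj_of_mem_frontier hz, hgz, one_mul] at h

theorem aestronglyMeasurable_meanCurvature :
    AEStronglyMeasurable (meanCurvature E) (boundaryMeasure E) :=
  (measurable_divergence _).aestronglyMeasurable.congr
    (hE.ae_meanCurvature_eq_divergence.mono fun _ hz => hz.symm)

end IsRegularConvex

/-! ### The divergence theorem in polar coordinates -/

theorem exists_lipschitzWith_of_locallyLipschitz {X F : Type*} [PseudoMetricSpace X]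
    [ProperSpace X] [NormedAddCommGroup F] {f : X → F} (hf : LocallyLipschitz f)
    (hc : HasCompactSupport f) : ∃ K, LipschitzWith K f := by
  obtain ⟨K, hK⟩ := (hf.locallyLipschitzOn (s := Metric.cthickening 1 (tsupport f))
    ).exists_lipschitzOnWith_of_compact (IsCompact.cthickening hc)
  obtain ⟨C, hC⟩ := hc.exists_bound_of_continuous hf.continuous
  refine ⟨max K (2 * C).toNNReal, LipschitzWith.of_dist_le_mul fun x y => ?_⟩
  have hKmax : (K : ℝ) ≤ max K (2 * C).toNNReal := NNReal.coe_le_coe.2 (le_max_left _ _)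
  have hCmax : 2 * C ≤ max K (2 * C).toNNReal :=
    (Real.le_coe_toNNReal _).trans (NNReal.coe_le_coe.2 (le_max_right _ _))
  by_cases hsupp : x ∈ tsupport f ∨ y ∈ tsupport f
  · rcases le_or_gt (dist x y) 1 with hxy | hxy
    · have hmem :
          x ∈ Metric.cthickening 1 (tsupport f) ∧ y ∈ Metric.cthickening 1 (tsupport f) := by
        rcases hsupp with hx | hy
        · exact ⟨Metric.self_subset_cthickening _ hx,
            Metric.mem_cthickening_of_dist_le _ x _ _ hx (dist_comm x y ▸ hxy)⟩
        · exact ⟨Metric.mem_cthickening_of_dist_le _ y _ _ hy hxy,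
            Metric.self_subset_cthickening _ hy⟩
      exact (hK.dist_le_mul x hmem.1 y hmem.2).trans (by gcongr)
    · calc dist (f x) (f y)
          ≤ ‖f x‖ + ‖f y‖ := dist_eq_norm (f x) (f y) ▸ norm_sub_le _ _
        _ ≤ 2 * C := by linarith [hC x, hC y]
        _ ≤ 2 * C * dist x y :=
          le_mul_of_one_le_right (by linarith [norm_nonneg (f x), hC x]) hxy.le
        _ ≤ _ := by gcongr
  · obtain ⟨hx, hy⟩ := not_or.1 hsupp
    rw [image_eq_zero_of_notMem_tsupport hx, image_eq_zero_of_notMem_tsupport hy, dist_self]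
    positivity

section DivergenceTheorem

variable {V : Type*} [NormedAddCommGroup V] [MeasurableSpace V] [BorelSpace V] {K : NNReal}

section NormedSpace

variable [NormedSpace ℝ V] {μ : Measure V} {f : V → ℝ}

theorem integrable_lineDeriv [IsFiniteMeasureOnCompacts μ] (hf : LipschitzWith K f)
    (hc : HasCompactSupport f) (v : V) : Integrable (fun x => lineDeriv ℝ f x v) μ := by
  have : IsFiniteMeasure (μ.restrict (tsupport f)) :=
    isFiniteMeasure_restrict.2 hc.measure_lt_top.ne
  have hint : IntegrableOn (fun x => lineDeriv ℝ f x v) (tsupport f) μ :=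
    ((hf.memLp_lineDeriv v).restrict _).integrable le_top
  refine (integrableOn_iff_integrable_of_support_subset fun x hx => ?_).1 hint
  by_contra hx'
  have hzero : f =ᶠ[𝓝 x] fun _ => 0 := notMem_tsupport_iff_eventuallyEq.1 hx'
  exact hx (by simp only [hzero.lineDeriv_eq]; simp [lineDeriv])

theorem integral_lineDeriv_eq_zero [FiniteDimensional ℝ V] [μ.IsAddHaarMeasure]
    (hf : LipschitzWith K f) (hc : HasCompactSupport f) (v : V) :
    ∫ x, lineDeriv ℝ f x v ∂μ = 0 := by
  have h := LipschitzWith.integral_lineDeriv_mul_eq (μ := μ) (LipschitzWith.const (1 : ℝ)) hf hc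
    (-v)
  simpa [lineDeriv] using h.symm

end NormedSpace

theorem integral_divergence_eq_zero [InnerProductSpace ℝ V] [FiniteDimensional ℝ V]
    {μ : Measure V} [μ.IsAddHaarMeasure] {X : V → V} (hX : LipschitzWith K X)
    (hc : HasCompactSupport X) : ∫ x, divergence X x ∂μ = 0 := by
  set e := stdOrthonormalBasis ℝ V
  have hLip : ∀ i, LipschitzWith (‖innerSL ℝ (e i)‖₊ * K) fun x => inner ℝ (e i) (X x) := fun i =>
    (innerSL ℝ (e i)).lipschitz.comp hX
  have hsupp : ∀ i, HasCompactSupport fun x => inner ℝ (e i) (X x) := fun i =>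
    hc.comp_left (g := fun y => inner ℝ (e i) y) (inner_zero_right _)
  have hae : ∀ᵐ x ∂μ, divergence X x =
      ∑ i, lineDeriv ℝ (fun x => inner ℝ (e i) (X x)) x (e i) := by
    filter_upwards [hX.ae_differentiableAt] with x hx
    rw [divergence_eq_sum e]
    refine Finset.sum_congr rfl fun i _ => ?_
    have hder : HasFDerivAt (fun x => inner ℝ (e i) (X x))
        ((innerSL ℝ (e i)).comp (fderiv ℝ X x)) x :=
      (innerSL ℝ (e i)).hasFDerivAt.comp x hx.hasFDerivAt
    rw [(hder.hasLineDerivAt (e i)).lineDeriv, ContinuousLinearMap.comp_apply,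
      innerSL_apply_apply]
  rw [integral_congr_ae hae,
    integral_finsetSum _ fun i _ => integrable_lineDeriv (hLip i) (hsupp i) _]
  exact Finset.sum_eq_zero fun i _ => integral_lineDeriv_eq_zero (hLip i) (hsupp i) _

end DivergenceTheorem

section RadialIntegrals

variable {θ : ℝ → ℝ} {k : ℕ}

theorem integrable_powMeasure_of_hasCompactSupport (hθ : Continuous θ) (hc : HasCompactSupport θ) :
    Integrable θ (powMeasure k) :=
  integrable_powMeasure.2
    (((continuous_pow k).mul hθ).integrable_of_hasCompactSupport hc.mul_left).integrableOn

theorem eqOn_pow_succ_mul_div :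
    EqOn (fun s => s ^ (k + 1) * (θ s / s)) (fun s => s ^ k * θ s) (Ioi 0) := by
  intro s hs
  have hs0 : s ≠ 0 := (mem_Ioi.1 hs).ne'
  simp only [pow_succ]
  field_simp

theorem integrable_div_powMeasure_succ :
    Integrable (fun s => θ s / s) (powMeasure (k + 1)) ↔ Integrable θ (powMeasure k) := by
  rw [integrable_powMeasure, integrable_powMeasure,
    integrableOn_congr_fun eqOn_pow_succ_mul_div measurableSet_Ioi]

theorem integral_div_powMeasure_succ :
    ∫ s, θ s / s ∂powMeasure (k + 1) = ∫ s, θ s ∂powMeasure k := by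
  rw [integral_powMeasure, integral_powMeasure]
  exact setIntegral_congr_fun measurableSet_Ioi eqOn_pow_succ_mul_div

theorem integral_deriv_powMeasure_succ (hθ : ContDiff ℝ 1 θ) (hc : HasCompactSupport θ) :
    ∫ s, deriv θ s ∂powMeasure (k + 1) = -(k + 1) * ∫ s, θ s ∂powMeasure k := by
  have hder : ∀ s ∈ Ici (0 : ℝ), HasDerivAt (fun s => s ^ (k + 1) * θ s)
      ((k + 1) * (s ^ k * θ s) + s ^ (k + 1) * deriv θ s) s := by
    intro s _
    refine ((hasDerivAt_pow (k + 1) s).mul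
      (hθ.differentiable one_ne_zero s).hasDerivAt).congr_deriv ?_
    simp only [Nat.add_sub_cancel, Nat.cast_add, Nat.cast_one]
    ring
  have htend : Tendsto (fun s : ℝ => s ^ (k + 1) * θ s) atTop (𝓝 0) :=
    (hc.mul_left (f := fun s => s ^ (k + 1))).is_zero_at_infty.mono_left atTop_le_cocompact
  have hint := integrable_powMeasure.1 (integrable_powMeasure_of_hasCompactSupport (k := k)
    hθ.continuous hc)
  have hint' := integrable_powMeasure.1 (integrable_powMeasure_of_hasCompactSupport (k := k + 1)
    (hθ.continuous_deriv le_rfl) hc.deriv)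
  have h := integral_Ioi_of_hasDerivAt_of_tendsto' hder ((hint.const_mul _).add hint') htend
  rw [integral_add (hint.const_mul _) hint', integral_const_mul, zero_pow k.succ_ne_zero, zero_mul,
    sub_zero] at h
  rw [integral_powMeasure, integral_powMeasure]
  linarith

theorem integral_powMeasure_pos (hθ : Continuous θ) (hc : HasCompactSupport θ) (h0 : 0 ≤ θ)
    {s : ℝ} (hs : 0 < s) (hθs : θ s ≠ 0) : 0 < ∫ s, θ s ∂powMeasure k := by
  rw [integral_powMeasure, setIntegral_pos_iff_support_of_nonneg_ae]
  · have hopen : IsOpen (Function.support (fun s => s ^ k * θ s) ∩ Ioi 0) :=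
      ((continuous_pow k).mul hθ).isOpen_support.inter isOpen_Ioi
    exact hopen.measure_pos volume ⟨s, mul_ne_zero (pow_ne_zero k hs.ne') hθs, hs⟩
  · filter_upwards [ae_restrict_mem measurableSet_Ioi] with s hs
    exact mul_nonneg (pow_nonneg (mem_Ioi.1 hs).le _) (h0 s)
  · exact integrable_powMeasure.1 (integrable_powMeasure_of_hasCompactSupport hθ hc)

end RadialIntegrals

/-! ### Integration by parts on the boundary -/

theorem integrable_exp_neg_mul_norm_sq {V : Type*} [NormedAddCommGroup V] [InnerProductSpace ℝ V]
    [FiniteDimensional ℝ V] [MeasurableSpace V] [BorelSpace V] {b : ℝ} (hb : 0 < b) :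
    Integrable fun x : V => Real.exp (-b * ‖x‖ ^ 2) := by
  by_contra h
  have hpos : 0 < (Real.pi / b) ^ (Module.finrank ℝ V / 2 : ℝ) := by positivity
  rw [← GaussianFourier.integral_rexp_neg_mul_sq_norm (V := V) hb, integral_undef h] at hpos
  exact hpos.false

namespace IsRegularConvex

variable {E : Set (Space n)} (hE : IsRegularConvex E) {f : Space n → ℝ} {b : ℝ}

include hE

theorem integrable_exp_coneMeasure (hb : 0 < b) :
    Integrable (fun z => Real.exp (-b * ‖z‖ ^ 2)) (coneMeasure volume (gauge E)) := by
  have hp := hE.isPosHomogeneous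
  have hcont : Continuous fun z : Space n => Real.exp (-b * ‖z‖ ^ 2) := by fun_prop
  refine Integrable.smul_measure ?_ (ENNReal.natCast_ne_top _)
  rw [integrable_map_measure hcont.aestronglyMeasurable hp.measurable_radialProj.aemeasurable]
  refine Integrable.mono' (integrable_exp_neg_mul_norm_sq hb).restrict
    (hcont.measurable.comp hp.measurable_radialProj).aestronglyMeasurable ?_
  filter_upwards [ae_restrict_mem ((measurableSet_lt measurable_const hp.measurable).inter
    (measurableSet_lt hp.measurable measurable_const))] with x ⟨hx0, hx1⟩
  have hnorm : ‖x‖ ≤ ‖radialProj (gauge E) x‖ := by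
    conv_lhs => rw [← smul_radialProj (p := gauge E) hx0.ne', norm_smul, Real.norm_of_nonneg hx0.le]
    exact mul_le_of_le_one_left (norm_nonneg _) hx1.le
  rw [Function.comp_apply, Real.norm_of_nonneg (Real.exp_nonneg _), Real.exp_le_exp, neg_mul,
    neg_mul, neg_le_neg_iff]
  gcongr

theorem integrable_exp (hb : 0 < b) :
    Integrable (fun z => Real.exp (-b * ‖z‖ ^ 2)) (boundaryMeasure E) := by
  have hint := hE.integrable_coneMeasure_iff.1 (hE.integrable_exp_coneMeasure hb)
  obtain ⟨δ, hδ, hle⟩ := hE.exists_le_inner_normal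
  refine (hint.const_mul δ⁻¹).mono' (Continuous.aestronglyMeasurable (by fun_prop)) ?_
  filter_upwards [ae_boundaryMeasure_mem_frontier] with z hz
  rw [Real.norm_of_nonneg (Real.exp_nonneg _), ← mul_assoc]
  refine le_mul_of_one_le_left (Real.exp_nonneg _) ?_
  rw [le_inv_mul_iff₀ hδ, mul_one]
  exact hle z hz

omit hE in
theorem integrable_of_continuousOn_of_le {g : Space n → ℝ} (hg : Integrable g (boundaryMeasure E))
    (hf : ContinuousOn f (frontier E)) (hfg : ∀ z ∈ frontier E, |f z| ≤ g z) :
    Integrable f (boundaryMeasure E) :=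
  hg.mono' (aestronglyMeasurable_of_continuousOn hf)
    (ae_boundaryMeasure_mem_frontier.mono hfg)

theorem integrable_of_continuousOn_of_hasCompactSupport (hf : ContinuousOn f (frontier E))
    (hc : HasCompactSupport f) : Integrable f (boundaryMeasure E) := by
  obtain ⟨C, hC⟩ := (hc.inter_right isClosed_frontier).exists_bound_of_continuousOn
    (hf.mono inter_subset_right)
  obtain ⟨R, hR⟩ := hc.isBounded.exists_norm_le
  refine integrable_of_continuousOn_of_le
    ((hE.integrable_exp one_pos).const_mul (|C| * Real.exp (R ^ 2))) hf fun z hz => ?_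
  by_cases hzf : z ∈ tsupport f
  · have hle : |f z| ≤ |C| := (hC z ⟨hzf, hz⟩).trans (le_abs_self C)
    have hnorm := hR z hzf
    have hexp : 1 ≤ Real.exp (R ^ 2) * Real.exp (-1 * ‖z‖ ^ 2) := by
      rw [← Real.exp_add, Real.one_le_exp_iff, neg_one_mul, ← sub_eq_add_neg, sub_nonneg]
      gcongr
    rw [mul_assoc]
    exact hle.trans (le_mul_of_one_le_right (abs_nonneg C) hexp)
  · rw [image_eq_zero_of_notMem_tsupport hzf, abs_zero]
    positivity

end IsRegularConvex

/-- The cutoff in the radial variable, supported in `[1, 3]`, that keeps the flux below away from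
the origin. -/
def radialBump : ContDiffBump (2 : ℝ) := ⟨1 / 2, 1, by norm_num, by norm_num⟩

theorem tsupport_radialBump : tsupport radialBump = Icc 1 3 := by
  rw [radialBump.tsupport_eq, Real.closedBall_eq_Icc]
  norm_num [radialBump]

theorem radialBump_eq_zero {s : ℝ} (hs : s ∉ Icc (1 : ℝ) 3) : radialBump s = 0 :=
  image_eq_zero_of_notMem_tsupport (tsupport_radialBump ▸ hs)

theorem integral_radialBump_pos (k : ℕ) : 0 < ∫ s, radialBump s ∂powMeasure k :=
  integral_powMeasure_pos radialBump.continuous radialBump.hasCompactSupport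
    (fun _ => radialBump.nonneg) two_pos
    (radialBump.pos_of_mem_ball (by simp [radialBump])).ne'

/-- The tangential component `x - ⟨x, ν⟩ ν` of the position vector of a boundary point. -/
def tangentialPart (E : Set (Space n)) (x : Space n) : Space n :=
  x - inner ℝ x (normal E x) • normal E x

/-- The field `h ν`, extended from the boundary of `E` along the rays from the origin and cut off
radially. Its divergence theorem in gauge polar coordinates is integration by parts on `∂E`. -/
def radialFlux (E : Set (Space n)) (h : Space n → ℝ) (y : Space n) : Space n :=
  (h (radialProj (gauge E) y) * radialBump (gauge E y)) • radialNormal E y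

theorem radialFlux_eq_zero {E : Set (Space n)} (h : Space n → ℝ) {x : Space n}
    (hx : gauge E x ∉ Icc (1 : ℝ) 3) : radialFlux E h x = 0 := by
  rw [radialFlux, radialBump_eq_zero hx, mul_zero, zero_smul]

theorem hasCompactSupport_radialFlux {E : Set (Space n)} {h : Space n → ℝ}
    (hc : HasCompactSupport h) : HasCompactSupport (radialFlux E h) := by
  refine HasCompactSupport.intro ((isCompact_Icc (a := (1 : ℝ)) (b := 3)).smul_set hc)
    fun x hx => ?_
  by_contra hflux
  have hg : gauge E x ∈ Icc (1 : ℝ) 3 := by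
    by_contra hg
    exact hflux (radialFlux_eq_zero h hg)
  have hz : radialProj (gauge E) x ∈ tsupport h := by
    by_contra hz
    rw [radialFlux, image_eq_zero_of_notMem_tsupport hz, zero_mul, zero_smul] at hflux
    exact hflux rfl
  exact hx (mem_smul.2 ⟨_, hg, _, hz, smul_radialProj (one_pos.trans_le hg.1).ne'⟩)

namespace IsRegularConvex

variable {E : Set (Space n)} (hE : IsRegularConvex E) {h : Space n → ℝ} {x : Space n}

include hE

theorem ne_zero_of_mem_frontier (hx : x ∈ frontier E) : x ≠ 0 := by
  rintro rfl
  simpa using hE.inner_normal_pos hx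

theorem eventually_radialFlux_eq_zero (h : Space n → ℝ) (hx : gauge E x < 1) :
    radialFlux E h =ᶠ[𝓝 x] fun _ => 0 := by
  filter_upwards [(continuous_gauge hE.convex hE.mem_nhds).continuousAt.eventually
    (Iio_mem_nhds hx)] with y hy
  exact radialFlux_eq_zero h fun hy' => hy'.1.not_gt hy

theorem fderiv_radialProj_radialNormal (hx : 0 < gauge E x)
    (hg : DifferentiableAt ℝ (gauge E) x) :
    fderiv ℝ (radialProj (gauge E)) x (radialNormal E x) =
      -(gauge E x * inner ℝ (radialProj (gauge E) x) (radialNormal E x))⁻¹ •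
        tangentialPart E (radialProj (gauge E) x) := by
  have hpos : 0 < inner ℝ (radialProj (gauge E) x) (radialNormal E x) :=
    hE.inner_normal_pos (hE.radialProj_mem_frontier hx)
  have hν : normal E (radialProj (gauge E) x) = radialNormal E x := rfl
  have hx_eq : x = gauge E x • radialProj (gauge E) x := (smul_radialProj hx.ne').symm
  rw [(hasFDerivAt_radialProj hx.ne' hg).fderiv]
  simp only [_root_.add_apply, _root_.smul_apply, ContinuousLinearMap.id_apply,
    ContinuousLinearMap.smulRight_apply, hE.fderiv_gauge_apply hx hg,
    real_inner_self_eq_norm_sq, hE.norm_radialNormal hx, tangentialPart, hν, smul_eq_mul]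
  set z := radialProj (gauge E) x
  set ν := radialNormal E x
  rw [show ∀ c : ℝ, c • x = (c * gauge E x) • z from fun c => by rw [mul_smul, ← hx_eq]]
  match_scalars <;> field_simp

theorem divergence_radialFlux (hh : ContDiffOn ℝ 1 h {0}ᶜ) (hx : 0 < gauge E x)
    (hg : DifferentiableAt ℝ (gauge E) x) (hd : DifferentiableAt ℝ (radialNormal E) x)
    {z : Space n} (hz : radialProj (gauge E) x = z) :
    divergence (radialFlux E h) x =
      (h z * meanCurvature E z - fderiv ℝ h z (tangentialPart E z) / inner ℝ z (normal E z)) *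
          (radialBump (gauge E x) / gauge E x) +
        h z / inner ℝ z (normal E z) * deriv radialBump (gauge E x) := by
  have hzE : z ∈ frontier E := hz ▸ hE.radialProj_mem_frontier hx
  have hpos := hE.inner_normal_pos hzE
  have hH : meanCurvature E z = gauge E x * divergence (radialNormal E) x :=
    hz ▸ hE.meanCurvature_radialProj hx hg hd
  have hν : radialNormal E x = normal E z := by rw [radialNormal, hz]
  have hproj : HasFDerivAt (radialProj (gauge E)) (fderiv ℝ (radialProj (gauge E)) x) x :=
    (hasFDerivAt_radialProj hx.ne' hg).differentiableAt.hasFDerivAt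
  have hproj_ν : fderiv ℝ (radialProj (gauge E)) x (normal E z) =
      -(gauge E x * inner ℝ z (normal E z))⁻¹ • tangentialPart E z := by
    rw [← hν, hE.fderiv_radialProj_radialNormal hx hg, hz, hν]
  have hgauge_ν : fderiv ℝ (gauge E) x (normal E z) = (inner ℝ z (normal E z))⁻¹ := by
    rw [← hν, hE.fderiv_gauge_apply hx hg, real_inner_self_eq_norm_sq, hE.norm_radialNormal hx,
      one_pow, one_div, hz]
  have hh_z : HasFDerivAt h (fderiv ℝ h z) (radialProj (gauge E) x) := by
    rw [hz]
    exact ((hh.contDiffAt (isOpen_compl_singleton.mem_nhds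
      (hE.ne_zero_of_mem_frontier hzE))).differentiableAt one_ne_zero).hasFDerivAt
  have hbump := ((radialBump.contDiff (n := 1)).differentiable one_ne_zero (gauge E x)).hasDerivAt
  have hdiv : divergence (radialFlux E h) x = _ := divergence_smul
    ((hh_z.comp x hproj).mul (hbump.comp_hasFDerivAt x hg.hasFDerivAt)) hd
  simp only [_root_.add_apply, _root_.smul_apply, ContinuousLinearMap.comp_apply, smul_eq_mul,
    Function.comp_apply, hz, hν, hproj_ν, hgauge_ν, map_smul] at hdiv
  rw [hdiv, hH]
  field_simp
  ring

theorem locallyLipschitz_radialFlux (hh : ContDiffOn ℝ 1 h {0}ᶜ) :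
    LocallyLipschitz (radialFlux E h) := by
  intro x
  rcases (gauge_nonneg (s := E) x).eq_or_lt with hx | hx
  · refine ⟨0, _, hE.eventually_radialFlux_eq_zero h (hx ▸ one_pos), ?_⟩
    exact LipschitzOnWith.of_dist_le_mul fun y hy z hz => by
      rw [show radialFlux E h y = 0 from hy, show radialFlux E h z = 0 from hz]
      simp
  · have hz : radialProj (gauge E) x ≠ 0 :=
      hE.ne_zero_of_mem_frontier (hE.radialProj_mem_frontier hx)
    have hgauge := hE.isLipschitzNear_gauge x
    have hproj := (hgauge.radialProj hx.ne').contDiffAt_comp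
      (hh.contDiffAt (isOpen_compl_singleton.mem_nhds hz))
    have hbump := hgauge.contDiffAt_comp (radialBump.contDiff (n := 1)).contDiffAt
    exact (hproj.smul hbump).smul (hE.isLipschitzNear_radialNormal hx)

theorem ae_divergence_radialFlux (hh : ContDiffOn ℝ 1 h {0}ᶜ) :
    ∀ᵐ x, divergence (radialFlux E h) x = {x | 0 < gauge E x}.indicator (fun x =>
      let z := radialProj (gauge E) x
      (h z * meanCurvature E z - fderiv ℝ h z (tangentialPart E z) / inner ℝ z (normal E z)) *
          (radialBump (gauge E x) / gauge E x) +
        h z / inner ℝ z (normal E z) * deriv radialBump (gauge E x)) x := by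
  filter_upwards [hE.ae_differentiableAt_gauge_and_radialNormal] with x hdiff
  by_cases hx : 0 < gauge E x
  · rw [indicator_of_mem (by exact hx)]
    exact hE.divergence_radialFlux hh hx (hdiff hx).1 (hdiff hx).2 rfl
  · rw [indicator_of_notMem (by exact hx), divergence,
      (hE.eventually_radialFlux_eq_zero h ((not_lt.1 hx).trans_lt one_pos)).fderiv_eq]
    simp

theorem integral_coneMeasure_mul_meanCurvature (hn : 2 ≤ n) (hh : ContDiffOn ℝ 1 h {0}ᶜ)
    (hc : HasCompactSupport h)
    (hi₁ : Integrable (fun z => h z * meanCurvature E z -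
      fderiv ℝ h z (tangentialPart E z) / inner ℝ z (normal E z)) (coneMeasure volume (gauge E)))
    (hi₂ : Integrable (fun z => h z / inner ℝ z (normal E z)) (coneMeasure volume (gauge E))) :
    ∫ z, (h z * meanCurvature E z -
        fderiv ℝ h z (tangentialPart E z) / inner ℝ z (normal E z)) ∂coneMeasure volume (gauge E) =
      (n - 1) * ∫ z, h z / inner ℝ z (normal E z) ∂coneMeasure volume (gauge E) := by
  obtain ⟨k, rfl⟩ := Nat.exists_eq_add_of_le' hn
  set f₁ : Space (k + 2) → ℝ := fun z =>
    h z * meanCurvature E z - fderiv ℝ h z (tangentialPart E z) / inner ℝ z (normal E z)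
  set f₂ : Space (k + 2) → ℝ := fun z => h z / inner ℝ z (normal E z)
  have hp := hE.isPosHomogeneous
  have := hp.sigmaFinite_coneMeasure (μ := volume)
  have : SFinite (powMeasure (k + 1)) := by unfold powMeasure; infer_instance
  obtain ⟨K, hK⟩ := exists_lipschitzWith_of_locallyLipschitz (hE.locallyLipschitz_radialFlux hh)
    (hasCompactSupport_radialFlux hc)
  have hbump : Integrable radialBump (powMeasure k) :=
    integrable_powMeasure_of_hasCompactSupport radialBump.continuous radialBump.hasCompactSupport
  have hbump' : Integrable (deriv radialBump) (powMeasure (k + 1)) :=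
    integrable_powMeasure_of_hasCompactSupport (radialBump.contDiff.continuous_deriv le_rfl)
      radialBump.hasCompactSupport.deriv
  have hprod₁ := hi₁.mul_prod (integrable_div_powMeasure_succ.2 hbump)
  have hprod₂ := hi₂.mul_prod hbump'
  have hpolar := hp.integral_polar (μ := volume) (by
    rw [finrank_euclideanSpace_fin]
    exact (hprod₁.add hprod₂).aestronglyMeasurable)
  rw [finrank_euclideanSpace_fin] at hpolar
  simp only [Pi.add_apply] at hpolar
  have hdiv : _ =ᵐ[_] {x | 0 < gauge E x}.indicator (fun x =>
      f₁ (radialProj (gauge E) x) * (radialBump (gauge E x) / gauge E x) +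
        f₂ (radialProj (gauge E) x) * deriv radialBump (gauge E x)) :=
    hE.ae_divergence_radialFlux hh
  rw [← integral_indicator (measurableSet_lt measurable_const hp.measurable),
    ← integral_congr_ae hdiv, integral_divergence_eq_zero hK (hasCompactSupport_radialFlux hc),
    Nat.add_succ_sub_one, integral_add hprod₁ hprod₂,
    integral_prod_mul f₁ fun s => radialBump s / s, integral_prod_mul,
    integral_div_powMeasure_succ, integral_deriv_powMeasure_succ radialBump.contDiff
    radialBump.hasCompactSupport] at hpolar
  have hpos := integral_radialBump_pos k
  refine mul_right_cancel₀ hpos.ne' ?_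
  push_cast
  linear_combination -hpolar

end IsRegularConvex

section Cutoff

variable {V : Type*} [NormedAddCommGroup V] [NormedSpace ℝ V] [HasContDiffBump V] {k : ℕ} {x : V}

/-- The rescaling of a fixed bump function that is `1` on the ball of radius `k + 1` and `0` off
the ball of radius `2 (k + 1)`. -/
def cutoff (k : ℕ) (x : V) : ℝ :=
  (⟨1, 2, one_pos, one_lt_two⟩ : ContDiffBump (0 : V)) ((k + 1 : ℝ)⁻¹ • x)

theorem cutoff_eq_one (hx : ‖x‖ ≤ k + 1) : cutoff k x = 1 := by
  refine ContDiffBump.one_of_mem_closedBall _ ?_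
  rw [mem_closedBall_zero_iff, norm_smul, norm_inv, Real.norm_of_nonneg (by positivity)]
  exact inv_mul_le_one_of_le₀ hx (by positivity)

theorem cutoff_nonneg (k : ℕ) (x : V) : 0 ≤ cutoff k x := ContDiffBump.nonneg _

theorem cutoff_le_one (k : ℕ) (x : V) : cutoff k x ≤ 1 := ContDiffBump.le_one _

theorem contDiff_cutoff (k : ℕ) : ContDiff ℝ 1 (cutoff k : V → ℝ) :=
  (ContDiffBump.contDiff _).comp (contDiff_const_smul _)

theorem hasCompactSupport_cutoff [FiniteDimensional ℝ V] (k : ℕ) :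
    HasCompactSupport (cutoff k : V → ℝ) :=
  (ContDiffBump.hasCompactSupport _).comp_smul (by positivity)

theorem exists_norm_fderiv_cutoff_le (V : Type*) [NormedAddCommGroup V] [NormedSpace ℝ V]
    [HasContDiffBump V] [FiniteDimensional ℝ V] :
    ∃ C, ∀ (k : ℕ) (x : V), ‖fderiv ℝ (cutoff k) x‖ ≤ C / (k + 1) := by
  let φ : ContDiffBump (0 : V) := ⟨1, 2, one_pos, one_lt_two⟩
  obtain ⟨C, hC⟩ := ((φ.contDiff (n := 1)).continuous_fderiv one_ne_zero)
    |>.bounded_above_of_compact_support (φ.hasCompactSupport.fderiv ℝ)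
  refine ⟨C, fun k x => ?_⟩
  have hfderiv : fderiv ℝ (cutoff k) x = (k + 1 : ℝ)⁻¹ • fderiv ℝ φ ((k + 1 : ℝ)⁻¹ • x) :=
    fderiv_comp_smul _
  rw [hfderiv, norm_smul, norm_inv, Real.norm_of_nonneg (by positivity), inv_mul_eq_div]
  gcongr
  exact hC _

variable [MeasurableSpace V] [BorelSpace V] {f : V → ℝ} {μ : Measure V}

theorem integrable_cutoff_mul (hf : Integrable f μ) (k : ℕ) :
    Integrable (fun x => cutoff k x * f x) μ := by
  refine hf.norm.mono' ((contDiff_cutoff k).continuous.measurable.aestronglyMeasurable.mul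
    hf.aestronglyMeasurable) (ae_of_all _ fun x => ?_)
  rw [norm_mul, Real.norm_of_nonneg (cutoff_nonneg k x)]
  exact mul_le_of_le_one_left (norm_nonneg _) (cutoff_le_one k x)

theorem tendsto_integral_cutoff_mul (hf : Integrable f μ) :
    Tendsto (fun k : ℕ => ∫ x, cutoff k x * f x ∂μ) atTop (𝓝 (∫ x, f x ∂μ)) := by
  refine tendsto_integral_of_dominated_convergence (fun x => ‖f x‖)
    (fun k => (integrable_cutoff_mul hf k).aestronglyMeasurable) hf.norm
    (fun k => ae_of_all _ fun x => ?_) (ae_of_all _ fun x => ?_)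
  · rw [norm_mul, Real.norm_of_nonneg (cutoff_nonneg k x)]
    exact mul_le_of_le_one_left (norm_nonneg _) (cutoff_le_one k x)
  · refine tendsto_const_nhds.congr' ?_
    obtain ⟨N, hN⟩ := exists_nat_ge ‖x‖
    filter_upwards [eventually_ge_atTop N] with k hk
    have hNk : (N : ℝ) ≤ k := by exact_mod_cast hk
    rw [cutoff_eq_one (hN.trans (hNk.trans (by linarith))), one_mul]

end Cutoff

theorem inner_tangentialPart (E : Set (Space n)) (x : Space n) :
    inner ℝ x (tangentialPart E x) = ‖x‖ ^ 2 - inner ℝ x (normal E x) ^ 2 := by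
  rw [tangentialPart, inner_sub_right, real_inner_smul_right, real_inner_self_eq_norm_sq, sq, sq]

namespace IsRegularConvex

variable {E : Set (Space n)} (hE : IsRegularConvex E) {h : Space n → ℝ} {x : Space n}

include hE

theorem norm_tangentialPart_le (hx : x ∈ frontier E) : ‖tangentialPart E x‖ ≤ ‖x‖ := by
  have hsq : ‖tangentialPart E x‖ ^ 2 = ‖x‖ ^ 2 - inner ℝ x (normal E x) ^ 2 := by
    rw [tangentialPart, norm_sub_sq_real, real_inner_smul_right, norm_smul, hE.norm_normal x hx,
      mul_one, Real.norm_eq_abs, sq_abs]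
    ring
  exact le_of_sq_le_sq (hsq.trans_le (sub_le_self _ (sq_nonneg _))) (norm_nonneg _)

theorem continuousOn_tangentialPart : ContinuousOn (tangentialPart E) (frontier E) :=
  continuousOn_id.sub (hE.continuousOn_inner_normal.smul hE.continuousOn_normal)

theorem frontier_subset_compl_zero : frontier E ⊆ {0}ᶜ := fun _ hx => hE.ne_zero_of_mem_frontier hx

theorem continuousOn_fderiv_tangentialPart (hh : ContDiffOn ℝ 1 h {0}ᶜ) :
    ContinuousOn (fun x => fderiv ℝ h x (tangentialPart E x)) (frontier E) :=
  ((hh.continuousOn_fderiv_of_isOpen isOpen_compl_singleton le_rfl).mono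
    hE.frontier_subset_compl_zero).clm_apply hE.continuousOn_tangentialPart

theorem integral_mul_meanCurvature_of_hasCompactSupport (hn : 2 ≤ n)
    (hh : ContDiffOn ℝ 1 h {0}ᶜ) (hc : HasCompactSupport h)
    (hi : Integrable (fun x => inner ℝ x (normal E x) * (h x * meanCurvature E x))
      (boundaryMeasure E)) :
    ∫ x, inner ℝ x (normal E x) * (h x * meanCurvature E x) ∂boundaryMeasure E =
      ∫ x, ((n - 1) * h x + fderiv ℝ h x (tangentialPart E x)) ∂boundaryMeasure E := by
  have hcont : ContinuousOn h (frontier E) := hh.continuousOn.mono hE.frontier_subset_compl_zero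
  have hih := hE.integrable_of_continuousOn_of_hasCompactSupport hcont hc
  have hid : Integrable (fun x => fderiv ℝ h x (tangentialPart E x)) (boundaryMeasure E) :=
    hE.integrable_of_continuousOn_of_hasCompactSupport (hE.continuousOn_fderiv_tangentialPart hh)
      ((hc.fderiv ℝ).mono fun x hx hx' => hx (by simp [hx']))
  have hae₁ : (fun x => inner ℝ x (normal E x) * (h x * meanCurvature E x -
      fderiv ℝ h x (tangentialPart E x) / inner ℝ x (normal E x))) =ᵐ[boundaryMeasure E]
      fun x => inner ℝ x (normal E x) * (h x * meanCurvature E x) -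
        fderiv ℝ h x (tangentialPart E x) := by
    filter_upwards [ae_boundaryMeasure_mem_frontier] with x hx
    rw [mul_sub, mul_div_cancel₀ _ (hE.inner_normal_pos hx).ne']
  have hae₂ : (fun x => inner ℝ x (normal E x) * (h x / inner ℝ x (normal E x)))
      =ᵐ[boundaryMeasure E] h := by
    filter_upwards [ae_boundaryMeasure_mem_frontier] with x hx
    rw [mul_div_cancel₀ _ (hE.inner_normal_pos hx).ne']
  have hcone := hE.integral_coneMeasure_mul_meanCurvature hn hh hc
    (hE.integrable_coneMeasure_iff.2 ((hi.sub hid).congr hae₁.symm))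
    (hE.integrable_coneMeasure_iff.2 (hih.congr hae₂.symm))
  rw [hE.integral_coneMeasure, hE.integral_coneMeasure, integral_congr_ae hae₁,
    integral_congr_ae hae₂, integral_sub hi hid] at hcone
  rw [integral_add (hih.const_mul _) hid, integral_const_mul, ← hcone, sub_add_cancel]

theorem abs_mul_fderiv_cutoff_le {C : ℝ} {k : ℕ}
    (hC : ∀ x : Space n, ‖fderiv ℝ (cutoff k) x‖ ≤ C / (k + 1)) (hx : x ∈ frontier E) :
    |h x * fderiv ℝ (cutoff k) x (tangentialPart E x)| ≤ C / (k + 1) * |‖x‖ * h x| := by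
  have hfderiv : |fderiv ℝ (cutoff k) x (tangentialPart E x)| ≤ C / (k + 1) * ‖x‖ :=
    (fderiv ℝ (cutoff k) x).le_of_opNorm_le_of_le (hC x) (hE.norm_tangentialPart_le hx)
  rw [abs_mul, abs_mul, abs_norm, ← mul_assoc, mul_comm |h x|]
  gcongr

theorem tendsto_integral_mul_fderiv_cutoff
    (hw : Integrable (fun x => ‖x‖ * h x) (boundaryMeasure E)) :
    Tendsto (fun k : ℕ => ∫ x, h x * fderiv ℝ (cutoff k) x (tangentialPart E x)
      ∂boundaryMeasure E) atTop (𝓝 0) := by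
  obtain ⟨C, hC⟩ := exists_norm_fderiv_cutoff_le (Space n)
  have hbound (k : ℕ) :
      ‖∫ x, h x * fderiv ℝ (cutoff k) x (tangentialPart E x) ∂boundaryMeasure E‖ ≤
        C * (∫ x, |‖x‖ * h x| ∂boundaryMeasure E) * (1 / (k + 1)) := by
    refine (norm_integral_le_of_norm_le (hw.abs.const_mul (C / (k + 1)))
      (ae_boundaryMeasure_mem_frontier.mono fun x hx =>
        hE.abs_mul_fderiv_cutoff_le (hC k) hx)).trans_eq ?_
    rw [integral_const_mul]
    ring
  refine squeeze_zero_norm hbound ?_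
  simpa only [mul_zero] using (tendsto_one_div_add_atTop_nhds_zero_nat (𝕜 := ℝ)).const_mul
    (C * ∫ x, |‖x‖ * h x| ∂boundaryMeasure E)

theorem integral_cutoff_mul (hn : 2 ≤ n) (hh : ContDiffOn ℝ 1 h {0}ᶜ)
    (hi : Integrable (fun x => inner ℝ x (normal E x) * (h x * meanCurvature E x))
      (boundaryMeasure E))
    (hw : Integrable (fun x => ‖x‖ * h x) (boundaryMeasure E))
    (hF : Integrable (fun x => (n - 1) * h x + fderiv ℝ h x (tangentialPart E x))
      (boundaryMeasure E)) (k : ℕ) :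
    ∫ x, cutoff k x * (inner ℝ x (normal E x) * (h x * meanCurvature E x) -
        ((n - 1) * h x + fderiv ℝ h x (tangentialPart E x))) ∂boundaryMeasure E =
      ∫ x, h x * fderiv ℝ (cutoff k) x (tangentialPart E x) ∂boundaryMeasure E := by
  obtain ⟨C, hC⟩ := exists_norm_fderiv_cutoff_le (Space n)
  have hcut : ContDiffOn ℝ 1 (cutoff k) {(0 : Space n)}ᶜ := (contDiff_cutoff k).contDiffOn
  have hit : Integrable (fun x => h x * fderiv ℝ (cutoff k) x (tangentialPart E x))
      (boundaryMeasure E) :=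
    integrable_of_continuousOn_of_le (hw.abs.const_mul (C / (k + 1)))
      ((hh.continuousOn.mono hE.frontier_subset_compl_zero).mul
        (hE.continuousOn_fderiv_tangentialPart hcut))
      fun x hx => hE.abs_mul_fderiv_cutoff_le (hC k) hx
  have hleft (x : Space n) : inner ℝ x (normal E x) * (cutoff k x * h x * meanCurvature E x) =
      cutoff k x * (inner ℝ x (normal E x) * (h x * meanCurvature E x)) := by ring
  have hright : (fun x => (n - 1) * (cutoff k x * h x) +
      fderiv ℝ (fun y => cutoff k y * h y) x (tangentialPart E x)) =ᵐ[boundaryMeasure E] fun x =>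
      cutoff k x * ((n - 1) * h x + fderiv ℝ h x (tangentialPart E x)) +
        h x * fderiv ℝ (cutoff k) x (tangentialPart E x) := by
    filter_upwards [ae_boundaryMeasure_mem_frontier] with x hx
    have hx0 := isOpen_compl_singleton.mem_nhds (hE.ne_zero_of_mem_frontier hx)
    rw [fderiv_fun_mul ((hcut.contDiffAt hx0).differentiableAt one_ne_zero)
      ((hh.contDiffAt hx0).differentiableAt one_ne_zero), _root_.add_apply, _root_.smul_apply,
      _root_.smul_apply, smul_eq_mul, smul_eq_mul]
    ring
  have hcompact := hE.integral_mul_meanCurvature_of_hasCompactSupport hn (hcut.mul hh)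
    (hasCompactSupport_cutoff k).mul_right
    ((integrable_cutoff_mul hi k).congr (ae_of_all _ fun x => (hleft x).symm))
  rw [integral_congr_ae hright, integral_add (integrable_cutoff_mul hF k) hit,
    integral_congr_ae (ae_of_all _ hleft)] at hcompact
  simp_rw [mul_sub (cutoff k _)]
  rw [integral_sub (integrable_cutoff_mul hi k) (integrable_cutoff_mul hF k), hcompact,
    add_sub_cancel_left]

theorem integral_mul_meanCurvature (hn : 2 ≤ n) (hh : ContDiffOn ℝ 1 h {0}ᶜ)
    (hi : Integrable (fun x => inner ℝ x (normal E x) * (h x * meanCurvature E x))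
      (boundaryMeasure E))
    (hw : Integrable (fun x => ‖x‖ * h x) (boundaryMeasure E))
    (hF : Integrable (fun x => (n - 1) * h x + fderiv ℝ h x (tangentialPart E x))
      (boundaryMeasure E)) :
    ∫ x, inner ℝ x (normal E x) * (h x * meanCurvature E x) ∂boundaryMeasure E =
      ∫ x, ((n - 1) * h x + fderiv ℝ h x (tangentialPart E x)) ∂boundaryMeasure E := by
  have hlim := tendsto_integral_cutoff_mul (hi.sub hF)
  simp only [Pi.sub_apply, hE.integral_cutoff_mul hn hh hi hw hF] at hlim
  rw [← sub_eq_zero, ← integral_sub hi hF]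
  exact tendsto_nhds_unique hlim (hE.tendsto_integral_mul_fderiv_cutoff hw)

end IsRegularConvex

/-! ### The weighted mean curvature -/

section Weight

variable {V : Type*} [NormedAddCommGroup V] {x : V}

/-- The density `e^{-|x|²/2} / |x|` with which the mean curvature is integrated against `⟨x, ν⟩` in
`radialEnergy`. -/
def weight (x : V) : ℝ := Real.exp (-‖x‖ ^ 2 / 2) / ‖x‖

theorem norm_mul_weight (hx : x ≠ 0) : ‖x‖ * weight x = Real.exp (-(1 / 2) * ‖x‖ ^ 2) := by
  rw [weight, mul_div_cancel₀ _ (norm_ne_zero_iff.2 hx)]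
  ring_nf

theorem weight_le {δ : ℝ} (hδ : 0 < δ) (hx : δ ≤ ‖x‖) :
    weight x ≤ δ⁻¹ * Real.exp (-(1 / 4) * ‖x‖ ^ 2) := by
  rw [weight, div_eq_inv_mul]
  gcongr
  linarith [sq_nonneg ‖x‖]

theorem norm_mul_exp_le (x : V) :
    ‖x‖ * Real.exp (-‖x‖ ^ 2 / 2) ≤ 4 * Real.exp (-(1 / 4) * ‖x‖ ^ 2) := by
  have hle : ‖x‖ ≤ 4 * Real.exp (‖x‖ ^ 2 / 4) := by
    nlinarith [Real.add_one_le_exp (‖x‖ ^ 2 / 4), sq_nonneg (‖x‖ - 2)]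
  calc ‖x‖ * Real.exp (-‖x‖ ^ 2 / 2)
      ≤ 4 * Real.exp (‖x‖ ^ 2 / 4) * Real.exp (-‖x‖ ^ 2 / 2) := by gcongr
    _ = 4 * Real.exp (-(1 / 4) * ‖x‖ ^ 2) := by
      rw [mul_assoc, ← Real.exp_add]
      ring_nf

variable [InnerProductSpace ℝ V]

theorem contDiffOn_weight : ContDiffOn ℝ 1 (weight : V → ℝ) {0}ᶜ :=
  (((contDiff_norm_sq ℝ).neg.div_const 2).exp).contDiffOn.div
    (fun _ hx => (contDiffAt_norm ℝ hx).contDiffWithinAt) fun _ hx => norm_ne_zero_iff.2 hx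

theorem fderiv_weight (hx : x ≠ 0) (v : V) :
    fderiv ℝ weight x v =
      -((1 / ‖x‖ + 1 / ‖x‖ ^ 3) * Real.exp (-‖x‖ ^ 2 / 2) * inner ℝ x v) := by
  have ht : 0 < ‖x‖ := norm_pos_iff.2 hx
  have hsq : HasFDerivAt (fun y : V => ‖y‖ ^ 2) (2 • innerSL ℝ x) x :=
    (hasStrictFDerivAt_norm_sq x).hasFDerivAt
  have hexp : HasDerivAt (fun s : ℝ => Real.exp (-s / 2))
      (Real.exp (-‖x‖ ^ 2 / 2) * (-1 / 2)) (‖x‖ ^ 2) := ((hasDerivAt_neg _).div_const 2).exp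
  have hprofile := hexp.div (Real.hasDerivAt_sqrt (by positivity))
    (by rw [Real.sqrt_sq ht.le]; exact ht.ne')
  have hweight : ((fun s : ℝ => Real.exp (-s / 2)) / Real.sqrt) ∘ (fun y : V => ‖y‖ ^ 2) =
      weight := by
    ext y
    simp only [Function.comp_apply, Pi.div_apply, weight, Real.sqrt_sq (norm_nonneg y)]
  have hcomp := hprofile.comp_hasFDerivAt x hsq
  rw [hweight] at hcomp
  rw [hcomp.fderiv, Real.sqrt_sq ht.le]
  simp only [_root_.smul_apply, innerSL_apply_apply, smul_eq_mul, nsmul_eq_mul, Nat.cast_ofNat]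
  field_simp
  ring

end Weight

/-- The derivative of `-weight` along the tangential part of the position vector. -/
def tangentialTerm (E : Set (Space n)) (x : Space n) : ℝ :=
  (1 / ‖x‖ + 1 / ‖x‖ ^ 3) * (‖x‖ ^ 2 - inner ℝ x (normal E x) ^ 2) * Real.exp (-‖x‖ ^ 2 / 2)

theorem fderiv_weight_tangentialPart (E : Set (Space n)) {x : Space n} (hx : x ≠ 0) :
    fderiv ℝ weight x (tangentialPart E x) = -tangentialTerm E x := by
  rw [fderiv_weight hx, inner_tangentialPart, tangentialTerm, mul_right_comm]

namespace IsRegularConvex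

variable {E : Set (Space n)} (hE : IsRegularConvex E)

include hE

theorem exists_le_norm : ∃ δ > 0, ∀ x ∈ frontier E, δ ≤ ‖x‖ := by
  obtain ⟨δ, hδ, hle⟩ := hE.exists_le_inner_normal
  exact ⟨δ, hδ, fun x hx => (hle x hx).trans (hE.inner_normal_le_norm hx)⟩

theorem integrable_weight : Integrable weight (boundaryMeasure E) := by
  obtain ⟨δ, hδ, hle⟩ := hE.exists_le_norm
  refine integrable_of_continuousOn_of_le
    ((hE.integrable_exp (b := 1 / 4) (by norm_num)).const_mul δ⁻¹)
    (contDiffOn_weight.continuousOn.mono hE.frontier_subset_compl_zero) fun x hx => ?_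
  rw [abs_of_nonneg (by unfold weight; positivity)]
  exact weight_le hδ (hle x hx)

theorem tangentialTerm_nonneg {x : Space n} (hx : x ∈ frontier E) : 0 ≤ tangentialTerm E x := by
  have hle : inner ℝ x (normal E x) ^ 2 ≤ ‖x‖ ^ 2 :=
    pow_le_pow_left₀ (hE.inner_normal_pos hx).le (hE.inner_normal_le_norm hx) 2
  exact mul_nonneg (mul_nonneg (by positivity) (sub_nonneg.2 hle)) (Real.exp_nonneg _)

theorem integrable_tangentialTerm : Integrable (tangentialTerm E) (boundaryMeasure E) := by
  obtain ⟨δ, hδ, hle⟩ := hE.exists_le_norm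
  have hcont : ContinuousOn (tangentialTerm E) (frontier E) :=
    (hE.continuousOn_fderiv_tangentialPart contDiffOn_weight).neg.congr fun x hx => by
      rw [Pi.neg_apply, fderiv_weight_tangentialPart E (hE.ne_zero_of_mem_frontier hx), neg_neg]
  refine integrable_of_continuousOn_of_le
    ((hE.integrable_exp (b := 1 / 4) (by norm_num)).const_mul (4 + δ⁻¹)) hcont fun x hx => ?_
  have ht : 0 < ‖x‖ := hδ.trans_le (hle x hx)
  rw [abs_of_nonneg (hE.tangentialTerm_nonneg hx)]
  calc tangentialTerm E x
      ≤ (1 / ‖x‖ + 1 / ‖x‖ ^ 3) * ‖x‖ ^ 2 * Real.exp (-‖x‖ ^ 2 / 2) := by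
        unfold tangentialTerm
        gcongr
        exact sub_le_self _ (sq_nonneg _)
    _ = ‖x‖ * Real.exp (-‖x‖ ^ 2 / 2) + weight x := by
        unfold weight
        field_simp
    _ ≤ 4 * Real.exp (-(1 / 4) * ‖x‖ ^ 2) + δ⁻¹ * Real.exp (-(1 / 4) * ‖x‖ ^ 2) :=
        add_le_add (norm_mul_exp_le x) (weight_le hδ (hle x hx))
    _ = (4 + δ⁻¹) * Real.exp (-(1 / 4) * ‖x‖ ^ 2) := (add_mul _ _ _).symm

theorem integrable_radialDensity (hi : Integrable (curvatureDensity E) (boundaryMeasure E)) :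
    Integrable (radialDensity E) (boundaryMeasure E) := by
  have hcont : ContinuousOn (fun x => inner ℝ x (normal E x) / ‖x‖) (frontier E) :=
    hE.continuousOn_inner_normal.div continuous_norm.continuousOn
      fun x hx => norm_ne_zero_iff.2 (hE.ne_zero_of_mem_frontier hx)
  refine hi.norm.mono' ((aestronglyMeasurable_of_continuousOn hcont).mul
    hi.aestronglyMeasurable) ?_
  filter_upwards [ae_boundaryMeasure_mem_frontier] with x hx
  have hpos := hE.inner_normal_pos hx
  rw [radialDensity, norm_mul, Real.norm_of_nonneg (by positivity)]
  exact mul_le_of_le_one_left (norm_nonneg _)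
    (div_le_one_of_le₀ (hE.inner_normal_le_norm hx) (norm_nonneg _))

theorem radialEnergy_eq (hn : 2 ≤ n)
    (hi : Integrable (curvatureDensity E) (boundaryMeasure E)) :
    radialEnergy E = ∫ x, ((n - 1) * weight x - tangentialTerm E x) ∂boundaryMeasure E := by
  have hdensity : radialDensity E =
      fun x => inner ℝ x (normal E x) * (weight x * meanCurvature E x) := by
    ext x
    rw [radialDensity, curvatureDensity, weight]
    ring
  have hderiv : (fun x => (n - 1) * weight x + fderiv ℝ weight x (tangentialPart E x))
      =ᵐ[boundaryMeasure E] fun x => (n - 1) * weight x - tangentialTerm E x := by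
    filter_upwards [ae_boundaryMeasure_mem_frontier] with x hx
    rw [fderiv_weight_tangentialPart E (hE.ne_zero_of_mem_frontier hx), ← sub_eq_add_neg]
  have hnorm : (fun x => ‖x‖ * weight x) =ᵐ[boundaryMeasure E]
      fun x => Real.exp (-(1 / 2) * ‖x‖ ^ 2) :=
    ae_boundaryMeasure_mem_frontier.mono fun x hx =>
      norm_mul_weight (hE.ne_zero_of_mem_frontier hx)
  rw [radialEnergy, hdensity, ← integral_congr_ae hderiv]
  exact hE.integral_mul_meanCurvature hn contDiffOn_weight
    (hdensity ▸ hE.integrable_radialDensity hi)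
    ((hE.integrable_exp (by norm_num)).congr hnorm.symm)
    (((hE.integrable_weight.const_mul _).sub hE.integrable_tangentialTerm).congr hderiv.symm)

end IsRegularConvex

/-! ### The flux of the radial field -/

theorem IsPosHomogeneous.setIntegral_lt {V : Type*} [NormedAddCommGroup V] [NormedSpace ℝ V]
    [MeasurableSpace V] [BorelSpace V] [FiniteDimensional ℝ V] [Nontrivial V] {p : V → ℝ}
    {μ : Measure V} [μ.IsAddHaarMeasure] (hp : IsPosHomogeneous p) {F : V → ℝ} (hm : Measurable F)
    (hF : Integrable F μ) {a : ℝ} (ha : 0 ≤ a) :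
    ∫ x in {x | a < p x}, F x ∂μ =
      ∫ z, (∫ s in Ioi a, s ^ (Module.finrank ℝ V - 1) * F (s • z)) ∂coneMeasure μ p := by
  have := hp.sigmaFinite_coneMeasure (μ := μ)
  have : SFinite (powMeasure (Module.finrank ℝ V - 1)) := by unfold powMeasure; infer_instance
  have hpos : MeasurableSet {x | 0 < p x} := measurableSet_lt measurable_const hp.measurable
  have hlt : MeasurableSet {x | a < p x} := measurableSet_lt measurable_const hp.measurable
  let f : V × ℝ → ℝ := {w | a < w.2}.indicator fun w => F (w.2 • w.1)
  have hf : Measurable f := (hm.comp (measurable_snd.smul measurable_fst)).indicator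
    (measurableSet_lt measurable_const measurable_snd)
  have hpolar : EqOn (fun x => f (radialProj p x, p x)) ({x | a < p x}.indicator F)
      {x | 0 < p x} := by
    intro x hx
    change {w : V × ℝ | a < w.2}.indicator _ (radialProj p x, p x) = _
    simp only [indicator_apply, mem_ofPred_eq, smul_radialProj (ne_of_gt hx)]
  have hint : Integrable f ((coneMeasure μ p).prod (powMeasure (Module.finrank ℝ V - 1))) :=
    (hp.integrable_polar hf.aestronglyMeasurable).1
      ((hF.indicator hlt).integrableOn.congr_fun hpolar.symm hpos)
  have hsection (z : V) : ∫ s, f (z, s) ∂powMeasure (Module.finrank ℝ V - 1) =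
      ∫ s in Ioi a, s ^ (Module.finrank ℝ V - 1) * F (s • z) := by
    rw [integral_powMeasure, ← inter_eq_self_of_subset_right (Ioi_subset_Ioi ha),
      ← setIntegral_indicator measurableSet_Ioi]
    refine integral_congr_ae (ae_of_all _ fun s => ?_)
    simp only [f, indicator_apply, mem_ofPred_eq, mem_Ioi, mul_ite, mul_zero]
  calc ∫ x in {x | a < p x}, F x ∂μ
      = ∫ x in {x | 0 < p x}, {x | a < p x}.indicator F x ∂μ := by
        have hsub : {x | a < p x} ⊆ {x | 0 < p x} := fun _ hx => ha.trans_lt hx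
        rw [setIntegral_indicator hlt, inter_eq_self_of_subset_right hsub]
    _ = ∫ x in {x | 0 < p x}, f (radialProj p x, p x) ∂μ :=
        (setIntegral_congr_fun hpos hpolar).symm
    _ = ∫ z, (∫ s, f (z, s) ∂powMeasure (Module.finrank ℝ V - 1)) ∂coneMeasure μ p := by
        rw [hp.integral_polar hf.aestronglyMeasurable, integral_prod _ hint]
    _ = _ := by simp only [hsection]

/-- The profile in `t = |x|` of the divergence of the field `e^{-|x|²/2} x / |x|²` on `ℝⁿ`. -/
def radialProfile (n : ℕ) (t : ℝ) : ℝ := ((n - 2) / t ^ 2 - 1) * Real.exp (-t ^ 2 / 2)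

section RadialProfile

variable {s t : ℝ}

theorem pow_mul_radialProfile (hn : 3 ≤ n) (hs : s ≠ 0) (ht : t ≠ 0) :
    s ^ (n - 1) * radialProfile n (s * t) =
      (n - 2) / t ^ 2 * (s ^ (n - 3) * Real.exp (-(t ^ 2 / 2) * s ^ 2)) -
        s ^ (n - 1) * Real.exp (-(t ^ 2 / 2) * s ^ 2) := by
  obtain ⟨k, rfl⟩ := Nat.exists_eq_add_of_le' hn
  rw [radialProfile, show -(s * t) ^ 2 / 2 = -(t ^ 2 / 2) * s ^ 2 by ring, Nat.add_sub_cancel,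
    show k + 3 - 1 = k + 2 from rfl]
  field_simp
  ring

theorem hasDerivAt_pow_mul_exp (hn : 3 ≤ n) (hs : s ≠ 0) (ht : t ≠ 0) :
    HasDerivAt (fun s : ℝ => s ^ (n - 2) * Real.exp (-(t ^ 2 / 2) * s ^ 2) / t ^ 2)
      (s ^ (n - 1) * radialProfile n (s * t)) s := by
  rw [pow_mul_radialProfile hn hs ht]
  obtain ⟨k, rfl⟩ := Nat.exists_eq_add_of_le' hn
  have hexp := (((hasDerivAt_pow 2 s).const_mul (-(t ^ 2 / 2))).exp)
  refine (((hasDerivAt_pow (k + 1) s).mul hexp).div_const (t ^ 2)).congr_deriv ?_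
  simp only [Nat.add_sub_cancel, show k + 3 - 1 = k + 2 from rfl]
  push_cast
  field_simp
  ring

theorem integrableOn_pow_mul_exp (k : ℕ) {b : ℝ} (hb : 0 < b) :
    IntegrableOn (fun s : ℝ => s ^ k * Real.exp (-b * s ^ 2)) (Ioi 0) := by
  simpa only [Real.rpow_natCast] using (integrable_rpow_mul_exp_neg_mul_sq hb
    (neg_one_lt_zero.trans_le k.cast_nonneg)).integrableOn

theorem tendsto_pow_mul_exp_atTop (k : ℕ) {b : ℝ} (hb : 0 < b) :
    Tendsto (fun s : ℝ => s ^ k * Real.exp (-b * s ^ 2)) atTop (𝓝 0) := by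
  have hexp : Tendsto (fun s : ℝ => Real.exp (-(1 / 2) * s)) atTop (𝓝 0) :=
    Real.tendsto_exp_atBot.comp (tendsto_id.const_mul_atTop_of_neg (by norm_num))
  simpa only [Real.rpow_natCast] using
    (rpow_mul_exp_neg_mul_sq_isLittleO_exp_neg hb k).trans_tendsto hexp

theorem integrableOn_radialProfile (hn : 3 ≤ n) (ht : t ≠ 0) :
    IntegrableOn (fun s : ℝ => s ^ (n - 1) * radialProfile n (s * t)) (Ioi 0) := by
  have hb : 0 < t ^ 2 / 2 := by positivity
  exact IntegrableOn.congr_fun (((integrableOn_pow_mul_exp (n - 3) hb).const_mul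
    ((n - 2) / t ^ 2)).sub (integrableOn_pow_mul_exp (n - 1) hb))
      (fun s hs => (pow_mul_radialProfile hn (ne_of_gt hs) ht).symm) measurableSet_Ioi

theorem integral_Ioi_radialProfile (hn : 3 ≤ n) (ht : t ≠ 0) {a : ℝ} (ha : 0 ≤ a) :
    ∫ s in Ioi a, s ^ (n - 1) * radialProfile n (s * t) =
      -(a ^ (n - 2) * Real.exp (-(t ^ 2 / 2) * a ^ 2) / t ^ 2) := by
  have hlim : Tendsto (fun s : ℝ => s ^ (n - 2) * Real.exp (-(t ^ 2 / 2) * s ^ 2) / t ^ 2)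
      atTop (𝓝 0) := by
    simpa only [zero_div] using
      (tendsto_pow_mul_exp_atTop (n - 2) (b := t ^ 2 / 2) (by positivity)).div_const (t ^ 2)
  rw [integral_Ioi_of_hasDerivAt_of_tendsto (Continuous.continuousWithinAt (by fun_prop))
    (fun s hs => hasDerivAt_pow_mul_exp hn (ha.trans_lt hs).ne' ht)
    ((integrableOn_radialProfile hn ht).mono_set (Ioi_subset_Ioi ha)) hlim, zero_sub]

end RadialProfile

/-- The divergence of the field `e^{-|x|²/2} x / |x|²`. -/
def radialDivergence (x : Space n) : ℝ := radialProfile n ‖x‖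

theorem measurable_radialDivergence : Measurable (radialDivergence (n := n)) := by
  unfold radialDivergence radialProfile
  fun_prop

theorem integral_Ioi_radialDivergence (hn : 3 ≤ n) {z : Space n} (hz : z ≠ 0) :
    ∫ s in Ioi (1 : ℝ), s ^ (n - 1) * radialDivergence (s • z) =
      -(Real.exp (-‖z‖ ^ 2 / 2) / ‖z‖ ^ 2) := by
  have hprofile := integral_Ioi_radialProfile hn (norm_ne_zero_iff.2 hz) zero_le_one
  rw [one_pow, one_mul, one_pow, mul_one] at hprofile
  rw [neg_div, ← hprofile]
  refine setIntegral_congr_fun measurableSet_Ioi fun s hs => ?_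
  rw [radialDivergence, norm_smul, Real.norm_of_nonneg (zero_le_one.trans (le_of_lt hs))]

theorem integrable_radialDivergence (hn : 3 ≤ n) : Integrable (radialDivergence (n := n)) := by
  have : Nonempty (Fin n) := ⟨⟨0, by omega⟩⟩
  refine (integrable_fun_norm_addHaar (volume : Measure (Space n))).2 ?_
  simpa only [finrank_euclideanSpace_fin, smul_eq_mul, mul_one] using
    integrableOn_radialProfile hn one_ne_zero

theorem integral_radialDivergence (hn : 3 ≤ n) : ∫ x, radialDivergence (n := n) x = 0 := by
  have : Nonempty (Fin n) := ⟨⟨0, by omega⟩⟩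
  have hprofile := integral_Ioi_radialProfile hn one_ne_zero le_rfl
  rw [zero_pow (by omega), zero_mul, zero_div, neg_zero] at hprofile
  refine (integral_fun_norm_addHaar (volume : Measure (Space n)) (radialProfile n)).trans ?_
  simp only [mul_one] at hprofile
  simp only [finrank_euclideanSpace_fin, smul_eq_mul, hprofile, nsmul_zero, mul_zero]

namespace IsRegularConvex

variable {E : Set (Space n)} (hE : IsRegularConvex E)

include hE

theorem setIntegral_one_lt_gauge_radialDivergence (hn : 3 ≤ n) :
    ∫ x in {x | 1 < gauge E x}, radialDivergence x =
      -∫ x, inner ℝ x (normal E x) / ‖x‖ ^ 2 * Real.exp (-‖x‖ ^ 2 / 2) ∂boundaryMeasure E := by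
  have : Nonempty (Fin n) := ⟨⟨0, by omega⟩⟩
  have hsection : ∀ᵐ z ∂coneMeasure volume (gauge E),
      ∫ s in Ioi (1 : ℝ), s ^ (n - 1) * radialDivergence (s • z) =
        -(Real.exp (-‖z‖ ^ 2 / 2) / ‖z‖ ^ 2) := by
    rw [hE.ae_coneMeasure_iff]
    exact ae_boundaryMeasure_mem_frontier.mono fun z hz =>
      integral_Ioi_radialDivergence hn (hE.ne_zero_of_mem_frontier hz)
  rw [hE.isPosHomogeneous.setIntegral_lt measurable_radialDivergence
    (integrable_radialDivergence hn) zero_le_one, finrank_euclideanSpace_fin,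
    integral_congr_ae hsection, integral_neg, hE.integral_coneMeasure]
  simp only [div_mul_eq_mul_div, mul_div_assoc]

theorem integral_inner_div_sq (hn : 3 ≤ n) :
    ∫ x, inner ℝ x (normal E x) / ‖x‖ ^ 2 * Real.exp (-‖x‖ ^ 2 / 2) ∂boundaryMeasure E =
      ∫ x in E, radialDivergence x := by
  have hnull : volume (frontier E) = 0 := hE.convex.addHaar_frontier _
  have hcompl : {x | 1 < gauge E x} = (closure E)ᶜ := by
    ext x
    rw [mem_compl_iff, ← gauge_le_one_iff_mem_closure hE.convex hE.mem_nhds, not_le, mem_ofPred_eq]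
  have hadd := integral_add_compl (isClosed_closure (s := E)).measurableSet
    (integrable_radialDivergence hn)
  rw [← hcompl, hE.setIntegral_one_lt_gauge_radialDivergence hn, integral_radialDivergence hn,
    setIntegral_congr_set (closure_ae_eq_of_null_frontier hnull)] at hadd
  linarith

end IsRegularConvex

/-! ### Gaussian volume of half-spaces -/

section Gaussian

variable {V : Type*} [NormedAddCommGroup V] [InnerProductSpace ℝ V]

theorem norm_sq_eq_inner_sq_add {v : V} (hv : ‖v‖ = 1) (x : V) :
    ‖x‖ ^ 2 = inner ℝ x v ^ 2 +
      ‖(Submodule.span ℝ {v})ᗮ.orthogonalProjectionOnto x‖ ^ 2 := by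
  rw [Submodule.norm_sq_eq_add_norm_sq_projection x (Submodule.span ℝ {v}),
    Submodule.coe_norm, ← Submodule.starProjection_apply,
    Submodule.starProjection_unit_singleton ℝ hv, norm_smul, hv, mul_one, Real.norm_eq_abs,
    sq_abs, real_inner_comm]

variable [MeasurableSpace V] [BorelSpace V]

theorem integral_comp_inner_span_singleton {v : V} (hv : ‖v‖ = 1) (f : ℝ → ℝ) :
    ∫ a : Submodule.span ℝ {v}, f (inner ℝ (a : V) v) = ∫ t, f t := by
  let L := LinearIsometryEquiv.toSpanUnitSingleton (𝕜 := ℝ) v hv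
  rw [← L.measurePreserving.integral_comp L.toHomeomorph.measurableEmbedding]
  refine integral_congr_ae (ae_of_all _ fun t => congrArg f ?_)
  simp [L, real_inner_smul_left, hv]

variable [FiniteDimensional ℝ V]

theorem integrable_exp_neg_norm_sq_div_two : Integrable fun x : V => Real.exp (-‖x‖ ^ 2 / 2) :=
  (integrable_exp_neg_mul_norm_sq one_half_pos).congr (ae_of_all _ fun x => by ring_nf)

theorem integral_exp_neg_norm_sq_div_two :
    ∫ x : V, Real.exp (-‖x‖ ^ 2 / 2) = (2 * Real.pi) ^ ((Module.finrank ℝ V : ℝ) / 2) := by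
  have hgauss := GaussianFourier.integral_rexp_neg_mul_sq_norm (V := V) (b := 1 / 2) (by norm_num)
  rw [show Real.pi / (1 / 2) = 2 * Real.pi by ring] at hgauss
  rw [← hgauss]
  exact integral_congr_ae (ae_of_all _ fun x => by ring_nf)

theorem integral_comp_inner_mul_comp_orthogonalProjectionOnto {v : V} (hv : ‖v‖ = 1) (f : ℝ → ℝ)
    (g : (Submodule.span ℝ {v})ᗮ → ℝ) :
    ∫ x, f (inner ℝ x v) * g ((Submodule.span ℝ {v})ᗮ.orthogonalProjectionOnto x) =
      (∫ t, f t) * ∫ b, g b := by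
  let S := Submodule.span ℝ {v}
  have hmp := S.measurePreserving_measurableEquivProd (0 : V)
  rw [InnerProductSpace.euclideanHausdorffMeasure_eq_volume] at hmp
  rw [← integral_comp_inner_span_singleton hv f, ← integral_prod_mul, ← Measure.volume_eq_prod,
    ← hmp.integral_comp (S.measurableEquivProd 0).measurableEmbedding]
  refine integral_congr_ae (ae_of_all _ fun x => ?_)
  have hinner : inner ℝ (S.orthogonalProjectionOnto x : V) v = inner ℝ x v :=
    Submodule.inner_orthogonalProjectionOnto_eq_of_mem_right
      (⟨v, Submodule.mem_span_singleton_self v⟩ : S) x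
  simp only [Submodule.measurableEquivProd_apply, vsub_eq_sub, sub_zero, S, hinner]

end Gaussian

theorem gaussianVolume_halfspace {v : Space n} (hv : ‖v‖ = 1) (s : ℝ) :
    gaussianVolume {x : Space n | inner ℝ x v ≤ s} = psi s := by
  let S := Submodule.span ℝ {v}
  have hfactor (x : Space n) :
      {x : Space n | inner ℝ x v ≤ s}.indicator (fun x => Real.exp (-‖x‖ ^ 2 / 2)) x =
        (Iic s).indicator (fun t => Real.exp (-t ^ 2 / 2)) (inner ℝ x v) *
          Real.exp (-‖Sᗮ.orthogonalProjectionOnto x‖ ^ 2 / 2) := by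
    simp only [indicator_apply, mem_ofPred_eq, mem_Iic, ite_mul, zero_mul, ← Real.exp_add,
      norm_sq_eq_inner_sq_add hv x, S]
    ring_nf
  have hfubini : ∫ x in {x : Space n | inner ℝ x v ≤ s}, Real.exp (-‖x‖ ^ 2 / 2) =
      (∫ t in Iic s, Real.exp (-t ^ 2 / 2)) * ∫ b : Sᗮ, Real.exp (-‖b‖ ^ 2 / 2) := by
    rw [← integral_indicator (measurableSet_le (by fun_prop) measurable_const),
      ← integral_indicator measurableSet_Iic,
      ← integral_comp_inner_mul_comp_orthogonalProjectionOnto hv]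
    exact integral_congr_ae (ae_of_all _ hfactor)
  have hfinrank : (Module.finrank ℝ Sᗮ : ℝ) = n - 1 := by
    have hadd := S.finrank_add_finrank_orthogonal
    rw [finrank_span_singleton (norm_ne_zero_iff.1 (hv.trans_ne one_ne_zero)),
      finrank_euclideanSpace_fin] at hadd
    exact eq_sub_of_add_eq' (by exact_mod_cast hadd)
  have hconst : (2 * Real.pi) ^ ((n : ℝ) / 2) =
      (2 * Real.pi) ^ (((n : ℝ) - 1) / 2) * √(2 * Real.pi) := by
    rw [Real.sqrt_eq_rpow, ← Real.rpow_add (by positivity)]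
    ring_nf
  rw [gaussianVolume, psi, hfubini, integral_exp_neg_norm_sq_div_two, hfinrank, hconst]
  field_simp

theorem integrable_exp_neg_sq_div_two : Integrable fun t : ℝ => Real.exp (-t ^ 2 / 2) := by
  simpa only [Real.norm_eq_abs, sq_abs] using integrable_exp_neg_norm_sq_div_two (V := ℝ)

theorem psi_pos (s : ℝ) : 0 < psi s := by
  have : NeZero (volume.restrict (Iic s)) := ⟨by simp⟩
  exact mul_pos (by positivity) (integral_exp_pos integrable_exp_neg_sq_div_two.integrableOn)

theorem strictMono_psi : StrictMono psi := by
  intro a b hab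
  have hint := integrable_exp_neg_sq_div_two
  have hsub := intervalIntegral.integral_Iic_sub_Iic (hint.integrableOn (s := Iic a))
    (hint.integrableOn (s := Iic b))
  have hpos : 0 < ∫ t in a..b, Real.exp (-t ^ 2 / 2) :=
    intervalIntegral.intervalIntegral_pos_of_pos hint.intervalIntegrable
      (fun t => Real.exp_pos _) hab
  exact mul_lt_mul_of_pos_left (by linarith) (by positivity)

theorem gaussianVolume_mono {E F : Set (Space n)} (h : E ⊆ F) :
    gaussianVolume E ≤ gaussianVolume F :=
  mul_le_mul_of_nonneg_left (setIntegral_mono_set integrable_exp_neg_norm_sq_div_two.integrableOn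
    (ae_of_all _ fun _ => (Real.exp_pos _).le) (ae_of_all _ h)) (by positivity)

theorem interior_nonempty_of_gaussianVolume_pos {E : Set (Space n)} (hc : Convex ℝ E)
    (h : 0 < gaussianVolume E) : (interior E).Nonempty := by
  contrapose! h
  have hfrontier : E ⊆ frontier E := by
    rw [frontier, h, sdiff_empty]
    exact subset_closure
  have hnull : volume E = 0 := measure_mono_null hfrontier (hc.addHaar_frontier volume)
  rw [gaussianVolume, Measure.restrict_eq_zero.2 hnull, integral_zero_measure, mul_zero]

namespace HasDefiningFunctions

variable {E : Set (Space n)} (hE : HasDefiningFunctions E) (hc : Convex ℝ E) {a : ℝ}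
  (ha : psi a ≤ gaussianVolume E)

include hE hc ha

theorem le_inner_normal {x : Space n} (hx : x ∈ frontier E) : a ≤ inner ℝ x (normal E x) := by
  have hν := hE.isExteriorNormal hx
  have hi := interior_nonempty_of_gaussianVolume_pos hc ((psi_pos a).trans_le ha)
  have hsub : E ⊆ {y : Space n | inner ℝ y (normal E x) ≤ inner ℝ x (normal E x)} := by
    intro y hy
    have hle := hν.inner_sub_nonpos hc hi hx.1 (subset_closure hy)
    rwa [inner_sub_left, sub_nonpos] at hle
  have hvolume := ha.trans (gaussianVolume_mono hsub)
  rw [gaussianVolume_halfspace hν.1] at hvolume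
  exact strictMono_psi.le_iff_le.1 hvolume

theorem isRegularConvex (h0 : 0 ∈ E) (ha0 : 0 < a) : IsRegularConvex E where
  convex := hc
  mem_nhds := by
    rw [← mem_interior_iff_mem_nhds]
    by_contra hi
    have hle := hE.le_inner_normal hc ha ⟨subset_closure h0, hi⟩
    rw [inner_zero_left] at hle
    exact hle.not_gt ha0
  norm_normal x hx := (hE.isExteriorNormal hx).1
  inner_sub_nonpos x hx y hy := (hE.isExteriorNormal hx).inner_sub_nonpos hc
    (interior_nonempty_of_gaussianVolume_pos hc ((psi_pos a).trans_le ha)) hx.1 hy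
  locallyLipschitzOn := hE.locallyLipschitzOn_normal

end HasDefiningFunctions

/-! ### Comparison with the ball -/

section Ball

variable {r : ℝ} {x : Space n}

theorem mem_frontier_ball (hr : 0 < r) :
    x ∈ frontier (Metric.ball (0 : Space n) r) ↔ ‖x‖ = r := by
  rw [frontier_ball _ hr.ne', mem_sphere_zero_iff_norm]

theorem isExteriorNormal_ball (hr : 0 < r) (hx : ‖x‖ = r) :
    IsExteriorNormal (Metric.ball 0 r) x (r⁻¹ • x) := by
  have hnorm : ‖r⁻¹ • x‖ = 1 := by
    rw [norm_smul, norm_inv, Real.norm_of_nonneg hr.le, hx, inv_mul_cancel₀ hr.ne']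
  refine ⟨hnorm, fun ε hε => ?_⟩
  filter_upwards [Metric.ball_mem_nhds x (by positivity : 0 < 2 * r * ε)] with y hy
  rw [mem_ball_iff_norm] at hy
  have hsq : ‖y‖ ^ 2 = r ^ 2 + 2 * (r * inner ℝ (y - x) (r⁻¹ • x)) + ‖y - x‖ ^ 2 := by
    rw [real_inner_smul_right, mul_inv_cancel_left₀ hr.ne', ← hx]
    conv_lhs => rw [← sub_add_cancel y x, norm_add_sq_real]
    ring
  have hle : ‖y - x‖ ^ 2 ≤ 2 * r * ε * ‖y - x‖ := by
    rw [sq]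
    gcongr
  rw [mem_ball_zero_iff, not_lt]
  constructor
  · intro hlt
    have hmul := mul_lt_mul_of_pos_left hlt hr
    exact lt_of_pow_lt_pow_left₀ 2 hr.le (by linarith)
  · intro hlt
    have hpos : 0 ≤ r * (ε * ‖y - x‖) := by positivity
    have hmul := mul_lt_mul_of_pos_left hlt hr
    exact le_of_sq_le_sq (by linarith [sq_nonneg ‖y - x‖]) (norm_nonneg y)

theorem normal_ball (hr : 0 < r) (hx : ‖x‖ = r) : normal (Metric.ball 0 r) x = r⁻¹ • x :=
  (isExteriorNormal_ball hr hx).normal_eq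

theorem isRegularConvex_ball (hr : 0 < r) : IsRegularConvex (Metric.ball (0 : Space n) r) where
  convex := convex_ball 0 r
  mem_nhds := Metric.ball_mem_nhds 0 hr
  norm_normal x hx := by
    have hν := isExteriorNormal_ball hr ((mem_frontier_ball hr).1 hx)
    rw [hν.normal_eq, hν.1]
  inner_sub_nonpos x hx y hy := by
    have hν := isExteriorNormal_ball hr ((mem_frontier_ball hr).1 hx)
    rw [hν.normal_eq]
    refine hν.inner_sub_nonpos (convex_ball 0 r) ?_ hx.1 hy
    rw [Metric.isOpen_ball.interior_eq]
    exact Metric.nonempty_ball.2 hr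
  locallyLipschitzOn := by
    refine fun x _ => ⟨‖r⁻¹‖₊, _, self_mem_nhdsWithin, fun y hy z hz => ?_⟩
    rw [normal_ball hr ((mem_frontier_ball hr).1 hy), normal_ball hr ((mem_frontier_ball hr).1 hz)]
    exact lipschitzWith_smul r⁻¹ y z

theorem meanCurvature_ball (hr : 0 < r) (hx : ‖x‖ = r) :
    meanCurvature (Metric.ball 0 r) x = (n - 1) / r := by
  have hE := isRegularConvex_ball (n := n) hr
  have hxf := (mem_frontier_ball hr).2 hx
  have hgauge : DifferentiableAt ℝ (gauge (Metric.ball (0 : Space n) r)) x := by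
    rw [funext (gauge_ball hr.le)]
    have hnorm : DifferentiableAt ℝ (fun y : Space n => ‖y‖) x :=
      differentiableAt_id.norm ℝ (hE.ne_zero_of_mem_frontier hxf)
    fun_prop
  have hderiv : HasFDerivAt (fun y : Space n => r⁻¹ • y)
      (r⁻¹ • ContinuousLinearMap.id ℝ (Space n)) x := (hasFDerivAt_id x).const_smul r⁻¹
  have htrace : LinearMap.trace ℝ (Space n) (ContinuousLinearMap.id ℝ (Space n)) = n := by
    rw [ContinuousLinearMap.coe_id, LinearMap.trace_id, finrank_euclideanSpace_fin]
  rw [hE.meanCurvature_eq_trace_sub hxf hgauge hderiv fun y hy =>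
    (normal_ball hr ((mem_frontier_ball hr).1 hy)).symm, ContinuousLinearMap.toLinearMap_smul,
    map_smul, htrace, _root_.smul_apply, ContinuousLinearMap.id_apply, real_inner_smul_left,
    real_inner_self_eq_norm_sq, hE.norm_normal x hxf, smul_eq_mul]
  ring

theorem inner_normal_ball (hr : 0 < r) (hx : ‖x‖ = r) :
    inner ℝ x (normal (Metric.ball 0 r) x) = r := by
  rw [normal_ball hr hx, real_inner_smul_right, real_inner_self_eq_norm_sq, hx]
  field_simp

theorem curvatureEnergy_ball (hn : 3 ≤ n) (hr : 0 < r) :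
    curvatureEnergy (Metric.ball (0 : Space n) r) =
      (n - 1) * ∫ x in Metric.ball (0 : Space n) r, radialDivergence x := by
  rw [← (isRegularConvex_ball hr).integral_inner_div_sq hn, ← integral_const_mul]
  refine integral_congr_ae (IsRegularConvex.ae_boundaryMeasure_mem_frontier.mono fun x hx => ?_)
  rw [mem_frontier_ball hr] at hx
  simp only [curvatureDensity, meanCurvature_ball hr hx, inner_normal_ball hr hx, hx]
  field_simp

theorem radialEnergy_ball (hr : 0 < r) :
    radialEnergy (Metric.ball (0 : Space n) r) = curvatureEnergy (Metric.ball (0 : Space n) r) := by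
  refine integral_congr_ae (IsRegularConvex.ae_boundaryMeasure_mem_frontier.mono fun x hx => ?_)
  rw [mem_frontier_ball hr] at hx
  simp only [radialDensity, inner_normal_ball hr hx, hx, div_self hr.ne', one_mul]

end Ball

theorem setIntegral_le_setIntegral_of_sign {X : Type*} [MeasurableSpace X] {μ : Measure X}
    {f : X → ℝ} (hf : Integrable f μ) {A B : Set X} (hA : NullMeasurableSet A μ)
    (hB : MeasurableSet B) (hnonneg : ∀ᵐ x ∂μ, x ∈ B → 0 ≤ f x)
    (hnonpos : ∀ᵐ x ∂μ, x ∉ B → f x ≤ 0) :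
    ∫ x in A, f x ∂μ ≤ ∫ x in B, f x ∂μ := by
  rw [← integral_indicator₀ hA, ← integral_indicator hB]
  refine integral_mono_ae (hf.indicator₀ hA) (hf.indicator hB) ?_
  filter_upwards [hnonneg, hnonpos] with x hnonneg hnonpos
  by_cases hx : x ∈ B
  · rw [indicator_of_mem hx]
    exact indicator_apply_le' (fun _ => le_rfl) fun _ => hnonneg hx
  · rw [indicator_of_notMem hx]
    exact indicator_apply_le' (fun _ => hnonpos hx) fun _ => le_rfl

theorem setIntegral_radialDivergence_le (hn : 3 ≤ n) {E : Set (Space n)} (hc : Convex ℝ E) {r : ℝ}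
    (hr : 0 < r) (h : gaussianVolume E = gaussianVolume (Metric.ball (0 : Space n) r)) :
    ∫ x in E, radialDivergence x ≤ ∫ x in Metric.ball (0 : Space n) r, radialDivergence x := by
  have : Nonempty (Fin n) := ⟨⟨0, by omega⟩⟩
  have hn2 : (0 : ℝ) ≤ n - 2 := sub_nonneg.2 (by exact_mod_cast (by omega : 2 ≤ n))
  have hvol : ∫ x in E, Real.exp (-‖x‖ ^ 2 / 2) =
      ∫ x in Metric.ball (0 : Space n) r, Real.exp (-‖x‖ ^ 2 / 2) :=
    mul_left_cancel₀ (by positivity) h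
  let c : ℝ := (n - 2) / r ^ 2 - 1
  have hF := integrable_radialDivergence hn
  have hG := (integrable_exp_neg_norm_sq_div_two (V := Space n)).const_mul c
  have hdiff (x : Space n) : radialDivergence x - c * Real.exp (-‖x‖ ^ 2 / 2) =
      ((n - 2) / ‖x‖ ^ 2 - (n - 2) / r ^ 2) * Real.exp (-‖x‖ ^ 2 / 2) := by
    simp only [radialDivergence, radialProfile, c]
    ring
  have hle : ∫ x in E, (radialDivergence x - c * Real.exp (-‖x‖ ^ 2 / 2)) ≤
      ∫ x in Metric.ball (0 : Space n) r, (radialDivergence x - c * Real.exp (-‖x‖ ^ 2 / 2)) := by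
    refine setIntegral_le_setIntegral_of_sign (hF.sub hG) (hc.nullMeasurableSet _)
      measurableSet_ball ?_ (ae_of_all _ fun x hx => ?_)
    · filter_upwards [compl_mem_ae_iff.2 (measure_singleton (0 : Space n))] with x hx0 hx
      have hpos : 0 < ‖x‖ := norm_pos_iff.2 hx0
      rw [mem_ball_zero_iff] at hx
      rw [Pi.sub_apply, hdiff]
      refine mul_nonneg (sub_nonneg.2 ?_) (Real.exp_nonneg _)
      gcongr
    · rw [mem_ball_zero_iff, not_lt] at hx
      rw [Pi.sub_apply, hdiff]
      refine mul_nonpos_of_nonpos_of_nonneg (sub_nonpos.2 ?_) (Real.exp_nonneg _)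
      gcongr
  rwa [integral_sub hF.integrableOn hG.integrableOn, integral_sub hF.integrableOn hG.integrableOn,
    integral_const_mul, integral_const_mul, hvol, sub_le_sub_iff_right] at hle

theorem radial_comparison {k K p t : ℝ} (hp : 0 < p) (hpt : p ≤ t) (hk : k ≤ p ^ 2 + 1)
    (hK : K ≤ p) :
    k / t - (1 / t + 1 / t ^ 3) * (t ^ 2 - p ^ 2) + (1 - p / t) * K ≤ k * (p / t ^ 2) := by
  have ht : 0 < t := hp.trans_le hpt
  have hfactor : k * (p / t ^ 2) -
      (k / t - (1 / t + 1 / t ^ 3) * (t ^ 2 - p ^ 2) + (1 - p / t) * K) =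
      (t - p) * ((t ^ 2 + 1) * (t + p) - k * t - t ^ 2 * K) / t ^ 3 := by
    field_simp
    ring
  have hquad : 0 ≤ t ^ 3 - t * p ^ 2 + p := by nlinarith [mul_nonneg ht.le (sub_nonneg.2 hpt)]
  have hbracket : 0 ≤ (t ^ 2 + 1) * (t + p) - k * t - t ^ 2 * K := by
    linarith [mul_le_mul_of_nonneg_right hk ht.le, mul_le_mul_of_nonneg_left hK (sq_nonneg t)]
  rw [← sub_nonneg, hfactor]
  exact div_nonneg (mul_nonneg (sub_nonneg.2 hpt) hbracket) (by positivity)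

namespace IsRegularConvex

variable {E : Set (Space n)} (hE : IsRegularConvex E)

include hE

theorem integrable_inner_div_sq :
    Integrable (fun x => inner ℝ x (normal E x) / ‖x‖ ^ 2 * Real.exp (-‖x‖ ^ 2 / 2))
      (boundaryMeasure E) := by
  have hcont : ContinuousOn
      (fun x => inner ℝ x (normal E x) / ‖x‖ ^ 2 * Real.exp (-‖x‖ ^ 2 / 2)) (frontier E) :=
    (hE.continuousOn_inner_normal.div (by fun_prop) fun x hx =>
      pow_ne_zero 2 (norm_ne_zero_iff.2 (hE.ne_zero_of_mem_frontier hx))).mul (by fun_prop)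
  refine integrable_of_continuousOn_of_le hE.integrable_weight hcont fun x hx => ?_
  have hpos := hE.inner_normal_pos hx
  have ht : 0 < ‖x‖ := norm_pos_iff.2 (hE.ne_zero_of_mem_frontier hx)
  rw [abs_of_nonneg (by positivity), weight, div_eq_inv_mul (Real.exp _)]
  gcongr
  rw [div_le_iff₀ (by positivity), sq, inv_mul_cancel_left₀ ht.ne']
  exact hE.inner_normal_le_norm hx

theorem integrable_curvatureDensity {M : ℝ}
    (hH : ∀ᵐ x ∂boundaryMeasure E, |meanCurvature E x| ≤ M) :
    Integrable (curvatureDensity E) (boundaryMeasure E) := by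
  refine ((hE.integrable_exp one_half_pos).const_mul M).mono'
    (hE.aestronglyMeasurable_meanCurvature.mul
      (Continuous.aestronglyMeasurable (by fun_prop))) (hH.mono fun x hx => ?_)
  rw [curvatureDensity, norm_mul, Real.norm_eq_abs, Real.norm_of_nonneg (Real.exp_nonneg _),
    neg_div, div_eq_inv_mul, ← one_div, ← neg_mul]
  gcongr

theorem radialEnergy_add_le (hn : 2 ≤ n)
    (hinner : ∀ x ∈ frontier E, √(n - 2) ≤ inner ℝ x (normal E x))
    (hi : Integrable (curvatureDensity E) (boundaryMeasure E)) {K : Space n → ℝ}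
    (hK : ∀ᵐ x ∂boundaryMeasure E, K x ≤ inner ℝ x (normal E x))
    (hKi : Integrable (fun x => (1 - inner ℝ x (normal E x) / ‖x‖) *
      (K x * Real.exp (-‖x‖ ^ 2 / 2))) (boundaryMeasure E)) :
    radialEnergy E + ∫ x, (1 - inner ℝ x (normal E x) / ‖x‖) *
        (K x * Real.exp (-‖x‖ ^ 2 / 2)) ∂boundaryMeasure E ≤
      (n - 1) * ∫ x, inner ℝ x (normal E x) / ‖x‖ ^ 2 * Real.exp (-‖x‖ ^ 2 / 2)
        ∂boundaryMeasure E := by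
  have hri : Integrable (fun x => (n - 1) * weight x - tangentialTerm E x) (boundaryMeasure E) :=
    (hE.integrable_weight.const_mul _).sub hE.integrable_tangentialTerm
  rw [hE.radialEnergy_eq hn hi, ← integral_add hri hKi, ← integral_const_mul]
  refine integral_mono_ae (hri.add hKi) (hE.integrable_inner_div_sq.const_mul _) ?_
  filter_upwards [ae_boundaryMeasure_mem_frontier, hK] with x hx hKx
  have hsq : (n : ℝ) - 1 ≤ inner ℝ x (normal E x) ^ 2 + 1 := by
    linarith [(Real.sqrt_le_left (hE.inner_normal_pos hx).le).1 (hinner x hx)]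
  have hcomparison := mul_le_mul_of_nonneg_right (radial_comparison (hE.inner_normal_pos hx)
    (hE.inner_normal_le_norm hx) hsq hKx) (Real.exp_nonneg (-‖x‖ ^ 2 / 2))
  rw [mul_assoc] at hcomparison
  refine le_of_eq_of_le ?_ hcomparison
  rw [weight, tangentialTerm]
  ring

theorem radialEnergy_le (hn : 2 ≤ n)
    (hinner : ∀ x ∈ frontier E, √(n - 2) ≤ inner ℝ x (normal E x))
    (hi : Integrable (curvatureDensity E) (boundaryMeasure E)) :
    radialEnergy E ≤ (n - 1) * ∫ x, inner ℝ x (normal E x) / ‖x‖ ^ 2 *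
      Real.exp (-‖x‖ ^ 2 / 2) ∂boundaryMeasure E := by
  simpa only [zero_mul, mul_zero, integral_zero, add_zero] using
    hE.radialEnergy_add_le hn hinner hi (K := fun _ => 0)
      (ae_boundaryMeasure_mem_frontier.mono fun x hx => (hE.inner_normal_pos hx).le)
      (by simp)

theorem curvatureEnergy_le (hn : 2 ≤ n)
    (hinner : ∀ x ∈ frontier E, √(n - 2) ≤ inner ℝ x (normal E x))
    (hi : Integrable (curvatureDensity E) (boundaryMeasure E))
    (hH : ∀ᵐ x ∂boundaryMeasure E, meanCurvature E x ≤ inner ℝ x (normal E x)) :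
    curvatureEnergy E ≤ (n - 1) * ∫ x, inner ℝ x (normal E x) / ‖x‖ ^ 2 *
      Real.exp (-‖x‖ ^ 2 / 2) ∂boundaryMeasure E := by
  have hri := hE.integrable_radialDensity hi
  have hsub : curvatureDensity E - radialDensity E =
      fun x => (1 - inner ℝ x (normal E x) / ‖x‖) * curvatureDensity E x := by
    ext x
    rw [Pi.sub_apply, radialDensity, one_sub_mul]
  have hle := hE.radialEnergy_add_le hn hinner hi hH (hsub ▸ hi.sub hri)
  have hadd : radialEnergy E + ∫ x, (curvatureDensity E - radialDensity E) x ∂boundaryMeasure E =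
      curvatureEnergy E := by
    rw [integral_sub' hi hri]
    exact add_sub_cancel _ _
  rw [hsub] at hadd
  exact hadd.symm.trans_le hle

theorem le_curvatureEnergy_ball (hn : 3 ≤ n) {r : ℝ} (hr : 0 < r)
    (hvol : gaussianVolume E = gaussianVolume (Metric.ball (0 : Space n) r)) :
    (n - 1) * ∫ x, inner ℝ x (normal E x) / ‖x‖ ^ 2 * Real.exp (-‖x‖ ^ 2 / 2)
        ∂boundaryMeasure E ≤
      curvatureEnergy (Metric.ball (0 : Space n) r) := by
  rw [hE.integral_inner_div_sq hn, curvatureEnergy_ball hn hr]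
  have hn1 : (0 : ℝ) ≤ n - 1 := sub_nonneg.2 (by exact_mod_cast (by omega : 1 ≤ n))
  exact mul_le_mul_of_nonneg_left (setIntegral_radialDivergence_le hn hE.convex hr hvol) hn1

end IsRegularConvex

theorem ae_abs_le_of_eLpNorm_top_le {X : Type*} [MeasurableSpace X] {μ : Measure X} {f : X → ℝ}
    {M : ℝ} (hM : 0 ≤ M) (h : eLpNorm f ⊤ μ ≤ ENNReal.ofReal M) : ∀ᵐ x ∂μ, |f x| ≤ M := by
  rw [eLpNorm_exponent_top] at h
  filter_upwards [ae_le_eLpNormEssSup (f := f)] with x hx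
  rw [← ENNReal.ofReal_le_ofReal_iff hM, ← Real.enorm_eq_ofReal_abs]
  exact hx.trans h

end GaussianCurvature

end

open GaussianCurvature in
theorem theorem4p4_general {n : ℕ} (hn : 3 ≤ n) {r : ℝ} (hr : 0 < r) {E : Set (Space n)}
    (hc : Convex ℝ E) (hD : HasDefiningFunctions E) (h0 : 0 ∈ E)
    (hn2 : psi (√(n - 2)) ≤ gaussianVolume E)
    (hvol : gaussianVolume E = gaussianVolume (Metric.ball (0 : Space n) r)) :
    (∀ M : ℝ, 0 ≤ M → psi M ≤ gaussianVolume E →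
      eLpNorm (meanCurvature E) ⊤ (boundaryMeasure E) ≤ ENNReal.ofReal M →
      Integrable (curvatureDensity E) (boundaryMeasure E) ∧
      curvatureEnergy E ≤ curvatureEnergy (Metric.ball (0 : Space n) r)) ∧
    (Integrable (curvatureDensity E) (boundaryMeasure E) →
      Integrable (radialDensity E) (boundaryMeasure E) ∧
      radialEnergy E ≤ radialEnergy (Metric.ball (0 : Space n) r)) := by
  have hroot : 0 < √((n : ℝ) - 2) :=
    Real.sqrt_pos.2 (sub_pos.2 (by exact_mod_cast (by omega : 2 < n)))
  have hE := hD.isRegularConvex hc hn2 h0 hroot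
  have hinner : ∀ x ∈ frontier E, √(n - 2) ≤ inner ℝ x (normal E x) :=
    fun x hx => hD.le_inner_normal hc hn2 hx
  have hball := hE.le_curvatureEnergy_ball hn hr hvol
  refine ⟨fun M hM hψM hbound => ?_, fun hi => ⟨hE.integrable_radialDensity hi, ?_⟩⟩
  · have habs := ae_abs_le_of_eLpNorm_top_le hM hbound
    have hi := hE.integrable_curvatureDensity habs
    refine ⟨hi, (hE.curvatureEnergy_le (by omega) hinner hi ?_).trans hball⟩
    filter_upwards [IsRegularConvex.ae_boundaryMeasure_mem_frontier, habs] with x hx hHx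
    exact (le_abs_self _).trans (hHx.trans (hD.le_inner_normal hc hψM hx))
  · rw [radialEnergy_ball hr]
    exact (hE.radialEnergy_le (by omega) hinner hi).trans hball

theorem theorem4p4 (n : ℕ) (hn : 3 ≤ n) (m r : ℝ) (hr : 0 < r)
    (hball : GaussianCurvature.gaussianVolume (Metric.ball (0 : GaussianCurvature.Space n) r) = m) :
    (∀ M : ℝ, 0 < M →
      max (GaussianCurvature.psi (2 * M)) (GaussianCurvature.psi (Real.sqrt ((n : ℝ) - 2))) ≤ m →
      ∀ E : Set (GaussianCurvature.Space n),
        Convex ℝ E → GaussianCurvature.IsClassC2 E → (0 : GaussianCurvature.Space n) ∈ E →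
        GaussianCurvature.gaussianVolume E = m →
        eLpNorm (GaussianCurvature.meanCurvature E) ⊤ (GaussianCurvature.boundaryMeasure E)
          ≤ ENNReal.ofReal M →
        Integrable (GaussianCurvature.curvatureDensity E) (GaussianCurvature.boundaryMeasure E) ∧
        GaussianCurvature.curvatureEnergy E ≤
          GaussianCurvature.curvatureEnergy (Metric.ball (0 : GaussianCurvature.Space n) r)) ∧
    (GaussianCurvature.psi (Real.sqrt ((n : ℝ) - 2)) ≤ m →
      ∀ E : Set (GaussianCurvature.Space n),
        Convex ℝ E → GaussianCurvature.IsClassC11 E → (0 : GaussianCurvature.Space n) ∈ E →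
        GaussianCurvature.gaussianVolume E = m →
        Integrable (GaussianCurvature.curvatureDensity E) (GaussianCurvature.boundaryMeasure E) →
        Integrable (GaussianCurvature.radialDensity E) (GaussianCurvature.boundaryMeasure E) ∧
        GaussianCurvature.radialEnergy E ≤
          GaussianCurvature.radialEnergy (Metric.ball (0 : GaussianCurvature.Space n) r)) := by
  refine ⟨fun M hM hm E hc hC2 h0 hvol hbound => ?_, fun hm E hc hC11 h0 hvol hi => ?_⟩
  · have hpsi : GaussianCurvature.psi M ≤ GaussianCurvature.gaussianVolume E :=
      (GaussianCurvature.strictMono_psi.monotone (by linarith)).trans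
        ((le_max_left _ _).trans (hm.trans_eq hvol.symm))
    exact (theorem4p4_general hn hr hc hC2.hasDefiningFunctions h0
      ((le_max_right _ _).trans (hm.trans_eq hvol.symm)) (hvol.trans hball.symm)).1
      M hM.le hpsi hbound
  · exact (theorem4p4_general hn hr hc hC11.hasDefiningFunctions h0 (hm.trans_eq hvol.symm)
      (hvol.trans hball.symm)).2 hi
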